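/- Setting. Let $\rho$ be a probability distribution on the unit sphere $\mathcal S^{d-1}\subset\mathbb R^d$ such that, for every $n$, almost surely no two of $n$ independent samples from $\rho$ are parallel, and let $f^*:\mathcal S^{d-1}\to\mathbb R$ be measurable with values in $[-1,1]$ ($\rho$-a.e.). The data are $x_1,\dots,x_n$ i.i.d. from $\rho$ and $y_i=f^*(x_i)$. The network is $f_{W,a}(x)=\frac1{\sqrt m}\sum_{j=1}^m a_j\max\{\langle x,w_j\rangle,0\}$, with $w_j^0\sim\mathcal N(0,\nu^2 I)$ and $a_j$ uniform on $\{1,-1\}$, all independent and independent of the data. The $a_j$ are kept fixed and the $w_j$ are trained by gradient descent with stepsize $\eta$ on $\frac1{2n}\sum_i(y_i-f_{W,a}(x_i))^2$, i.e. $$w_j^{t+1}=w_j^t+\frac{\eta a_j}{n\sqrt m}\sum_{i=1}^n\big(y_i-\hat y_i(t)\big)\,x_i\,\mathbf 1\{\langle w_j^t,x_i\rangle>0\},\qquad \hat y_i(t)=f_{W^t,a}(x_i);$$ $y$ and $\hat y(t)$ denote the vectors in $\mathbb R^n$ with entries $y_i$ and $\hat y_i(t)$. Let $L_{\mathcal K}$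 be the integral operator $(L_{\mathcal K}f)(x)=\int\mathcal K(x,s)f(s)\,d\rho(s)$ on $L^2(\mathcal S^{d-1},\rho)$ with kernel $\mathcal K(x,s)=\frac{\langle x,s\rangle}{2\pi}(\pi-\arccos\langle x,s\rangle)$. Let $\mu_1>\mu_2>\cdots$ be its distinct eigenvalues, $P_{\mu_i}$ the orthogonal projection onto the eigenspace of $\mu_i$, $\lambda_1\ge\lambda_2\ge\cdots$ its eigenvalues repeated according to multiplicity (padded with zeros), and $m_\ell$ the sum of the multiplicities of $\mu_1,\dots,\mu_\ell$, so that $\lambda_{m_\ell}=\mu_\ell>\lambda_{m_\ell+1}$ when $\mu_\ell>0$. Put $\mathrm{gap}_\ell=\lambda_{m_\ell}-\lambda_{m_\ell+1}$ and $\epsilon(f^*,\ell)=\sup_x\big|f^*(x)-\sum_{i\le\ell}(P_{\mu_i}f^*)(x)\big|$ ($\rho$-essential supremum). Claim. There is an absolute constant $C>0$ such that the following holds. Suppose $\ell\ge1$, $\mu_1,\dots,\mu_\ell>0$ and $\epsilon(f^*,\ell)=0$. Let $\nu=\frac1{\sqrt n}$, $\eta=1$ and $T=\log(n\,\mathrm{gap}_\ell)$.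 If $\delta\in(0,\frac14)$, $n>\max\Big\{\frac{256\log\frac2\delta}{\mathrm{gap}_\ell^2},\,m_\ell\Big\}$ and $$m\ \ge\ C\,\mathrm{gap}_\ell^2\,n^2\Big(\frac1{\lambda_{m_\ell}}+\frac{\log n}{\mathrm{gap}_\ell\sqrt n}\Big)^4,$$ then with probability at least $1-3\delta$, for all integers $0\le t\le T$, $$\Big\|\tfrac1{\sqrt n}\big(y-\hat y(t)\big)\Big\|\ \le\ \Big(1-\frac{3\lambda_{m_\ell}}4\Big)^t+\frac{16\sqrt{2\log(2/\delta)}}{\sqrt n\ \mathrm{gap}_\ell}.\qquad(*)$$ In particular, quadratic over-parameterization suffices for a constant linear rate down to an error $O(1/\sqrt n)$: $\mathrm{gap}_\ell>0$, $0<1-\frac{3\lambda_{m_\ell}}4<1$, and there is a constant $c>0$, depending only on the problem ($d,\rho,f^*,\ell$) and not on $n,m,\delta$, such that for every $\delta\in(0,\frac14)$ and every $n$ as above, already $m\ge c\,n^2$ implies that $(*)$ holds for all $0\le t\le T$ with probability at least $1-3\delta$. -/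

import Mathlib

open MeasureTheory ProbabilityTheory
open scoped ENNReal RealInnerProductSpace

noncomputable section

namespace TwoLayer

/-- The ambient Euclidean space `ℝ^d`. -/
abbrev E (d : ℕ) : Type := EuclideanSpace ℝ (Fin d)

/-- The unit sphere `S^{d-1}` in `ℝ^d`, where the feature vectors live. -/
abbrev S (d : ℕ) : Type := Metric.sphere (0 : E d) 1

/-! ### The network and gradient descent -/

/-- The ReLU activation `[u]_+ = max {u, 0}`. -/
def relu (u : ℝ) : ℝ := max u 0

/-- The two-layer network `f_{W,a}(x) = m^{-1/2} ∑_j a_j [⟨x, w_j⟩]_+`. -/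
def network {d m : ℕ} (a : Fin m → ℝ) (W : Fin m → E d) (x : E d) : ℝ :=
  (1 / Real.sqrt m) * ∑ j, a j * relu ⟪x, W j⟫

/-- One gradient descent step with stepsize `η` on the first-layer weights for the empirical risk
`L_n(W) = (1 / 2n) ∑_i (y_i - f_{W,a}(x_i))^2`, with the usual convention that the derivative of the
ReLU at `u` is the indicator of `u > 0`:
`w_j ↦ w_j + (η a_j / (n √m)) ∑_i (y_i - f_{W,a}(x_i)) 1{⟨w_j, x_i⟩ > 0} x_i`. -/
def gdStep {d m n : ℕ} (η : ℝ) (a : Fin m → ℝ) (x : Fin n → S d) (y : Fin n → ℝ)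
    (W : Fin m → E d) : Fin m → E d := fun j =>
  W j + (η * a j / (n * Real.sqrt m)) •
    ∑ i, ((y i - network a W (x i)) * (if 0 < ⟪W j, (x i : E d)⟫ then 1 else 0)) • (x i : E d)

/-- The gradient descent iterates `W^t`, started at `W^0 = W`. -/
def gdIter {d m n : ℕ} (η : ℝ) (a : Fin m → ℝ) (x : Fin n → S d) (y : Fin n → ℝ)
    (W : Fin m → E d) : ℕ → Fin m → E d
  | 0 => W
  | t + 1 => gdStep η a x y (gdIter η a x y W t)

/-- The normalized training error `‖n^{-1/2} (y - ŷ(t))‖` (Euclidean norm in `ℝ^n`), where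
`y_i = f(x_i)` and `ŷ_i(t) = f_{W^t,a}(x_i)`. -/
def trainError {d m n : ℕ} (η : ℝ) (f : S d → ℝ) (x : Fin n → S d) (a : Fin m → ℝ)
    (W : Fin m → E d) (t : ℕ) : ℝ :=
  ‖(1 / Real.sqrt n) • (WithLp.toLp 2
    (fun i => f (x i) - network a (gdIter η a x (fun k => f (x k)) W t) (x i)) :
      EuclideanSpace ℝ (Fin n))‖

/-! ### The random data set and the random initialization -/

/-- The Gaussian law `N(0, ν^2 I)` on `ℝ^d`. -/
def gaussianInit (d : ℕ) (ν : ℝ) : Measure (E d) :=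
  (stdGaussian (E d)).map (fun w => ν • w)

/-- The uniform law on `{1, -1}`. -/
def signLaw : Measure ℝ :=
  (2⁻¹ : ℝ≥0∞) • Measure.dirac 1 + (2⁻¹ : ℝ≥0∞) • Measure.dirac (-1)

/-- The joint law of the data set `(x_1, …, x_n)` (i.i.d. from `ρ`), the initial first-layer weights
`(w_1, …, w_m)` (i.i.d. `N(0, ν^2 I)`) and the second-layer weights `(a_1, …, a_m)` (i.i.d. uniform
signs), all of them independent. -/
def sampleLaw {d : ℕ} (ρ : Measure (S d)) (n m : ℕ) (ν : ℝ) :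
    Measure ((Fin n → S d) × (Fin m → E d) × (Fin m → ℝ)) :=
  (Measure.pi fun _ : Fin n => ρ).prod
    ((Measure.pi fun _ : Fin m => gaussianInit d ν).prod (Measure.pi fun _ : Fin m => signLaw))

/-- For every `n`, almost surely no two of `n` independent samples from `ρ` are parallel. -/
def NoParallel {d : ℕ} (ρ : Measure (S d)) : Prop :=
  ∀ n : ℕ, ∀ᵐ x ∂(Measure.pi fun _ : Fin n => ρ),
    ∀ i j : Fin n, i ≠ j → ¬ ∃ c : ℝ, (x i : E d) = c • (x j : E d)

/-! ### The integral operator and its spectrum -/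

/-- The kernel `K(x, s) = ⟨x, s⟩ (π - arccos ⟨x, s⟩) / (2 π)`. -/
def kernel {d : ℕ} (x s : S d) : ℝ :=
  ⟪(x : E d), (s : E d)⟫ / (2 * Real.pi) * (Real.pi - Real.arccos ⟪(x : E d), (s : E d)⟫)

theorem continuous_kernel {d : ℕ} : Continuous (Function.uncurry (kernel (d := d))) := by
  unfold kernel Function.uncurry
  have h : Continuous fun p : S d × S d => ⟪(p.1 : E d), (p.2 : E d)⟫ := by fun_prop
  exact (h.div_const _).mul (continuous_const.sub (Real.continuous_arccos.comp h))

theorem abs_kernel_le {d : ℕ} (x s : S d) : |kernel x s| ≤ 1 := by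
  unfold kernel
  have h1 : |⟪(x : E d), (s : E d)⟫| ≤ 1 := by
    have := abs_real_inner_le_norm (x : E d) (s : E d)
    simpa using this
  have h2 := Real.arccos_nonneg ⟪(x : E d), (s : E d)⟫
  have h3 := Real.arccos_le_pi ⟪(x : E d), (s : E d)⟫
  have hpi := Real.pi_pos
  rw [abs_mul, abs_div, abs_of_pos (by positivity : (0 : ℝ) < 2 * Real.pi),
    abs_of_nonneg (by linarith : 0 ≤ Real.pi - Real.arccos ⟪(x : E d), (s : E d)⟫),
    div_mul_eq_mul_div, div_le_one (by positivity)]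
  nlinarith [abs_nonneg ⟪(x : E d), (s : E d)⟫]

section Operator

variable {d : ℕ} (ρ : Measure (S d)) [IsProbabilityMeasure ρ]

/-- The function `x ↦ ∫ K(x, s) f(s) dρ(s)`. -/
def kernelFun (f : S d → ℝ) (x : S d) : ℝ := ∫ s, kernel x s * f s ∂ρ

theorem integrable_kernel_mul (f : Lp ℝ 2 ρ) (x : S d) :
    Integrable (fun s => kernel x s * f s) ρ := by
  refine Integrable.bdd_mul (c := 1) ((Lp.memLp f).integrable (by norm_num)) ?_ ?_
  · exact (continuous_kernel.comp (Continuous.prodMk_right x)).aestronglyMeasurable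
  · exact Filter.Eventually.of_forall fun s => abs_kernel_le x s

theorem stronglyMeasurable_kernelFun (f : Lp ℝ 2 ρ) :
    StronglyMeasurable (kernelFun ρ f) := by
  have h : StronglyMeasurable (Function.uncurry fun x s : S d => kernel x s * f s) :=
    continuous_kernel.stronglyMeasurable.mul
      ((Lp.stronglyMeasurable f).comp_measurable measurable_snd)
  exact h.integral_prod_right

theorem norm_kernelFun_le (f : Lp ℝ 2 ρ) (x : S d) : ‖kernelFun ρ f x‖ ≤ ‖f‖ := by
  have hf : Integrable f ρ := (Lp.memLp f).integrable (by norm_num)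
  calc ‖kernelFun ρ f x‖ ≤ ∫ s, ‖f s‖ ∂ρ := by
        refine (norm_integral_le_integral_norm _).trans
          (integral_mono (integrable_kernel_mul ρ f x).norm hf.norm fun s => ?_)
        simp only [norm_mul]
        exact mul_le_of_le_one_left (norm_nonneg _) (abs_kernel_le x s)
    _ = (eLpNorm f 1 ρ).toReal := by
        rw [integral_norm_eq_lintegral_enorm hf.1, eLpNorm_one_eq_lintegral_enorm]
    _ ≤ (eLpNorm f 2 ρ).toReal :=
        ENNReal.toReal_mono (Lp.eLpNorm_ne_top f)
          (eLpNorm_le_eLpNorm_of_exponent_le (by norm_num) hf.1)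
    _ = ‖f‖ := (Lp.norm_def f).symm

theorem memLp_kernelFun (f : Lp ℝ 2 ρ) : MemLp (kernelFun ρ f) 2 ρ :=
  MemLp.of_bound (stronglyMeasurable_kernelFun ρ f).aestronglyMeasurable ‖f‖
    (Filter.Eventually.of_forall (norm_kernelFun_le ρ f))

/-- The integral operator `(L_K f)(x) = ∫ K(x, s) f(s) dρ(s)` on `L^2(S^{d-1}, ρ)`. -/
def kernelOp : Lp ℝ 2 ρ →L[ℝ] Lp ℝ 2 ρ :=
  LinearMap.mkContinuous
    { toFun := fun f => (memLp_kernelFun ρ f).toLp (kernelFun ρ f)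
      map_add' := fun f g => by
        rw [← MemLp.toLp_add]
        refine MemLp.toLp_congr _ _ (Filter.Eventually.of_forall fun x => ?_)
        have h : (fun s => kernel x s * (f + g : Lp ℝ 2 ρ) s) =ᵐ[ρ]
            fun s => kernel x s * f s + kernel x s * g s := by
          filter_upwards [Lp.coeFn_add f g] with s hs
          rw [hs, Pi.add_apply, mul_add]
        simp only [kernelFun, Pi.add_apply]
        rw [integral_congr_ae h,
          integral_add (integrable_kernel_mul ρ f x) (integrable_kernel_mul ρ g x)]
      map_smul' := fun c f => by
        rw [RingHom.id_apply, ← MemLp.toLp_const_smul]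
        refine MemLp.toLp_congr _ _ (Filter.Eventually.of_forall fun x => ?_)
        have h : (fun s => kernel x s * (c • f : Lp ℝ 2 ρ) s) =ᵐ[ρ]
            fun s => c * (kernel x s * f s) := by
          filter_upwards [Lp.coeFn_smul c f] with s hs
          rw [hs, Pi.smul_apply, smul_eq_mul]
          ring
        simp only [kernelFun, Pi.smul_apply, smul_eq_mul]
        rw [integral_congr_ae h, integral_const_mul] }
    1 (fun f => by
      rw [one_mul]
      have h := Lp.norm_le_of_ae_bound (f := (memLp_kernelFun ρ f).toLp (kernelFun ρ f))
        (norm_nonneg f) (by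
          filter_upwards [(memLp_kernelFun ρ f).coeFn_toLp] with x hx
          rw [hx]
          exact norm_kernelFun_le ρ f x)
      simpa [measureUnivNNReal] using h)

/-- The eigenspace of `L_K` for the real number `μ` (it is `⊥` if `μ` is not an eigenvalue). -/
def eigSpace (μ : ℝ) : Submodule ℝ (Lp ℝ 2 ρ) :=
  Module.End.eigenspace (kernelOp ρ : Lp ℝ 2 ρ →ₗ[ℝ] Lp ℝ 2 ρ) μ

theorem isClosed_eigSpace (μ : ℝ) : IsClosed (eigSpace ρ μ : Set (Lp ℝ 2 ρ)) := by
  have h : (eigSpace ρ μ : Set (Lp ℝ 2 ρ)) = {f | kernelOp ρ f = μ • f} := by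
    ext f
    simp [eigSpace]
  rw [h]
  exact isClosed_eq (kernelOp ρ).continuous (continuous_const_smul μ)

instance completeSpace_eigSpace (μ : ℝ) : CompleteSpace (eigSpace ρ μ) :=
  (isClosed_eigSpace ρ μ).completeSpace_coe

/-- The set of eigenvalues of `L_K`. -/
def eigs : Set ℝ :=
  {μ | Module.End.HasEigenvalue (kernelOp ρ : Lp ℝ 2 ρ →ₗ[ℝ] Lp ℝ 2 ρ) μ}

/-- The distinct eigenvalues of `L_K` in decreasing order; `distinctEig ρ i` is the
`(i+1)`-st largest one, `μ_{i+1}`. The operator is compact, self-adjoint and positive, so every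
supremum that is positive is attained; once the positive eigenvalues are exhausted, all further
terms are `0`. -/
def distinctEig : ℕ → ℝ
  | 0 => sSup (eigs ρ)
  | i + 1 => sSup {μ | μ ∈ eigs ρ ∧ μ < distinctEig i}

/-- The eigenvalues `λ_1 ≥ λ_2 ≥ …` of `L_K` repeated according to multiplicity (first index `1`):
`λ_i` is the largest `μ > 0` such that the eigenvalues `≥ μ` have total multiplicity at least `i`,
and `λ_i = 0` if there is no such `μ`. -/
def eig (i : ℕ) : ℝ :=
  sSup {μ : ℝ | 0 < μ ∧ (i : Cardinal) ≤ Module.rank ℝ (⨆ θ ≥ μ, eigSpace ρ θ : Submodule ℝ _)}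

/-- `m_ℓ`: the sum of the multiplicities of the `ℓ` largest distinct eigenvalues `μ_1, …, μ_ℓ`. -/
def multSum (ℓ : ℕ) : ℕ :=
  ∑ i ∈ Finset.range ℓ, Module.finrank ℝ (eigSpace ρ (distinctEig ρ i))

/-- The eigengap `λ_{m_ℓ} - λ_{m_ℓ + 1}`. -/
def gap (ℓ : ℕ) : ℝ := eig ρ (multSum ρ ℓ) - eig ρ (multSum ρ ℓ + 1)

/-- `∑_{i=1}^ℓ P_{μ_i} f`, with `P_μ` the orthogonal projection onto the eigenspace of `μ`. -/
def lowRankPart (f : Lp ℝ 2 ρ) (ℓ : ℕ) : Lp ℝ 2 ρ :=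
  ∑ i ∈ Finset.range ℓ, (eigSpace ρ (distinctEig ρ i)).starProjection f

theorem memLp_target {f : S d → ℝ} (hf : Measurable f) (hb : ∀ᵐ x ∂ρ, f x ∈ Set.Icc (-1) 1) :
    MemLp f 2 ρ :=
  memLp_of_bounded hb hf.aestronglyMeasurable 2

/-- The approximation error `ε(f, ℓ) = sup_x |f(x) - (∑_{i=1}^ℓ P_{μ_i} f)(x)|`. The projections are
elements of `L^2(ρ)`, so the supremum is the `ρ`-essential one. -/
def approxError (f : S d → ℝ) (hf : MemLp f 2 ρ) (ℓ : ℕ) : ℝ≥0∞ :=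
  eLpNorm (fun x => f x - lowRankPart ρ (hf.toLp f) ℓ x) ∞ ρ

/-- The event that along gradient descent with stepsize `η`, for all iterations `t ≤ T`, the
normalized training error is at most `(1 - 3 λ_{m_ℓ} / 4)^t + err`. -/
def goodEvent (f : S d → ℝ) (ℓ n m : ℕ) (η T err : ℝ) :
    Set ((Fin n → S d) × (Fin m → E d) × (Fin m → ℝ)) :=
  {ω | ∀ t : ℕ, (t : ℝ) ≤ T →
    trainError η f ω.1 ω.2.2 ω.2.1 t ≤ (1 - 3 * eig ρ (multSum ρ ℓ) / 4) ^ t + err}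

end Operator

end TwoLayer

end

/-!
The proof compares the residual vector of gradient descent with population gradient descent for the
kernel regression problem, directly on the span of the leading eigenfunctions of `L_K`.

**Feature space.** The kernel is the Gram kernel of the gradient features `x ↦ 1{⟨w, x⟩ > 0} x`
under a Gaussian weight `w`, because two unit vectors at angle `θ` are both in a random half-space with
probability `(π - θ) / (2 π)` (`stdGaussian_inner_pos_inner_pos`, `exists_featureMap`). The
eigenfunctions of `L_K` become orthonormal eigenvectors `e_i` of the feature covariance
(`exists_feature_eigenvectors`), and a target with vanishing approximation error is
`f(x) = ⟪ψ x, h₀⟫` with `h₀` in their span. The operator is symmetric and Hilbert-Schmidt, so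
that the enumeration of the spectrum behaves as expected: `λ_{m_ℓ} = μ_ℓ` and the gap is positive
(`eig_multSum`, `eig_multSum_succ_lt`).

**Linearized dynamics.** In the population dynamics the coefficient of `e_i` is multiplied by
`1 - μ_i` in each step, which yields the rate `(1 - λ)^t`. The empirical operator `S* S` is within
`σ ≈ √(log (2 / δ) / n)` of its expectation on the span of the `e_i`; that span is invariant under
the population dynamics, so no statement about empirical eigenvectors is needed. The resulting
forcing is fed through the sampling operator `S`, and by the energy inequality
`‖(1 - S S*) v‖² + ‖S* v‖² ≤ ‖v‖²` its total effect is bounded by the `ℓ²` norm of the forcing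
(`norm_forced_sq_le`), of order `σ / λ` uniformly in time (`norm_sampling_add_sqrt_le`).

**The network.** As long as the weights move by at most `τ`, one step of gradient descent is one
step of the linearized dynamics up to a relative error given by the Gram matrix deviation at
initialization and by the fraction of neurons within `τ` of their kink
(`norm_residual_gdStep_sub_le`). The distance moved is at most the sum of the residual norms
divided by `√m`.
An induction over time (`trainError_le`) closes the loop: the sum `R` of the residual norms is about
`1 / λ + log n / (gap √n)`, and the accumulated error of linearization, of order `R² √n / √m`, is within
the claimed error by the condition on the width (`exists_radius_of_width`).

**Concentration.** All exceptional events are tails of sums of independent vectors in a Hilbert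
space. The exponential moment used is `cosh ‖X‖`, which is submultiplicative on average for centered
increments since `cosh √u` is convex (`measure_pi_norm_sum_ge_le`). For the initial predictions the
random signs of the second layer play the role of the centering (`measure_output_ge_le`).
-/

noncomputable section

namespace TwoLayer

/-! ### Exponential concentration in a Hilbert space -/

/-- The reason why `cosh ‖X‖` is the right exponential moment in a Hilbert space: it is a convex
function of `‖X‖ ^ 2`, and `‖x + v‖ ^ 2` is affine in `⟪x, v⟫` for fixed `‖v‖`. -/
theorem convexOn_cosh_sqrt : ConvexOn ℝ (Set.Ici 0) fun u : ℝ => Real.cosh √u := by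
  -- the power series of `cosh √u` in `u` has nonnegative coefficients
  have hs : ∀ u : ℝ, 0 ≤ u →
      HasSum (fun n : ℕ => u ^ n / ((2 * n).factorial : ℝ)) (Real.cosh √u) := by
    intro u hu
    have := Real.hasSum_cosh √u
    simpa [pow_mul, Real.sq_sqrt hu] using this
  refine ⟨convex_Ici 0, fun u hu v hv p q hp hq hpq => ?_⟩
  have huv : 0 ≤ p • u + q • v := by
    simp only [Set.mem_Ici, smul_eq_mul] at *
    positivity
  refine hasSum_le (fun n => ?_) (hs _ huv)
    (((hs u hu).mul_left p).add ((hs v hv).mul_left q))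
  have := (convexOn_pow n).2 hu hv hp hq hpq
  simp only [smul_eq_mul] at this ⊢
  rw [← mul_div_assoc, ← mul_div_assoc, ← add_div]
  gcongr

/-- The increments of a sum of independent vectors may be estimated one at a time. -/
theorem lintegral_pi_cosh_norm_sum_le {H : Type*} [NormedAddCommGroup H] {Ω : Type*}
    [MeasurableSpace Ω] :
    ∀ {n : ℕ} (P : Fin n → Measure Ω) [∀ j, IsProbabilityMeasure (P j)] (X : Fin n → Ω → H)
      (_ : ∀ j, StronglyMeasurable (X j)) (M : Fin n → ℝ≥0∞)
      (_ : ∀ j x, ∫⁻ ω, ENNReal.ofReal (Real.cosh ‖x + X j ω‖) ∂(P j) ≤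
        ENNReal.ofReal (Real.cosh ‖x‖) * M j) (x : H),
      ∫⁻ ω, ENNReal.ofReal (Real.cosh ‖x + ∑ j, X j (ω j)‖) ∂(Measure.pi P) ≤
        ENNReal.ofReal (Real.cosh ‖x‖) * ∏ j, M j := by
  intro n
  induction n with
  | zero => intro P _ X _ M _ x; simp
  | succ n ih =>
    intro P _ X hX M hM x
    have hmp := (measurePreserving_piFinSuccAbove P 0).symm
    have hmeas : Measurable fun p : Ω × (Fin n → Ω) =>
        ENNReal.ofReal (Real.cosh ‖x + (X 0 p.1 + ∑ j : Fin n, X j.succ (p.2 j))‖) := by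
      have h1 : StronglyMeasurable fun p : Ω × (Fin n → Ω) =>
          x + (X 0 p.1 + ∑ j : Fin n, X j.succ (p.2 j)) := by
        refine stronglyMeasurable_const.add (((hX 0).comp_measurable measurable_fst).add ?_)
        refine Finset.stronglyMeasurable_fun_sum _ fun j _ => ?_
        exact (hX j.succ).comp_measurable ((measurable_pi_apply j).comp measurable_snd)
      exact (Real.measurable_cosh.comp h1.norm.measurable).ennreal_ofReal
    rw [← hmp.lintegral_comp_emb (MeasurableEquiv.measurableEmbedding _)]
    simp only [MeasurableEquiv.piFinSuccAbove_symm_apply, Fin.insertNthEquiv_zero,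
      Fin.consEquiv_apply, Fin.sum_univ_succ, Fin.cons_zero, Fin.cons_succ]
    rw [lintegral_prod _ hmeas.aemeasurable]
    calc _ ≤ ∫⁻ ω, ENNReal.ofReal (Real.cosh ‖x + X 0 ω‖) * ∏ j : Fin n, M j.succ ∂(P 0) := by
          refine lintegral_mono fun ω => ?_
          have := ih (fun j => P j.succ) (fun j => X j.succ) (fun j => hX _) (fun j => M j.succ)
            (fun j => hM _) (x + X 0 ω)
          simpa only [add_assoc, Fin.zero_succAbove] using this
      _ = (∫⁻ ω, ENNReal.ofReal (Real.cosh ‖x + X 0 ω‖) ∂(P 0)) * ∏ j : Fin n, M j.succ := by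
          rw [lintegral_mul_const]
          exact (Real.measurable_cosh.comp
            (stronglyMeasurable_const.add (hX 0)).norm.measurable).ennreal_ofReal
      _ ≤ ENNReal.ofReal (Real.cosh ‖x‖) * M 0 * ∏ j : Fin n, M j.succ := by
          gcongr
          exact hM 0 x
      _ = _ := by rw [Fin.prod_univ_succ, mul_assoc]

section Hilbert

variable {H : Type*} [NormedAddCommGroup H] [InnerProductSpace ℝ H]

/-- The function `v ↦ cosh ‖x + v‖` lies below an affine function of `⟪x, v⟫` on a ball: for fixed
`‖v‖` it is a convex function of the inner product, so it is at most its chord. -/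
theorem exists_cosh_norm_add_le (x : H) (c : ℝ) :
    ∃ B : ℝ, ∀ v : H, ‖v‖ ≤ c →
      Real.cosh ‖x + v‖ ≤ Real.cosh ‖x‖ * Real.cosh c + B * ⟪x, v⟫ := by
  set A := ‖x‖ with hA
  have hA0 : 0 ≤ A := norm_nonneg x
  rcases le_or_gt (A * c) 0 with hAc | hAc
  -- here `x = 0` or `c ≤ 0`, and the slope of the chord would be `0 / 0`
  · refine ⟨0, fun v hv => ?_⟩
    have hc : 0 ≤ c := (norm_nonneg v).trans hv
    have h0 : A * c = 0 := le_antisymm hAc (by positivity)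
    have h1 : ‖x + v‖ ≤ A + c := (norm_add_le x v).trans (by rw [← hA]; gcongr)
    rw [zero_mul, add_zero]
    calc Real.cosh ‖x + v‖ ≤ Real.cosh (A + c) := by
          rw [Real.cosh_le_cosh, abs_of_nonneg (norm_nonneg _), abs_of_nonneg (by positivity)]
          exact h1
      _ = Real.cosh A * Real.cosh c := by
          rcases mul_eq_zero.1 h0 with h | h <;> simp [h]
  · have hc : 0 < c := by
      by_contra h
      exact absurd hAc (not_lt.2 (mul_nonpos_of_nonneg_of_nonpos hA0 (not_lt.1 h)))
    have hA1 : 0 < A := pos_of_mul_pos_left hAc hc.le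
    refine ⟨Real.sinh A * Real.sinh c / (A * c), fun v hv => ?_⟩
    set p := ⟪x, v⟫ with hp
    have hpabs : |p| ≤ A * c := (abs_real_inner_le_norm x v).trans (by rw [← hA]; gcongr)
    obtain ⟨hp1, hp2⟩ := abs_le.1 hpabs
    -- the chord of `u ↦ cosh √u` over `[(A - c) ^ 2, (A + c) ^ 2]` at `A ^ 2 + c ^ 2 + 2 ⟪x, v⟫`
    have hconv := convexOn_cosh_sqrt.2 (Set.mem_Ici.2 (sq_nonneg (A - c)))
      (Set.mem_Ici.2 (sq_nonneg (A + c)))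
      (show 0 ≤ (1 - p / (A * c)) / 2 by
          have : p / (A * c) ≤ 1 := (div_le_one hAc).2 hp2
          linarith)
      (show 0 ≤ (1 + p / (A * c)) / 2 by
          have : -1 ≤ p / (A * c) := (le_div_iff₀ hAc).2 (by linarith)
          linarith) (by ring)
    have hcomb : ((1 - p / (A * c)) / 2) • (A - c) ^ 2 + ((1 + p / (A * c)) / 2) • (A + c) ^ 2
        = A ^ 2 + c ^ 2 + 2 * p := by
      simp only [smul_eq_mul]
      field_simp
      ring
    rw [hcomb] at hconv
    simp only [smul_eq_mul, Real.sqrt_sq_eq_abs, Real.cosh_abs, Real.cosh_sub, Real.cosh_add]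
      at hconv
    have hn : ‖x + v‖ ^ 2 ≤ A ^ 2 + c ^ 2 + 2 * p := by
      rw [norm_add_sq_real]
      have : ‖v‖ ^ 2 ≤ c ^ 2 := by gcongr
      linarith
    calc Real.cosh ‖x + v‖ ≤ Real.cosh √(A ^ 2 + c ^ 2 + 2 * p) := by
          rw [Real.cosh_le_cosh, abs_of_nonneg (norm_nonneg _), abs_of_nonneg (Real.sqrt_nonneg _)]
          exact Real.le_sqrt_of_sq_le hn
      _ ≤ _ := hconv
      _ = _ := by
          field_simp
          ring

theorem cosh_norm_add_add_cosh_norm_sub_le (x v : H) :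
    Real.cosh ‖x + v‖ + Real.cosh ‖x - v‖ ≤ 2 * (Real.cosh ‖x‖ * Real.cosh ‖v‖) := by
  obtain ⟨B, hB⟩ := exists_cosh_norm_add_le x ‖v‖
  have h1 := hB v le_rfl
  have h2 := hB (-v) (norm_neg v).le
  rw [inner_neg_right, ← sub_eq_add_neg] at h2
  linarith

/-- A centred random vector of norm at most `c` multiplies `cosh ‖x‖` by at most `cosh c` on
average. -/
theorem lintegral_cosh_norm_add_le [CompleteSpace H] {Ω : Type*} [MeasurableSpace Ω]
    (P : Measure Ω) [IsProbabilityMeasure P] {X : Ω → H} (hX : AEStronglyMeasurable X P) {c : ℝ}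
    (hc : ∀ᵐ ω ∂P, ‖X ω‖ ≤ c) (h0 : ∫ ω, X ω ∂P = 0) (x : H) :
    ∫⁻ ω, ENNReal.ofReal (Real.cosh ‖x + X ω‖) ∂P ≤
      ENNReal.ofReal (Real.cosh ‖x‖) * ENNReal.ofReal (Real.cosh c) := by
  obtain ⟨B, hB⟩ := exists_cosh_norm_add_le x c
  have hint : Integrable X P := Integrable.of_bound hX c hc
  have hi : Integrable (fun ω => Real.cosh ‖x‖ * Real.cosh c + B * ⟪x, X ω⟫) P :=
    (integrable_const _).add ((hint.const_inner x).const_mul B)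
  have hle : ∀ᵐ ω ∂P, Real.cosh ‖x + X ω‖ ≤ Real.cosh ‖x‖ * Real.cosh c + B * ⟪x, X ω⟫ := by
    filter_upwards [hc] with ω hω using hB _ hω
  calc ∫⁻ ω, ENNReal.ofReal (Real.cosh ‖x + X ω‖) ∂P
      ≤ ∫⁻ ω, ENNReal.ofReal (Real.cosh ‖x‖ * Real.cosh c + B * ⟪x, X ω⟫) ∂P := by
        refine lintegral_mono_ae ?_
        filter_upwards [hle] with ω hω using ENNReal.ofReal_le_ofReal hω
    _ = ENNReal.ofReal (∫ ω, Real.cosh ‖x‖ * Real.cosh c + B * ⟪x, X ω⟫ ∂P) := by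
        rw [ofReal_integral_eq_lintegral_ofReal hi]
        filter_upwards [hle] with ω hω using (Real.cosh_pos _).le.trans hω
    _ = _ := by
        rw [integral_add (integrable_const _) ((hint.const_inner x).const_mul B),
          integral_const_mul B, integral_inner hint, h0]
        simp [ENNReal.ofReal_mul (Real.cosh_pos _).le]

/-- Markov's inequality for `cosh ‖X‖`. -/
theorem measure_norm_ge_le_of_lintegral_cosh {Ω : Type*} [MeasurableSpace Ω] (P : Measure Ω)
    {X : Ω → H} (hX : StronglyMeasurable X) {s θ K : ℝ} (hθ : 0 ≤ θ)
    (h : ∫⁻ ω, ENNReal.ofReal (Real.cosh ‖θ • X ω‖) ∂P ≤ ENNReal.ofReal (Real.exp K)) :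
    P {ω | s ≤ ‖X ω‖} ≤ ENNReal.ofReal (2 * Real.exp (K - θ * s)) := by
  have hm : AEMeasurable (fun ω => ENNReal.ofReal (Real.cosh ‖θ • X ω‖)) P :=
    (Real.measurable_cosh.comp (hX.const_smul θ).norm.measurable).ennreal_ofReal.aemeasurable
  have hsub : {ω | s ≤ ‖X ω‖} ⊆
      {ω | ENNReal.ofReal (Real.exp (θ * s) / 2) ≤ ENNReal.ofReal (Real.cosh ‖θ • X ω‖)} := by
    intro ω hω
    refine ENNReal.ofReal_le_ofReal ?_
    have h1 : θ * s ≤ ‖θ • X ω‖ := by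
      rw [norm_smul, Real.norm_of_nonneg hθ]
      exact mul_le_mul_of_nonneg_left hω hθ
    rw [Real.cosh_eq]
    have := Real.exp_le_exp.2 h1
    have := Real.exp_pos (-‖θ • X ω‖)
    linarith
  have hpos : 0 < Real.exp (θ * s) / 2 := by positivity
  calc P {ω | s ≤ ‖X ω‖} ≤ _ := measure_mono hsub
    _ ≤ (∫⁻ ω, ENNReal.ofReal (Real.cosh ‖θ • X ω‖) ∂P) / ENNReal.ofReal (Real.exp (θ * s) / 2) :=
        meas_ge_le_lintegral_div hm (by simpa using hpos) ENNReal.ofReal_ne_top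
    _ ≤ ENNReal.ofReal (Real.exp K) / ENNReal.ofReal (Real.exp (θ * s) / 2) := by gcongr
    _ = _ := by
        rw [← ENNReal.ofReal_div_of_pos hpos]
        congr 1
        rw [Real.exp_sub]
        field_simp

/-- Hoeffding's inequality in a Hilbert space, with no dependence on the dimension. -/
theorem measure_pi_norm_sum_ge_le [CompleteSpace H] {Ω : Type*} [MeasurableSpace Ω]
    (P : Measure Ω) [IsProbabilityMeasure P] {X : Ω → H} (hX : StronglyMeasurable X) {c : ℝ}
    (hc0 : 0 < c) (hc : ∀ ω, ‖X ω‖ ≤ c) (h0 : ∫ ω, X ω ∂P = 0) {n : ℕ} (hn : 0 < n) {s : ℝ}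
    (hs : 0 ≤ s) :
    (Measure.pi fun _ : Fin n => P) {ω | s ≤ ‖∑ j, X (ω j)‖} ≤
      ENNReal.ofReal (2 * Real.exp (-(s ^ 2 / (2 * n * c ^ 2)))) := by
  -- the minimizer of the Chernoff exponent `n (θ c) ^ 2 / 2 - θ s`
  set θ := s / (n * c ^ 2) with hθ
  have hn' : (0 : ℝ) < n := Nat.cast_pos.2 hn
  have hθ0 : 0 ≤ θ := by positivity
  have hsm : StronglyMeasurable fun ω : Fin n → Ω => ∑ j, X (ω j) :=
    Finset.stronglyMeasurable_fun_sum _ fun j _ => hX.comp_measurable (measurable_pi_apply j)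
  have hexp : n * ((θ * c) ^ 2 / 2) - θ * s = -(s ^ 2 / (2 * n * c ^ 2)) := by
    rw [hθ]
    field_simp
    ring
  rw [← hexp]
  refine measure_norm_ge_le_of_lintegral_cosh _ hsm hθ0 ?_
  have := lintegral_pi_cosh_norm_sum_le (fun _ : Fin n => P) (fun _ ω => θ • X ω)
    (fun _ => hX.const_smul θ) (fun _ => ENNReal.ofReal (Real.cosh (θ * c)))
    (fun _ x => lintegral_cosh_norm_add_le P (hX.const_smul θ).aestronglyMeasurable
      (Filter.Eventually.of_forall fun ω => by
        rw [Pi.smul_apply, norm_smul, Real.norm_of_nonneg hθ0]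
        exact mul_le_mul_of_nonneg_left (hc ω) hθ0)
      (by simp only [Pi.smul_apply, integral_smul, h0, smul_zero]) x) 0
  simp only [zero_add, norm_zero, Real.cosh_zero, ENNReal.ofReal_one, one_mul, Finset.prod_const,
    Finset.card_univ, Fintype.card_fin, ← Finset.smul_sum] at this
  refine this.trans ?_
  rw [← ENNReal.ofReal_pow (Real.cosh_pos _).le]
  refine ENNReal.ofReal_le_ofReal ?_
  rw [Real.exp_nat_mul]
  exact pow_le_pow_left₀ (Real.cosh_pos _).le (Real.cosh_le_exp_half_sq _) n

end Hilbert

instance : IsProbabilityMeasure signLaw := by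
  constructor
  simp [signLaw, ENNReal.inv_two_add_inv_two]

theorem ae_signLaw : ∀ᵐ a ∂signLaw, a = 1 ∨ a = -1 := by
  unfold signLaw
  rw [ae_add_measure_iff]
  constructor <;> refine Measure.ae_smul_measure ?_ _ <;> simp [ae_dirac_eq]

theorem lintegral_signLaw {g : ℝ → ℝ≥0∞} :
    ∫⁻ a, g a ∂signLaw = 2⁻¹ * g 1 + 2⁻¹ * g (-1) := by
  simp [signLaw, lintegral_add_measure, lintegral_smul_measure]

theorem lintegral_cosh_norm_sum_signs_le {H : Type*} [NormedAddCommGroup H]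
    [InnerProductSpace ℝ H] {m : ℕ} (v : Fin m → H) :
    ∫⁻ a, ENNReal.ofReal (Real.cosh ‖∑ j, a j • v j‖) ∂(Measure.pi fun _ : Fin m => signLaw) ≤
      ∏ j, ENNReal.ofReal (Real.cosh ‖v j‖) := by
  have := lintegral_pi_cosh_norm_sum_le (fun _ : Fin m => signLaw) (fun j a => a • v j)
    (fun j => (stronglyMeasurable_id.smul_const (v j))) (fun j => ENNReal.ofReal (Real.cosh ‖v j‖))
    (fun j x => by
      rw [lintegral_signLaw, ← ENNReal.ofReal_mul (Real.cosh_pos _).le, ← mul_add,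
        ← ENNReal.ofReal_add (Real.cosh_pos _).le (Real.cosh_pos _).le]
      have h2 : (2⁻¹ : ℝ≥0∞) = ENNReal.ofReal (2⁻¹) := by
        rw [ENNReal.ofReal_inv_of_pos two_pos]; simp
      rw [h2, ← ENNReal.ofReal_mul (by norm_num)]
      refine ENNReal.ofReal_le_ofReal ?_
      have := cosh_norm_add_add_cosh_norm_sub_le x (v j)
      rw [one_smul, neg_one_smul, ← sub_eq_add_neg]
      linarith) 0
  simpa using this

/-! ### Gaussian computations -/

theorem map_inner_stdGaussian {d : ℕ} {x : E d} (hx : ‖x‖ = 1) :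
    (stdGaussian (E d)).map (fun w => ⟪w, x⟫) = gaussianReal 0 1 := by
  have h := IsGaussian.map_eq_gaussianReal (μ := stdGaussian (E d)) (innerSL ℝ x)
  rw [variance_dual_stdGaussian, integral_strongDual_stdGaussian, innerSL_apply_norm, hx] at h
  simp only [one_pow, Real.toNNReal_one] at h
  rw [← h]
  congr 1
  ext w
  exact real_inner_comm _ _

/-- Two coordinates of a standard Gaussian vector in orthogonal directions are independent. -/
theorem map_inner_pair_stdGaussian {d : ℕ} {x y : E d} (hx : ‖x‖ = 1) (hy : ‖y‖ = 1)
    (hxy : ⟪x, y⟫ = 0) :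
    (stdGaussian (E d)).map (fun w => (⟪w, x⟫, ⟪w, y⟫)) =
      (gaussianReal 0 1).prod (gaussianReal 0 1) := by
  have hm : Measurable fun w : E d => WithLp.toLp 2 ![⟪w, x⟫, ⟪w, y⟫] := by
    refine (WithLp.measurable_toLp 2 _).comp (measurable_pi_lambda _ fun i => ?_)
    fin_cases i <;> simp <;> fun_prop
  -- both laws have the same characteristic function, as `t ↦ t 0 • x + t 1 • y` is isometric
  have h2 : (stdGaussian (E d)).map (fun w => WithLp.toLp 2 ![⟪w, x⟫, ⟪w, y⟫]) =
      stdGaussian (EuclideanSpace ℝ (Fin 2)) := by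
    have : IsProbabilityMeasure
        ((stdGaussian (E d)).map (fun w => WithLp.toLp 2 ![⟪w, x⟫, ⟪w, y⟫])) :=
      Measure.isProbabilityMeasure_map hm.aemeasurable
    refine Measure.ext_of_charFun ?_
    ext t
    rw [charFun_stdGaussian, charFun_apply, integral_map hm.aemeasurable
      (by fun_prop)]
    have h3 := charFun_stdGaussian (E := E d) (t 0 • x + t 1 • y)
    rw [charFun_apply] at h3
    have h4 : ‖t 0 • x + t 1 • y‖ ^ 2 = ‖t‖ ^ 2 := by
      rw [norm_add_sq_real, norm_smul, norm_smul, hx, hy, inner_smul_left, inner_smul_right, hxy,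
        EuclideanSpace.norm_sq_eq]
      simp
    rw [← Complex.ofReal_pow, h4, Complex.ofReal_pow] at h3
    rw [← h3]
    congr 1
    ext w
    congr 3
    simp [PiLp.inner_apply, inner_add_right, inner_smul_right]
  have h5 := map_pi_eq_stdGaussian (ι := Fin 2)
  have h6 := (measurePreserving_finTwoArrow (gaussianReal 0 1)).map_eq
  rw [← h6]
  have h7 : Measure.pi (fun _ : Fin 2 => gaussianReal 0 1) =
      (stdGaussian (EuclideanSpace ℝ (Fin 2))).map (WithLp.ofLp (p := 2)) := by
    rw [← h5, Measure.map_map (by fun_prop) (by fun_prop)]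
    simp [Function.comp_def]
  rw [h7, ← h2, Measure.map_map (WithLp.measurable_ofLp 2 _) hm,
    Measure.map_map (MeasurableEquiv.measurable _) ((WithLp.measurable_ofLp 2 _).comp hm)]
  rfl

/-- The planar Gaussian is rotation invariant: the measure of a cone is proportional to its angle.
The cone `B` is given by the set `Φ` of its angles in polar coordinates. -/
theorem gaussianReal_prod_cone {B : Set (ℝ × ℝ)} (hB : MeasurableSet B) {Φ : Set ℝ}
    (hΦ : MeasurableSet Φ)
    (h : ∀ r φ : ℝ, 0 < r → φ ∈ Set.Ioo (-Real.pi) Real.pi →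
      ((r * Real.cos φ, r * Real.sin φ) ∈ B ↔ φ ∈ Φ)) :
    ((gaussianReal 0 1).prod (gaussianReal 0 1)) B =
      (∫⁻ r in Set.Ioi (0 : ℝ), ENNReal.ofReal (r * ((2 * Real.pi)⁻¹ * Real.exp (-r ^ 2 / 2)))) *
        volume (Φ ∩ Set.Ioo (-Real.pi) Real.pi) := by
  rw [gaussianReal_of_var_ne_zero 0 one_ne_zero,
    prod_withDensity (measurable_gaussianPDF _ _) (measurable_gaussianPDF _ _),
    withDensity_apply _ hB, ← lintegral_indicator hB, ← Measure.volume_eq_prod,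
    ← lintegral_comp_polarCoord_symm, polarCoord_target]
  rw [Measure.volume_eq_prod, ← Measure.prod_restrict]
  have hpt : ∀ p ∈ Set.Ioi (0 : ℝ) ×ˢ Set.Ioo (-Real.pi) Real.pi,
      ENNReal.ofReal p.1 • B.indicator (fun z => gaussianPDF 0 1 z.1 * gaussianPDF 0 1 z.2)
        (polarCoord.symm p) =
      ENNReal.ofReal (p.1 * ((2 * Real.pi)⁻¹ * Real.exp (-p.1 ^ 2 / 2))) *
        Φ.indicator 1 p.2 := by
    rintro ⟨r, φ⟩ ⟨hr, hφ⟩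
    have hr : 0 < r := hr
    have hφ : φ ∈ Set.Ioo (-Real.pi) Real.pi := hφ
    have hb := h r φ hr hφ
    simp only [polarCoord_symm_apply]
    by_cases hm : φ ∈ Φ
    · rw [Set.indicator_of_mem (hb.2 hm), Set.indicator_of_mem hm, Pi.one_apply, mul_one,
        smul_eq_mul, gaussianPDF, gaussianPDF, ← ENNReal.ofReal_mul (gaussianPDFReal_nonneg _ _ _),
        ← ENNReal.ofReal_mul hr.le]
      congr 2
      simp only [gaussianPDFReal_def, NNReal.coe_one, mul_one, sub_zero]
      have hpi : (√(2 * Real.pi))⁻¹ * (√(2 * Real.pi))⁻¹ = (2 * Real.pi)⁻¹ := by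
        rw [← mul_inv, Real.mul_self_sqrt (by positivity)]
      calc _ = (√(2 * Real.pi))⁻¹ * (√(2 * Real.pi))⁻¹ *
            (Real.exp (-(r * Real.cos φ) ^ 2 / 2) * Real.exp (-(r * Real.sin φ) ^ 2 / 2)) := by ring
        _ = _ := by
          rw [hpi, ← Real.exp_add]
          congr 2
          have := Real.cos_sq_add_sin_sq φ
          linear_combination (-r ^ 2 / 2) * this
    · rw [Set.indicator_of_notMem (fun hc => hm (hb.1 hc)), Set.indicator_of_notMem hm]
      simp
  rw [Measure.prod_restrict, setLIntegral_congr_fun (measurableSet_Ioi.prod measurableSet_Ioo) hpt,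
    ← Measure.prod_restrict]
  rw [lintegral_prod_mul
    (f := fun r => ENNReal.ofReal (r * ((2 * Real.pi)⁻¹ * Real.exp (-r ^ 2 / 2))))
    (g := Φ.indicator 1) (by fun_prop) ((measurable_one.indicator hΦ).aemeasurable)]
  rw [lintegral_indicator_one hΦ, Measure.restrict_apply hΦ]

theorem real_gaussianReal_prod_cone {B : Set (ℝ × ℝ)} (hB : MeasurableSet B) {Φ : Set ℝ}
    (hΦ : MeasurableSet Φ)
    (h : ∀ r φ : ℝ, 0 < r → φ ∈ Set.Ioo (-Real.pi) Real.pi →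
      ((r * Real.cos φ, r * Real.sin φ) ∈ B ↔ φ ∈ Φ)) :
    ((gaussianReal 0 1).prod (gaussianReal 0 1)).real B =
      (volume : Measure ℝ).real (Φ ∩ Set.Ioo (-Real.pi) Real.pi) / (2 * Real.pi) := by
  -- the whole plane, with angle `2 π`, determines the radial integral
  have h1 := gaussianReal_prod_cone MeasurableSet.univ (Φ := Set.univ) MeasurableSet.univ
    (by simp)
  rw [measure_univ, Set.univ_inter, Real.volume_Ioo] at h1
  have h2 := gaussianReal_prod_cone hB hΦ h
  set G := ∫⁻ r in Set.Ioi (0 : ℝ), ENNReal.ofReal (r * ((2 * Real.pi)⁻¹ * Real.exp (-r ^ 2 / 2)))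
  have h3 : G.toReal * (2 * Real.pi) = 1 := by
    have := congrArg ENNReal.toReal h1
    rw [ENNReal.toReal_mul, ENNReal.toReal_ofReal (by linarith [Real.pi_pos])] at this
    simp only [ENNReal.toReal_one] at this
    linarith
  have h4 : (((gaussianReal 0 1).prod (gaussianReal 0 1)).real B) =
      G.toReal * (volume : Measure ℝ).real (Φ ∩ Set.Ioo (-Real.pi) Real.pi) := by
    rw [measureReal_def, h2, ENNReal.toReal_mul]
    rfl
  rw [h4, eq_div_iff (by positivity)]
  linear_combination (volume : Measure ℝ).real (Φ ∩ Set.Ioo (-Real.pi) Real.pi) * h3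

/-- The probability that a Gaussian vector has positive inner product with each of two unit vectors
is determined by the angle between them. -/
theorem stdGaussian_inner_pos_inner_pos {d : ℕ} {x s : E d} (hx : ‖x‖ = 1) (hs : ‖s‖ = 1) :
    (stdGaussian (E d)).real {w | 0 < ⟪w, x⟫ ∧ 0 < ⟪w, s⟫} =
      (Real.pi - Real.arccos ⟪x, s⟫) / (2 * Real.pi) := by
  have hpi := Real.pi_pos
  have habs := abs_real_inner_le_norm x s
  rw [hx, hs, one_mul, abs_le] at habs
  -- the cases of parallel vectors, where there is no orthogonal direction in their span
  rcases eq_or_lt_of_le habs.1 with hm | hm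
  · have hsx : x = -s := (inner_eq_neg_one_iff_of_norm_eq_one hx hs).1 hm.symm
    have : {w : E d | 0 < ⟪w, x⟫ ∧ 0 < ⟪w, s⟫} = ∅ := by
      ext w
      simp only [hsx, inner_neg_right, Set.mem_ofPred_eq, Set.mem_empty_iff_false, iff_false]
      rintro ⟨h1, h2⟩
      linarith
    rw [this, ← hm]
    simp
  rcases eq_or_lt_of_le habs.2 with hp | hp
  · have hsx : x = s := (inner_eq_one_iff_of_norm_eq_one hx hs).1 hp
    have hset : {w : E d | 0 < ⟪w, x⟫ ∧ 0 < ⟪w, s⟫} = (fun w => ⟪w, x⟫) ⁻¹' (Set.Ioi 0) := by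
      ext w
      simp [hsx]
    have hfst : (gaussianReal 0 1) (Set.Ioi 0) =
        ((gaussianReal 0 1).prod (gaussianReal 0 1)) (Set.Ioi 0 ×ˢ Set.univ) := by
      rw [Measure.prod_prod, measure_univ, mul_one]
    rw [hset, hp, Real.arccos_one, measureReal_def, ← Measure.map_apply (by fun_prop)
      measurableSet_Ioi, map_inner_stdGaussian hx, hfst, ← measureReal_def,
      real_gaussianReal_prod_cone (measurableSet_Ioi.prod MeasurableSet.univ)
        (Φ := Set.Ioo (-(Real.pi / 2)) (Real.pi / 2)) measurableSet_Ioo]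
    · rw [Set.inter_eq_left.2 (Set.Ioo_subset_Ioo (by linarith) (by linarith)),
        measureReal_def, Real.volume_Ioo, ENNReal.toReal_ofReal (by linarith)]
      ring
    · intro r φ hr hφ
      simp only [Set.mem_prod, Set.mem_Ioi, Set.mem_univ, and_true, mul_pos_iff_of_pos_left hr]
      refine ⟨fun h => ?_, fun h => Real.cos_pos_of_mem_Ioo h⟩
      by_contra hc
      rw [Set.mem_Ioo, not_and_or, not_lt, not_lt] at hc
      rcases hc with hc | hc
      · have := Real.cos_nonpos_of_pi_div_two_le_of_le (x := -φ) (by linarith) (by linarith [hφ.1])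
        rw [Real.cos_neg] at this
        linarith
      · have := Real.cos_nonpos_of_pi_div_two_le_of_le hc (by linarith [hφ.2])
        linarith
  set c := ⟪x, s⟫ with hc
  set θ := Real.arccos c with hθ
  have hcos : Real.cos θ = c := Real.cos_arccos hm.le hp.le
  have hθ0 : 0 < θ := Real.arccos_pos.2 hp
  have hθ1 : θ < Real.pi := Real.arccos_lt_pi.2 hm
  have hsin : 0 < Real.sin θ := Real.sin_pos_of_pos_of_lt_pi hθ0 hθ1
  -- `(x, y)` is an orthonormal basis of the plane of `x` and `s`, with `s` at the angle `θ`
  set y : E d := (Real.sin θ)⁻¹ • (s - c • x) with hy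
  have hnorm : ‖s - c • x‖ ^ 2 = Real.sin θ ^ 2 := by
    rw [norm_sub_sq_real, norm_smul, hx, hs, inner_smul_right, real_inner_comm, ← hc,
      Real.sin_sq, hcos, Real.norm_eq_abs, mul_one, sq_abs]
    ring
  have hy1 : ‖y‖ = 1 := by
    have : ‖s - c • x‖ = Real.sin θ := by
      rwa [sq_eq_sq₀ (norm_nonneg _) hsin.le] at hnorm
    rw [hy, norm_smul, this, norm_inv, Real.norm_of_nonneg hsin.le, inv_mul_cancel₀ hsin.ne']
  have hxy : ⟪x, y⟫ = 0 := by
    rw [hy, inner_smul_right, inner_sub_right, inner_smul_right, real_inner_self_eq_norm_sq, hx,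
      ← hc]
    ring
  have hs2 : s = Real.cos θ • x + Real.sin θ • y := by
    rw [hy, smul_inv_smul₀ hsin.ne', hcos]
    abel
  have hset : {w : E d | 0 < ⟪w, x⟫ ∧ 0 < ⟪w, s⟫} = (fun w => (⟪w, x⟫, ⟪w, y⟫)) ⁻¹'
      {p : ℝ × ℝ | 0 < p.1 ∧ 0 < Real.cos θ * p.1 + Real.sin θ * p.2} := by
    ext w
    simp only [Set.mem_ofPred_eq, Set.mem_preimage]
    rw [hs2, inner_add_right, inner_smul_right, inner_smul_right]
  have hBm : MeasurableSet {p : ℝ × ℝ | 0 < p.1 ∧ 0 < Real.cos θ * p.1 + Real.sin θ * p.2} :=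
    (measurableSet_lt measurable_const measurable_fst).inter
      (measurableSet_lt measurable_const
        ((measurable_fst.const_mul _).add (measurable_snd.const_mul _)))
  rw [hset, measureReal_def, ← Measure.map_apply (by fun_prop) hBm,
    map_inner_pair_stdGaussian hx hy1 hxy, ← measureReal_def,
    real_gaussianReal_prod_cone hBm (Φ := Set.Ioo (θ - Real.pi / 2) (Real.pi / 2))
      measurableSet_Ioo]
  · rw [Set.inter_eq_left.2 (Set.Ioo_subset_Ioo (by linarith) (by linarith)),
      measureReal_def, Real.volume_Ioo, ENNReal.toReal_ofReal (by linarith)]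
    ring
  · intro r φ hr hφ
    have hrw : Real.cos θ * (r * Real.cos φ) + Real.sin θ * (r * Real.sin φ) =
        r * Real.cos (φ - θ) := by
      rw [Real.cos_sub]
      ring
    simp only [Set.mem_ofPred_eq, hrw, mul_pos_iff_of_pos_left hr]
    refine ⟨fun ⟨h1, h2⟩ => ?_, fun h => ⟨Real.cos_pos_of_mem_Ioo ⟨by linarith [h.1], h.2⟩,
      Real.cos_pos_of_mem_Ioo ⟨by linarith [h.1], by linarith [h.2]⟩⟩⟩
    have hφ2 : φ < Real.pi / 2 := by
      by_contra hcon
      have := Real.cos_nonpos_of_pi_div_two_le_of_le (not_lt.1 hcon) (by linarith [hφ.2])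
      linarith
    have hφ1 : -(Real.pi / 2) < φ := by
      by_contra hcon
      have := Real.cos_nonpos_of_pi_div_two_le_of_le (x := -φ) (by linarith) (by linarith [hφ.1])
      rw [Real.cos_neg] at this
      linarith
    refine ⟨?_, hφ2⟩
    by_contra hcon
    have := Real.cos_nonpos_of_pi_div_two_le_of_le (x := -(φ - θ)) (by linarith) (by linarith)
    rw [Real.cos_neg] at this
    linarith

/-- The Gaussian density is at most `1 / √(2π) ≤ 1 / 2`. -/
theorem stdGaussian_abs_inner_le {d : ℕ} {x : E d} (hx : ‖x‖ = 1) {τ : ℝ} (hτ : 0 ≤ τ) :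
    (stdGaussian (E d)).real {w | |⟪w, x⟫| ≤ τ} ≤ τ := by
  have hset : {w : E d | |⟪w, x⟫| ≤ τ} = (fun w => ⟪w, x⟫) ⁻¹' (Set.Icc (-τ) τ) := by
    ext w
    simp [abs_le]
  refine ENNReal.toReal_le_of_le_ofReal hτ ?_
  rw [hset, ← Measure.map_apply (by fun_prop) measurableSet_Icc, map_inner_stdGaussian hx,
    gaussianReal_apply 0 one_ne_zero]
  calc ∫⁻ t in Set.Icc (-τ) τ, gaussianPDF 0 1 t
      ≤ ∫⁻ _ in Set.Icc (-τ) τ, ENNReal.ofReal (1 / 2) := by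
        refine lintegral_mono fun t => ENNReal.ofReal_le_ofReal ?_
        rw [gaussianPDFReal_def]
        simp only [NNReal.coe_one, mul_one, sub_zero]
        have h2 : 2 ≤ √(2 * Real.pi) := by
          refine Real.le_sqrt_of_sq_le ?_
          linarith [Real.two_le_pi]
        calc (√(2 * Real.pi))⁻¹ * Real.exp (-t ^ 2 / 2) ≤ (2 : ℝ)⁻¹ * 1 := by
              gcongr
              rw [Real.exp_le_one_iff]
              nlinarith [sq_nonneg t]
          _ = 1 / 2 := by norm_num
    _ = ENNReal.ofReal τ := by
        rw [setLIntegral_const, Real.volume_Icc, ← ENNReal.ofReal_mul (by norm_num)]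
        congr 1
        ring

theorem lintegral_exp_sq_gaussianReal_le {s : ℝ} (hs0 : 0 ≤ s) (hs : s ≤ 1 / 4) :
    ∫⁻ t, ENNReal.ofReal (Real.exp (s * t ^ 2)) ∂(gaussianReal 0 1) ≤
      ENNReal.ofReal (Real.exp (2 * s)) := by
  have hb : 0 < 1 / 2 - s := by linarith
  have hpi := Real.pi_pos
  rw [gaussianReal_of_var_ne_zero 0 one_ne_zero,
    lintegral_withDensity_eq_lintegral_mul _ (measurable_gaussianPDF _ _) (by fun_prop)]
  have hpt : ∀ t : ℝ, (gaussianPDF 0 1 * fun t => ENNReal.ofReal (Real.exp (s * t ^ 2))) t =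
      ENNReal.ofReal ((√(2 * Real.pi))⁻¹ * Real.exp (-(1 / 2 - s) * t ^ 2)) := by
    intro t
    rw [Pi.mul_apply, gaussianPDF, ← ENNReal.ofReal_mul (gaussianPDFReal_nonneg _ _ _),
      gaussianPDFReal_def]
    simp only [NNReal.coe_one, mul_one, sub_zero]
    rw [mul_assoc, ← Real.exp_add]
    congr 3
    ring
  simp_rw [hpt]
  rw [← ofReal_integral_eq_lintegral_ofReal ((integrable_exp_neg_mul_sq hb).const_mul _)
    (Filter.Eventually.of_forall fun t => by positivity), integral_const_mul, integral_gaussian]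
  refine ENNReal.ofReal_le_ofReal ?_
  rw [← Real.sqrt_inv, ← Real.sqrt_mul (by positivity)]
  refine Real.sqrt_le_iff.2 ⟨(Real.exp_pos _).le, ?_⟩
  rw [← Real.exp_nat_mul]
  have h1 : (2 * Real.pi)⁻¹ * (Real.pi / (1 / 2 - s)) = (1 - 2 * s)⁻¹ := by
    field_simp
  rw [h1]
  have h2 : (1 - 2 * s)⁻¹ ≤ 1 + 4 * s := by
    rw [inv_le_iff_one_le_mul₀ (by linarith)]
    nlinarith
  have h3 := Real.add_one_le_exp ((2 : ℕ) * (2 * s))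
  push_cast at h3 ⊢
  linarith

/-! ### The feature map of the kernel -/

theorem norm_coe_S {d : ℕ} (x : S d) : ‖(x : E d)‖ = 1 := by simp

theorem measurableSet_inner_pos {d : ℕ} (x : E d) : MeasurableSet {w : E d | 0 < ⟪w, x⟫} :=
  measurableSet_lt measurable_const (by fun_prop)

theorem kernel_eq_stdGaussian {d : ℕ} (x s : S d) :
    kernel x s = ⟪(x : E d), (s : E d)⟫ *
      (stdGaussian (E d)).real {w | 0 < ⟪w, (x : E d)⟫ ∧ 0 < ⟪w, (s : E d)⟫} := by
  rw [stdGaussian_inner_pos_inner_pos (norm_coe_S x) (norm_coe_S s), kernel]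
  ring

theorem kernel_self {d : ℕ} (x : S d) : kernel x x = 1 / 2 := by
  have := Real.pi_pos
  rw [kernel, real_inner_self_eq_norm_sq, norm_coe_S]
  simp
  field_simp

/-- The kernel is positive semidefinite: it is the Gram kernel of the gradient features
`x ↦ (w ↦ 1{⟨w, x⟩ > 0} x)`, which take values in the `L²` space of vector fields under the standard
Gaussian measure. -/
theorem exists_featureMap (d : ℕ) :
    ∃ ψ : S d → Lp (E d) 2 (stdGaussian (E d)), Continuous ψ ∧ ∀ x s, ⟪ψ x, ψ s⟫ = kernel x s := by
  let ψ : S d → Lp (E d) 2 (stdGaussian (E d)) := fun x =>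
    indicatorConstLp 2 (measurableSet_inner_pos (x : E d)) (measure_ne_top _ _) (x : E d)
  have hψ : ∀ x s, ⟪ψ x, ψ s⟫ = kernel x s := by
    intro x s
    rw [L2.inner_indicatorConstLp_indicatorConstLp, kernel_eq_stdGaussian, smul_eq_mul, mul_comm]
    rfl
  refine ⟨ψ, ?_, hψ⟩
  -- continuity of the kernel gives continuity of `ψ`: `‖ψ y - ψ x‖ ^ 2 = 1 - 2 K(y, x)`
  rw [continuous_iff_continuousAt]
  intro x
  rw [ContinuousAt, tendsto_iff_norm_sub_tendsto_zero]
  have h1 : ∀ y, ‖ψ y - ψ x‖ = √(1 - 2 * kernel y x) := by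
    intro y
    rw [← Real.sqrt_sq (norm_nonneg (ψ y - ψ x)), norm_sub_sq_real,
      ← real_inner_self_eq_norm_sq, ← real_inner_self_eq_norm_sq, hψ, hψ, hψ, kernel_self,
      kernel_self]
    congr 1
    ring
  have h2 : Continuous fun y : S d => √(1 - 2 * kernel y x) := by
    have : Continuous fun y : S d => kernel y x :=
      continuous_kernel.comp (Continuous.prodMk_left x)
    fun_prop
  have h3 := h2.tendsto x
  simp only [h1]
  convert h3 using 2
  rw [kernel_self]
  norm_num

section FeatureIntegral

variable {d : ℕ} (ρ : Measure (S d)) [IsProbabilityMeasure ρ]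
  {H : Type*} [NormedAddCommGroup H] [InnerProductSpace ℝ H] {ψ : S d → H}

theorem norm_feature_sq (hψ : ∀ x s, ⟪ψ x, ψ s⟫ = kernel x s) (x : S d) : ‖ψ x‖ ^ 2 = 1 / 2 := by
  rw [← real_inner_self_eq_norm_sq, hψ, kernel_self]

theorem norm_feature_le_one (hψ : ∀ x s, ⟪ψ x, ψ s⟫ = kernel x s) (x : S d) : ‖ψ x‖ ≤ 1 := by
  have := norm_feature_sq hψ x
  nlinarith [norm_nonneg (ψ x)]

theorem integrable_smul_feature (hc : Continuous ψ) (hψ : ∀ x s, ⟪ψ x, ψ s⟫ = kernel x s)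
    (f : Lp ℝ 2 ρ) : Integrable (fun s => f s • ψ s) ρ := by
  have hf : Integrable f ρ := (Lp.memLp f).integrable (by norm_num)
  refine hf.mono (hf.1.smul hc.aestronglyMeasurable) (Filter.Eventually.of_forall fun s => ?_)
  rw [norm_smul]
  exact mul_le_of_le_one_right (norm_nonneg _) (norm_feature_le_one hψ s)

theorem inner_feature_integral [CompleteSpace H] (hc : Continuous ψ)
    (hψ : ∀ x s, ⟪ψ x, ψ s⟫ = kernel x s) (f : Lp ℝ 2 ρ) (x : S d) :
    ⟪ψ x, ∫ s, f s • ψ s ∂ρ⟫ = kernelFun ρ f x := by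
  rw [← integral_inner (integrable_smul_feature ρ hc hψ f), kernelFun]
  simp only [inner_smul_right, hψ, mul_comm]

theorem coeFn_kernelOp (f : Lp ℝ 2 ρ) : kernelOp ρ f =ᵐ[ρ] kernelFun ρ f :=
  (memLp_kernelFun ρ f).coeFn_toLp

/-- Integration against the feature map carries the quadratic form of the integral operator to the
inner product of the feature space. -/
theorem inner_integral_feature_integral_feature [CompleteSpace H] (hc : Continuous ψ)
    (hψ : ∀ x s, ⟪ψ x, ψ s⟫ = kernel x s) (f g : Lp ℝ 2 ρ) :
    ⟪∫ s, f s • ψ s ∂ρ, ∫ s, g s • ψ s ∂ρ⟫ = ⟪kernelOp ρ f, g⟫ := by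
  rw [← integral_inner (integrable_smul_feature ρ hc hψ g), L2.inner_def]
  refine integral_congr_ae ?_
  filter_upwards [coeFn_kernelOp ρ f] with x hx
  rw [inner_smul_right, real_inner_comm, inner_feature_integral ρ hc hψ, hx]
  simp

end FeatureIntegral

/-! ### The spectrum of the integral operator -/

section Spectrum

variable {d : ℕ} (ρ : Measure (S d)) [IsProbabilityMeasure ρ]

theorem isSymmetric_kernelOp : (kernelOp ρ : Lp ℝ 2 ρ →ₗ[ℝ] Lp ℝ 2 ρ).IsSymmetric := by
  obtain ⟨ψ, hc, hψ⟩ := exists_featureMap d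
  intro f g
  have h1 := inner_integral_feature_integral_feature ρ hc hψ f g
  have h2 := inner_integral_feature_integral_feature ρ hc hψ g f
  rw [real_inner_comm, h1] at h2
  rw [ContinuousLinearMap.coe_coe, h2, real_inner_comm]

theorem norm_kernelOp_le (f : Lp ℝ 2 ρ) : ‖kernelOp ρ f‖ ≤ ‖f‖ := by
  refine ((kernelOp ρ).le_of_opNorm_le ?_ f).trans_eq (one_mul _)
  exact LinearMap.mkContinuous_norm_le _ zero_le_one _

/-- The Hilbert-Schmidt norm of the integral operator is at most `1`, because each section
`kernel x` has norm at most `1` in `L²(ρ)`. -/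
theorem sum_norm_kernelOp_sq_le {N : ℕ} {u : Fin N → Lp ℝ 2 ρ} (hu : Orthonormal ℝ u) :
    ∑ i, ‖kernelOp ρ (u i)‖ ^ 2 ≤ 1 := by
  have hk : ∀ x : S d, MemLp (kernel x) 2 ρ := fun x =>
    MemLp.of_bound (continuous_kernel.comp (Continuous.prodMk_right x)).aestronglyMeasurable 1
      (Filter.Eventually.of_forall fun s => abs_kernel_le x s)
  -- `(L_K u_i)(x)` is the inner product of `u_i` with the section `kernel x`
  have hbessel : ∀ x : S d, ∑ i, kernelFun ρ (u i) x ^ 2 ≤ 1 := by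
    intro x
    have h1 := hu.sum_inner_products_le ((hk x).toLp (kernel x)) (s := Finset.univ)
    have h2 : ‖(hk x).toLp (kernel x)‖ ≤ 1 := by
      have := Lp.norm_le_of_ae_bound (f := (hk x).toLp (kernel x)) zero_le_one (by
        filter_upwards [(hk x).coeFn_toLp] with s hs
        rw [hs]
        exact abs_kernel_le x s)
      simpa [measureUnivNNReal] using this
    have h3 : ∀ i, ‖⟪u i, (hk x).toLp (kernel x)⟫‖ ^ 2 = kernelFun ρ (u i) x ^ 2 := by
      intro i
      rw [Real.norm_eq_abs, sq_abs, L2.inner_def, kernelFun]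
      congr 1
      refine integral_congr_ae ?_
      filter_upwards [(hk x).coeFn_toLp] with s hs
      rw [hs]
      simp
    rw [Finset.sum_congr rfl fun i _ => h3 i] at h1
    exact h1.trans (pow_le_one₀ (norm_nonneg _) h2)
  have hint : ∀ i, Integrable (fun x => kernelFun ρ (u i) x ^ 2) ρ := fun i =>
    (memLp_kernelFun ρ (u i)).integrable_sq
  have h4 : ∀ i, ‖kernelOp ρ (u i)‖ ^ 2 = ∫ x, kernelFun ρ (u i) x ^ 2 ∂ρ := by
    intro i
    rw [← real_inner_self_eq_norm_sq, L2.inner_def]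
    refine integral_congr_ae ?_
    filter_upwards [coeFn_kernelOp ρ (u i)] with x hx
    rw [hx]
    simp [sq]
  rw [Finset.sum_congr rfl fun i _ => h4 i, ← integral_finsetSum _ fun i _ => hint i]
  calc ∫ x, ∑ i, kernelFun ρ (u i) x ^ 2 ∂ρ ≤ ∫ _, (1 : ℝ) ∂ρ :=
        integral_mono (integrable_finsetSum _ fun i _ => hint i) (integrable_const _) hbessel
    _ = 1 := by simp

/-- There are at most `ε⁻²` orthonormal vectors on which the Hilbert-Schmidt operator is at least
`ε`. -/
theorem card_mul_sq_le_one {ε : ℝ} (hε : 0 ≤ ε) {N : ℕ} {u : Fin N → Lp ℝ 2 ρ}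
    (hu : Orthonormal ℝ u) (h : ∀ i, ε ≤ ‖kernelOp ρ (u i)‖) : N * ε ^ 2 ≤ 1 := by
  refine le_trans ?_ (sum_norm_kernelOp_sq_le ρ hu)
  calc (N : ℝ) * ε ^ 2 = ∑ _i : Fin N, ε ^ 2 := by simp
    _ ≤ _ := Finset.sum_le_sum fun i _ => pow_le_pow_left₀ hε (h i) 2

theorem mem_eigSpace_iff {θ : ℝ} {v : Lp ℝ 2 ρ} : v ∈ eigSpace ρ θ ↔ kernelOp ρ v = θ • v := by
  simp [eigSpace]

theorem le_norm_kernelOp_of_mem_iSup {ε : ℝ} (hε : 0 ≤ ε) {v : Lp ℝ 2 ρ}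
    (hv : v ∈ (⨆ θ ≥ ε, eigSpace ρ θ : Submodule ℝ (Lp ℝ 2 ρ))) :
    ε * ‖v‖ ≤ ‖kernelOp ρ v‖ := by
  rw [iSup_subtype', Submodule.mem_iSup_iff_exists_finsupp] at hv
  obtain ⟨g, hg, rfl⟩ := hv
  -- a vector of the span is a finite sum of orthogonal eigenvectors
  have horth := (isSymmetric_kernelOp ρ).orthogonalFamily_eigenspaces.comp
    (Subtype.coe_injective (p := fun θ : ℝ => θ ≥ ε))
  have h1 := horth.norm_sum (fun i => ⟨g i, hg i⟩) g.support
  have h2 := horth.norm_sum (fun i => ⟨(i : ℝ) • g i, Submodule.smul_mem _ _ (hg i)⟩) g.support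
  have h3 : kernelOp ρ (g.sum fun _ xi => xi) = ∑ i ∈ g.support, (i : ℝ) • g i := by
    rw [Finsupp.sum, map_sum]
    exact Finset.sum_congr rfl fun i _ => (mem_eigSpace_iff ρ).1 (hg i)
  rw [← sq_le_sq₀ (by positivity) (norm_nonneg _)]
  rw [h3, mul_pow]
  have h1' : ‖g.sum fun _ xi => xi‖ ^ 2 = ∑ i ∈ g.support, ‖g i‖ ^ 2 := h1
  have h2' : ‖∑ i ∈ g.support, (i : ℝ) • g i‖ ^ 2 = ∑ i ∈ g.support, ‖(i : ℝ) • g i‖ ^ 2 := h2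
  rw [h1', h2', Finset.mul_sum]
  refine Finset.sum_le_sum fun i _ => ?_
  rw [norm_smul, mul_pow, Real.norm_eq_abs, sq_abs]
  have : ε ≤ (i : ℝ) := i.2
  gcongr

theorem finite_iSup_eigSpace {ε : ℝ} (hε : 0 < ε) :
    Module.Finite ℝ (⨆ θ ≥ ε, eigSpace ρ θ : Submodule ℝ (Lp ℝ 2 ρ)) := by
  set V := (⨆ θ ≥ ε, eigSpace ρ θ : Submodule ℝ (Lp ℝ 2 ρ)) with hV
  by_contra hfin
  have hrank : Cardinal.aleph0 ≤ Module.rank ℝ V := by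
    rw [← not_lt]
    exact fun h => hfin (Module.rank_lt_aleph0_iff.1 h)
  obtain ⟨N, hN⟩ := exists_nat_gt (1 / ε ^ 2)
  obtain ⟨b, hb⟩ := exists_linearIndependent_of_le_rank
    ((Cardinal.natCast_lt_aleph0 (n := N)).le.trans hrank)
  have hon := InnerProductSpace.gramSchmidtNormed_orthonormal (𝕜 := ℝ) hb
  set u := InnerProductSpace.gramSchmidtNormed ℝ b
  have hon' : Orthonormal ℝ (fun i => (u i : Lp ℝ 2 ρ)) :=
    hon.comp_linearIsometry V.subtypeₗᵢ
  have := card_mul_sq_le_one ρ hε.le hon' fun i => by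
    have h := le_norm_kernelOp_of_mem_iSup ρ hε.le (u i).2
    rwa [hon'.1 i, mul_one] at h
  rw [div_lt_iff₀ (by positivity)] at hN
  linarith

theorem finite_eigs_ge {ε : ℝ} (hε : 0 < ε) : {θ | θ ∈ eigs ρ ∧ ε ≤ θ}.Finite := by
  by_contra hinf
  obtain ⟨N, hN⟩ := exists_nat_gt (1 / ε ^ 2)
  obtain ⟨t, ht, hcard⟩ := Set.Infinite.exists_subset_card_eq hinf N
  have hv : ∀ i : Fin N, ∃ v : Lp ℝ 2 ρ,
      v ∈ eigSpace ρ (t.equivFinOfCardEq hcard |>.symm i : ℝ) ∧ ‖v‖ = 1 := by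
    intro i
    have hi := (ht (t.equivFinOfCardEq hcard |>.symm i).2).1
    obtain ⟨v, hv⟩ := Module.End.HasEigenvalue.exists_hasEigenvector hi
    exact ⟨(‖v‖)⁻¹ • v, Submodule.smul_mem _ _ hv.1, norm_smul_inv_norm hv.2⟩
  choose v hv1 hv2 using hv
  have hon : Orthonormal ℝ v := by
    refine ⟨hv2, fun i j hij => ?_⟩
    have := (isSymmetric_kernelOp ρ).orthogonalFamily_eigenspaces
      (i := (t.equivFinOfCardEq hcard |>.symm i : ℝ))
      (j := (t.equivFinOfCardEq hcard |>.symm j : ℝ)) (fun h => hij (by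
        simpa [Subtype.coe_injective.eq_iff] using h))
    exact this ⟨v i, hv1 i⟩ ⟨v j, hv1 j⟩
  have := card_mul_sq_le_one ρ hε.le hon fun i => by
    rw [(mem_eigSpace_iff ρ).1 (hv1 i), norm_smul, hv2, mul_one]
    exact (ht (t.equivFinOfCardEq hcard |>.symm i).2).2.trans (le_abs_self _)
  rw [div_lt_iff₀ (by positivity)] at hN
  linarith

/-- A positive supremum of eigenvalues is attained. Positivity also excludes the junk value `0` of
the supremum of an empty or unbounded set. -/
theorem sSup_mem_of_subset_eigs {A : Set ℝ} (hA : A ⊆ eigs ρ) (hpos : 0 < sSup A) :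
    sSup A ∈ A ∧ ∀ θ ∈ A, θ ≤ sSup A := by
  have hbdd : BddAbove A := by
    by_contra h
    rw [Real.sSup_of_not_bddAbove h] at hpos
    exact lt_irrefl _ hpos
  have hne : A.Nonempty := by
    by_contra h
    rw [Set.not_nonempty_iff_eq_empty.1 h, Real.sSup_empty] at hpos
    exact lt_irrefl _ hpos
  refine ⟨?_, fun θ hθ => le_csSup hbdd hθ⟩
  have hfin : {θ | θ ∈ A ∧ sSup A / 2 ≤ θ}.Finite :=
    (finite_eigs_ge ρ (half_pos hpos)).subset fun θ hθ => ⟨hA hθ.1, hθ.2⟩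
  obtain ⟨θ₀, hθ₀, hlt⟩ := exists_lt_of_lt_csSup hne (half_lt_self hpos)
  obtain ⟨M, hM, hmax⟩ := hfin.exists_maximal ⟨θ₀, hθ₀, hlt.le⟩
  have hub : ∀ θ ∈ A, θ ≤ M := by
    intro θ hθ
    by_contra hc
    have hc' := not_le.1 hc
    exact hc (hmax ⟨hθ, hM.2.trans hc'.le⟩ hc'.le)
  have : sSup A = M := le_antisymm (csSup_le hne hub) (le_csSup hbdd hM.1)
  rw [this]
  exact hM.1

theorem distinctEig_mem_eigs {i : ℕ} (h : 0 < distinctEig ρ i) : distinctEig ρ i ∈ eigs ρ := by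
  cases i with
  | zero => exact (sSup_mem_of_subset_eigs ρ subset_rfl h).1
  | succ i => exact (sSup_mem_of_subset_eigs ρ (fun _ hθ => hθ.1) h).1.1

theorem distinctEig_succ_lt {i : ℕ} (h : 0 < distinctEig ρ (i + 1)) :
    distinctEig ρ (i + 1) < distinctEig ρ i :=
  (sSup_mem_of_subset_eigs ρ (A := {μ | μ ∈ eigs ρ ∧ μ < distinctEig ρ i})
    (fun _ hθ => hθ.1) h).1.2

theorem distinctEig_le_of_le {i j : ℕ} (hij : i ≤ j) (h : ∀ k ≤ j, 0 < distinctEig ρ k) :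
    distinctEig ρ j ≤ distinctEig ρ i := by
  induction j, hij using Nat.le_induction with
  | base => exact le_rfl
  | succ j hij ih =>
    exact (distinctEig_succ_lt ρ (h _ le_rfl)).le.trans (ih fun k hk => h k (hk.trans j.le_succ))

theorem distinctEig_lt_of_lt {i j : ℕ} (hij : i < j) (h : ∀ k ≤ j, 0 < distinctEig ρ k) :
    distinctEig ρ j < distinctEig ρ i := by
  obtain ⟨j, rfl⟩ := Nat.exists_eq_add_of_lt hij
  exact (distinctEig_succ_lt ρ (h _ le_rfl)).trans_le
    (distinctEig_le_of_le ρ (Nat.le_add_right i j) fun k hk => h k (hk.trans (Nat.le_succ _)))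

/-- Every eigenvalue that is at least a positive term of the decreasing enumeration occurs in it. -/
theorem exists_distinctEig_eq {j : ℕ} (h : ∀ k ≤ j, 0 < distinctEig ρ k) {θ : ℝ}
    (hθ : θ ∈ eigs ρ) (hle : distinctEig ρ j ≤ θ) : ∃ i ≤ j, θ = distinctEig ρ i := by
  induction j with
  | zero =>
    exact ⟨0, le_rfl, le_antisymm ((sSup_mem_of_subset_eigs ρ subset_rfl (h 0 le_rfl)).2 θ hθ) hle⟩
  | succ j ih =>
    rcases le_or_gt (distinctEig ρ j) θ with hj | hj
    · obtain ⟨i, hi, rfl⟩ := ih (fun k hk => h k (hk.trans j.le_succ)) hj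
      exact ⟨i, hi.trans j.le_succ, rfl⟩
    · refine ⟨j + 1, le_rfl, le_antisymm ?_ hle⟩
      exact (sSup_mem_of_subset_eigs ρ (A := {μ | μ ∈ eigs ρ ∧ μ < distinctEig ρ j})
        (fun θ hθ => hθ.1) (h _ le_rfl)).2 θ ⟨hθ, hj⟩

theorem eigSpace_eq_bot {θ : ℝ} (hθ : θ ∉ eigs ρ) : eigSpace ρ θ = ⊥ := by
  by_contra h
  exact hθ (Module.End.hasEigenvalue_iff.2 h)

theorem iSup_eigSpace_mono {ε ε' : ℝ} (h : ε ≤ ε') :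
    (⨆ θ ≥ ε', eigSpace ρ θ : Submodule ℝ (Lp ℝ 2 ρ)) ≤ ⨆ θ ≥ ε, eigSpace ρ θ :=
  iSup₂_le fun θ hθ => le_iSup₂_of_le θ (h.trans hθ) le_rfl

/-- The eigenspaces of the eigenvalues `≥ μ_{j+1}` span the sum of the first `j + 1` eigenspaces,
whose dimension is the sum of the multiplicities. -/
theorem finrank_iSup_eigSpace {j : ℕ} (h : ∀ k ≤ j, 0 < distinctEig ρ k) :
    Module.finrank ℝ (⨆ θ ≥ distinctEig ρ j, eigSpace ρ θ : Submodule ℝ (Lp ℝ 2 ρ)) =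
      multSum ρ (j + 1) := by
  induction j with
  | zero =>
    have : (⨆ θ ≥ distinctEig ρ 0, eigSpace ρ θ : Submodule ℝ (Lp ℝ 2 ρ)) =
        eigSpace ρ (distinctEig ρ 0) := by
      refine le_antisymm (iSup₂_le fun θ hθ => ?_) (le_iSup₂_of_le _ le_rfl le_rfl)
      by_cases hm : θ ∈ eigs ρ
      · obtain ⟨i, hi, rfl⟩ := exists_distinctEig_eq ρ h hm hθ
        rw [Nat.le_zero.1 hi]
      · rw [eigSpace_eq_bot ρ hm]
        exact bot_le
    rw [this, multSum, Finset.sum_range_one]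
  | succ j ih =>
    have h' : ∀ k ≤ j, 0 < distinctEig ρ k := fun k hk => h k (hk.trans j.le_succ)
    have hlt := distinctEig_succ_lt ρ (h (j + 1) le_rfl)
    have hsup : (⨆ θ ≥ distinctEig ρ (j + 1), eigSpace ρ θ : Submodule ℝ (Lp ℝ 2 ρ)) =
        (⨆ θ ≥ distinctEig ρ j, eigSpace ρ θ) ⊔ eigSpace ρ (distinctEig ρ (j + 1)) := by
      refine le_antisymm (iSup₂_le fun θ hθ => ?_)
        (sup_le (iSup_eigSpace_mono ρ hlt.le) (le_iSup₂_of_le _ le_rfl le_rfl))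
      by_cases hm : θ ∈ eigs ρ
      · obtain ⟨i, hi, rfl⟩ := exists_distinctEig_eq ρ h hm hθ
        rcases Nat.le_succ_iff.1 hi with hi | rfl
        · exact le_sup_of_le_left (le_iSup₂_of_le _ (distinctEig_le_of_le ρ hi h') le_rfl)
        · exact le_sup_right
      · rw [eigSpace_eq_bot ρ hm]
        exact bot_le
    have hdisj : Disjoint (⨆ θ ≥ distinctEig ρ j, eigSpace ρ θ : Submodule ℝ (Lp ℝ 2 ρ))
        (eigSpace ρ (distinctEig ρ (j + 1))) := by
      refine ((Module.End.eigenspaces_iSupIndep (kernelOp ρ : Lp ℝ 2 ρ →ₗ[ℝ] Lp ℝ 2 ρ))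
        (distinctEig ρ (j + 1))).symm.mono_left (iSup₂_le fun θ hθ => ?_)
      exact le_iSup₂_of_le θ (hlt.trans_le hθ).ne' le_rfl
    have := finite_iSup_eigSpace ρ (h' j le_rfl)
    have hf2 := finite_iSup_eigSpace ρ (h (j + 1) le_rfl)
    have : Module.Finite ℝ (eigSpace ρ (distinctEig ρ (j + 1))) :=
      Submodule.finiteDimensional_of_le
        (le_iSup₂_of_le (f := fun θ (_ : θ ≥ distinctEig ρ (j + 1)) => eigSpace ρ θ) _ le_rfl
          le_rfl)
    have hdim := Submodule.finrank_sup_add_finrank_inf_eq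
      (⨆ θ ≥ distinctEig ρ j, eigSpace ρ θ : Submodule ℝ (Lp ℝ 2 ρ))
      (eigSpace ρ (distinctEig ρ (j + 1)))
    rw [hdisj.eq_bot, finrank_bot, add_zero, ih h'] at hdim
    rw [hsup, hdim, multSum, multSum, Finset.sum_range_succ _ (j + 1)]

theorem finrank_eigSpace_pos {i : ℕ} (h : 0 < distinctEig ρ i) :
    0 < Module.finrank ℝ (eigSpace ρ (distinctEig ρ i)) := by
  have := finite_iSup_eigSpace ρ h
  have : Module.Finite ℝ (eigSpace ρ (distinctEig ρ i)) :=
    Submodule.finiteDimensional_of_le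
      (le_iSup₂_of_le (f := fun θ (_ : θ ≥ distinctEig ρ i) => eigSpace ρ θ) _ le_rfl le_rfl)
  refine Submodule.one_le_finrank_iff.2 ?_
  exact Module.End.hasEigenvalue_iff.1 (distinctEig_mem_eigs ρ h)

theorem eig_multSum {j : ℕ} (h : ∀ k ≤ j, 0 < distinctEig ρ k) :
    eig ρ (multSum ρ (j + 1)) = distinctEig ρ j := by
  have := finite_iSup_eigSpace ρ (h j le_rfl)
  refine IsGreatest.csSup_eq ⟨⟨h j le_rfl, ?_⟩, ?_⟩
  · rw [← finrank_iSup_eigSpace ρ h, Module.finrank_eq_rank]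
  · rintro μ ⟨hμ0, hμ⟩
    by_contra hc
    have hc := not_le.1 hc
    have hlt : Module.finrank ℝ (⨆ θ ≥ μ, eigSpace ρ θ : Submodule ℝ (Lp ℝ 2 ρ)) <
        multSum ρ (j + 1) := by
      cases j with
      | zero =>
        have hbot : (⨆ θ ≥ μ, eigSpace ρ θ : Submodule ℝ (Lp ℝ 2 ρ)) = ⊥ := by
          rw [eq_bot_iff]
          refine iSup₂_le fun θ hθ => ?_
          by_cases hm : θ ∈ eigs ρ
          · obtain ⟨i, hi, rfl⟩ := exists_distinctEig_eq ρ h hm (hc.le.trans hθ)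
            rw [Nat.le_zero.1 hi] at hθ
            exact absurd hθ (not_le.2 hc)
          · rw [eigSpace_eq_bot ρ hm]
        rw [hbot, finrank_bot, multSum, Finset.sum_range_one]
        exact finrank_eigSpace_pos ρ (h 0 le_rfl)
      | succ j =>
        have h' : ∀ k ≤ j, 0 < distinctEig ρ k := fun k hk => h k (hk.trans j.le_succ)
        have hle : (⨆ θ ≥ μ, eigSpace ρ θ : Submodule ℝ (Lp ℝ 2 ρ)) ≤
            ⨆ θ ≥ distinctEig ρ j, eigSpace ρ θ := by
          refine iSup₂_le fun θ hθ => ?_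
          by_cases hm : θ ∈ eigs ρ
          · obtain ⟨i, hi, rfl⟩ := exists_distinctEig_eq ρ h hm (hc.le.trans hθ)
            rcases Nat.le_succ_iff.1 hi with hi | rfl
            · exact le_iSup₂_of_le _ (distinctEig_le_of_le ρ hi h') le_rfl
            · exact absurd hθ (not_le.2 hc)
          · rw [eigSpace_eq_bot ρ hm]
            exact bot_le
        have := finite_iSup_eigSpace ρ (h' j le_rfl)
        have h1 := Submodule.finrank_mono hle
        rw [finrank_iSup_eigSpace ρ h'] at h1
        refine h1.trans_lt ?_
        rw [multSum, multSum, Finset.sum_range_succ _ (j + 1)]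
        exact Nat.lt_add_of_pos_right (finrank_eigSpace_pos ρ (h _ le_rfl))
    have := finite_iSup_eigSpace ρ hμ0
    rw [← Module.finrank_eq_rank, Nat.cast_le] at hμ
    omega

theorem eig_nonneg (i : ℕ) : 0 ≤ eig ρ i := Real.sSup_nonneg fun _ hμ => hμ.1.le

/-- There is a gap after the first `j + 1` distinct eigenvalues, whether the next term of the
enumeration is another eigenvalue or the value `0` after the positive eigenvalues are exhausted. -/
theorem eig_multSum_succ_lt {j : ℕ} (h : ∀ k ≤ j, 0 < distinctEig ρ k) :
    eig ρ (multSum ρ (j + 1) + 1) < distinctEig ρ j := by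
  have hfin := finite_iSup_eigSpace ρ (h j le_rfl)
  set A := {μ : ℝ | 0 < μ ∧ ((multSum ρ (j + 1) + 1 : ℕ) : Cardinal) ≤
    Module.rank ℝ (⨆ θ ≥ μ, eigSpace ρ θ : Submodule ℝ (Lp ℝ 2 ρ))} with hA
  -- if no eigenvalue lay in `[μ, μ_{j+1})`, the rank above `μ` would be `multSum ρ (j + 1)`
  have hstep : ∀ μ ∈ A, ∃ θ ∈ eigs ρ, μ ≤ θ ∧ θ < distinctEig ρ j := by
    rintro μ ⟨hμ0, hμ⟩
    by_contra! hc
    have hle : (⨆ θ ≥ μ, eigSpace ρ θ : Submodule ℝ (Lp ℝ 2 ρ)) ≤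
        ⨆ θ ≥ distinctEig ρ j, eigSpace ρ θ := by
      refine iSup₂_le fun θ hθ => ?_
      by_cases hm : θ ∈ eigs ρ
      · exact le_iSup₂_of_le θ (hc θ hm hθ) le_rfl
      · rw [eigSpace_eq_bot ρ hm]
        exact bot_le
    have h1 := hμ.trans (Submodule.rank_mono hle)
    rw [← Module.finrank_eq_rank, finrank_iSup_eigSpace ρ h, Nat.cast_le] at h1
    omega
  change sSup A < _
  rcases A.eq_empty_or_nonempty with hemp | ⟨μ₀, hμ₀⟩
  · rw [hemp, Real.sSup_empty]
    exact h j le_rfl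
  · have hbdd : BddAbove {μ | μ ∈ eigs ρ ∧ μ < distinctEig ρ j} :=
      ⟨distinctEig ρ j, fun μ hμ => hμ.2.le⟩
    have hub : ∀ μ ∈ A, μ ≤ distinctEig ρ (j + 1) := by
      intro μ hμ
      obtain ⟨θ, hθ, h1, h2⟩ := hstep μ hμ
      exact h1.trans (le_csSup hbdd ⟨hθ, h2⟩)
    have hpos : 0 < distinctEig ρ (j + 1) := hμ₀.1.trans_le (hub μ₀ hμ₀)
    exact (csSup_le ⟨μ₀, hμ₀⟩ hub).trans_lt (distinctEig_succ_lt ρ hpos)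

theorem le_one_of_mem_eigs {θ : ℝ} (hθ : θ ∈ eigs ρ) : θ ≤ 1 := by
  obtain ⟨v, hv⟩ := Module.End.HasEigenvalue.exists_hasEigenvector hθ
  have h1 := norm_kernelOp_le ρ v
  rw [(mem_eigSpace_iff ρ).1 hv.1, norm_smul] at h1
  have h2 : 0 < ‖v‖ := norm_pos_iff.2 hv.2
  exact (le_abs_self θ).trans ((mul_le_iff_le_one_left h2).1 h1)

/-- A target that lies in the span of the first `ℓ` eigenspaces is a combination of orthonormal
eigenfunctions, one for each of the eigenspaces. -/
theorem exists_eigenfunctions {f : S d → ℝ} (hf : Measurable f)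
    (hb : ∀ᵐ x ∂ρ, f x ∈ Set.Icc (-1) 1) {ℓ : ℕ} (h : ∀ i < ℓ, 0 < distinctEig ρ i)
    (h0 : approxError ρ f (memLp_target ρ hf hb) ℓ = 0) :
    ∃ (u : Fin ℓ → Lp ℝ 2 ρ) (c : Fin ℓ → ℝ), Orthonormal ℝ u ∧
      (∀ i, kernelOp ρ (u i) = distinctEig ρ i • u i) ∧ ∑ i, c i ^ 2 ≤ 1 ∧
      ∀ᵐ x ∂ρ, f x = ∑ i, c i * u i x := by
  set F := (memLp_target ρ hf hb).toLp f with hF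
  have hv : ∀ i : Fin ℓ, ∃ (v : Lp ℝ 2 ρ) (c : ℝ), v ∈ eigSpace ρ (distinctEig ρ i) ∧ ‖v‖ = 1 ∧
      (eigSpace ρ (distinctEig ρ i)).starProjection F = c • v := by
    intro i
    -- a vanishing projection is represented by an arbitrary eigenfunction with coefficient `0`
    by_cases hz : (eigSpace ρ (distinctEig ρ i)).starProjection F = 0
    · obtain ⟨v, hv⟩ := Module.End.HasEigenvalue.exists_hasEigenvector
        (distinctEig_mem_eigs ρ (h i i.2))
      exact ⟨(‖v‖)⁻¹ • v, 0, Submodule.smul_mem _ _ hv.1, norm_smul_inv_norm hv.2, by simp [hz]⟩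
    · set v := (eigSpace ρ (distinctEig ρ i)).starProjection F with hv
      refine ⟨(‖v‖)⁻¹ • v, ‖v‖, Submodule.smul_mem _ _ ?_, norm_smul_inv_norm hz, ?_⟩
      · rw [hv]
        exact Submodule.starProjection_apply_mem _ _
      · rw [smul_inv_smul₀ (norm_ne_zero_iff.2 hz)]
  choose u c hu1 hu2 hu3 using hv
  have hinj : ∀ i j : Fin ℓ, i ≠ j → distinctEig ρ i ≠ distinctEig ρ j := by
    intro i j hij
    rcases lt_or_gt_of_ne hij with hlt | hlt
    · exact (distinctEig_lt_of_lt ρ hlt fun k hk => h k (hk.trans_lt j.2)).ne'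
    · exact (distinctEig_lt_of_lt ρ hlt fun k hk => h k (hk.trans_lt i.2)).ne
  have hon : Orthonormal ℝ u := by
    refine ⟨hu2, fun i j hij => ?_⟩
    exact (isSymmetric_kernelOp ρ).orthogonalFamily_eigenspaces (hinj i j hij)
      ⟨u i, hu1 i⟩ ⟨u j, hu1 j⟩
  have hlow : lowRankPart ρ F ℓ = ∑ i, c i • u i := by
    rw [lowRankPart, Finset.sum_range]
    exact Finset.sum_congr rfl fun i _ => hu3 i
  have hae : ∀ᵐ x ∂ρ, f x = lowRankPart ρ F ℓ x := by
    rw [approxError, eLpNorm_exponent_top, eLpNormEssSup_eq_zero_iff] at h0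
    filter_upwards [h0] with x hx
    exact sub_eq_zero.1 hx
  have hFeq : F = ∑ i, c i • u i := by
    rw [← hlow]
    refine Lp.ext ?_
    filter_upwards [hae, (memLp_target ρ hf hb).coeFn_toLp] with x hx hx2
    rw [hF, hx2, hx]
  refine ⟨u, c, hon, fun i => (mem_eigSpace_iff ρ).1 (hu1 i), ?_, ?_⟩
  · have h1 : ‖F‖ ^ 2 = ∑ i, c i ^ 2 := by
      rw [← real_inner_self_eq_norm_sq, hFeq, hon.inner_sum]
      simp [sq]
    have h2 : ‖F‖ ≤ 1 := by
      have := Lp.norm_le_of_ae_bound (f := F) zero_le_one (by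
        filter_upwards [hb, (memLp_target ρ hf hb).coeFn_toLp] with x hx hx2
        rw [hF, hx2]
        exact abs_le.2 hx)
      simpa [measureUnivNNReal] using this
    rw [← h1]
    exact pow_le_one₀ (norm_nonneg _) h2
  · have h3 : (∑ i, c i • u i : Lp ℝ 2 ρ) =ᵐ[ρ] fun x => ∑ i, c i * u i x := by
      have h4 : ∀ i, ∀ᵐ x ∂ρ, (c i • u i : Lp ℝ 2 ρ) x = c i * u i x := fun i => by
        filter_upwards [Lp.coeFn_smul (c i) (u i)] with x hx
        rw [hx]
        rfl
      filter_upwards [Lp.coeFn_finsetSum Finset.univ (fun i => c i • u i), ae_all_iff.2 h4]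
        with x hx hx2
      rw [hx, Finset.sum_apply]
      exact Finset.sum_congr rfl fun i _ => hx2 i
    filter_upwards [hae, h3] with x hx hx2
    rw [hx, hlow, hx2]

variable {H : Type*} [NormedAddCommGroup H] [InnerProductSpace ℝ H] [CompleteSpace H] {ψ : S d → H}

/-- An `L²(ρ)`-orthonormal family of eigenfunctions of the integral operator gives an orthonormal
family of eigenvectors of the covariance operator `h ↦ ∫ ⟪ψ x, h⟫ ψ x dρ(x)` on the feature space,
namely the normalized integrals `e_i = μ_i^{-1/2} ∫ u_i ψ dρ`. -/
theorem exists_feature_eigenvectors (hc : Continuous ψ) (hψ : ∀ x s, ⟪ψ x, ψ s⟫ = kernel x s)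
    {ℓ : ℕ} {u : Fin ℓ → Lp ℝ 2 ρ} {μ : Fin ℓ → ℝ} (hu : Orthonormal ℝ u)
    (hμ : ∀ i, 0 < μ i) (hL : ∀ i, kernelOp ρ (u i) = μ i • u i) :
    ∃ e : Fin ℓ → H, Orthonormal ℝ e ∧ (∀ i, ∫ x, ⟪ψ x, e i⟫ • ψ x ∂ρ = μ i • e i) ∧
      ∀ i, ∀ᵐ x ∂ρ, ⟪ψ x, e i⟫ = √(μ i) * u i x := by
  have hs : ∀ i, 0 < √(μ i) := fun i => Real.sqrt_pos.2 (hμ i)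
  have hss : ∀ i, √(μ i) * √(μ i) = μ i := fun i => Real.mul_self_sqrt (hμ i).le
  have hval : ∀ i, ∀ᵐ x ∂ρ,
      ⟪ψ x, (√(μ i))⁻¹ • ∫ s, u i s • ψ s ∂ρ⟫ = √(μ i) * u i x := by
    intro i
    filter_upwards [coeFn_kernelOp ρ (u i), Lp.coeFn_smul (μ i) (u i)] with x hx1 hx2
    rw [inner_smul_right, inner_feature_integral ρ hc hψ, ← hx1, hL, hx2, Pi.smul_apply,
      smul_eq_mul, ← mul_assoc]
    nth_rw 2 [← hss i]
    rw [inv_mul_cancel_left₀ (hs i).ne']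
  refine ⟨fun i => (√(μ i))⁻¹ • ∫ s, u i s • ψ s ∂ρ, ?_, fun i => ?_, hval⟩
  · rw [orthonormal_iff_ite] at hu ⊢
    intro i j
    rw [inner_smul_left, inner_smul_right, inner_integral_feature_integral_feature ρ hc hψ, hL,
      inner_smul_left, hu]
    by_cases hij : i = j
    · subst hij
      simp only [conj_trivial, if_true, mul_one]
      nth_rw 3 [← hss i]
      rw [inv_mul_cancel_left₀ (hs i).ne', inv_mul_cancel₀ (hs i).ne']
    · simp [hij]
  · have h1 : ∫ x, ⟪ψ x, (√(μ i))⁻¹ • ∫ s, u i s • ψ s ∂ρ⟫ • ψ x ∂ρ =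
        ∫ x, √(μ i) • (u i x • ψ x) ∂ρ := by
      refine integral_congr_ae ?_
      filter_upwards [hval i] with x hx
      rw [hx, mul_smul]
    rw [h1, integral_smul, smul_smul]
    congr 1
    nth_rw 2 [← hss i]
    rw [mul_assoc, mul_inv_cancel₀ (hs i).ne', mul_one]

end Spectrum

/-! ### The empirical operator and the linearized dynamics -/

section Sampling

variable {H : Type*} [NormedAddCommGroup H] [InnerProductSpace ℝ H] {n : ℕ}

/-- The normalized sampling operator `h ↦ n^{-1/2} (⟪φ_i, h⟫)_i` of a family of features. -/
def sampling (φ : Fin n → H) : H →ₗ[ℝ] EuclideanSpace ℝ (Fin n) where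
  toFun h := WithLp.toLp 2 fun i => (1 / √n) * ⟪φ i, h⟫
  map_add' g h := by
    ext i
    simp [inner_add_right, mul_add]
  map_smul' c h := by
    ext i
    simp [inner_smul_right]
    ring

/-- The adjoint `v ↦ n^{-1/2} ∑_i v_i φ_i` of the sampling operator. -/
def samplingAdj (φ : Fin n → H) : EuclideanSpace ℝ (Fin n) →ₗ[ℝ] H where
  toFun v := (1 / √n) • ∑ i, v i • φ i
  map_add' u v := by
    simp [add_smul, Finset.sum_add_distrib]
  map_smul' c v := by
    simp only [PiLp.smul_apply, smul_eq_mul, RingHom.id_apply, mul_smul, ← Finset.smul_sum]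
    rw [smul_comm]

theorem sampling_apply (φ : Fin n → H) (h : H) (i : Fin n) :
    sampling φ h i = (1 / √n) * ⟪φ i, h⟫ := rfl

theorem samplingAdj_apply (φ : Fin n → H) (v : EuclideanSpace ℝ (Fin n)) :
    samplingAdj φ v = (1 / √n) • ∑ i, v i • φ i := rfl

theorem inner_sampling (φ : Fin n → H) (h : H) (v : EuclideanSpace ℝ (Fin n)) :
    ⟪sampling φ h, v⟫ = ⟪h, samplingAdj φ v⟫ := by
  rw [samplingAdj_apply, inner_smul_right, inner_sum, PiLp.inner_apply, Finset.mul_sum]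
  refine Finset.sum_congr rfl fun i _ => ?_
  rw [sampling_apply, inner_smul_right, real_inner_comm h]
  simp
  ring

/-- One step of gradient descent for the linearized model. -/
def linearStep (φ : Fin n → H) (v : EuclideanSpace ℝ (Fin n)) : EuclideanSpace ℝ (Fin n) :=
  v - sampling φ (samplingAdj φ v)

theorem linearStep_sub (φ : Fin n → H) (u v : EuclideanSpace ℝ (Fin n)) :
    linearStep φ (u - v) = linearStep φ u - linearStep φ v := by
  simp only [linearStep, map_sub]
  abel

variable {φ : Fin n → H} (hφ : ∀ i, ‖φ i‖ ≤ 1)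
include hφ

theorem norm_sampling_le (h : H) : ‖sampling φ h‖ ≤ ‖h‖ := by
  rw [← sq_le_sq₀ (norm_nonneg _) (norm_nonneg _), EuclideanSpace.norm_sq_eq]
  have h1 : ∀ i, ‖sampling φ h i‖ ^ 2 ≤ (1 / √n) ^ 2 * ‖h‖ ^ 2 := by
    intro i
    rw [sampling_apply, norm_mul, mul_pow, Real.norm_eq_abs, sq_abs]
    gcongr
    calc ‖⟪φ i, h⟫‖ ≤ ‖φ i‖ * ‖h‖ := norm_inner_le_norm _ _
      _ ≤ 1 * ‖h‖ := by gcongr; exact hφ i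
      _ = ‖h‖ := one_mul _
  refine (Finset.sum_le_sum fun i _ => h1 i).trans ?_
  rw [Finset.sum_const, Finset.card_univ, Fintype.card_fin, nsmul_eq_mul, div_pow, one_pow,
    Real.sq_sqrt (Nat.cast_nonneg n), ← mul_assoc]
  refine mul_le_of_le_one_left (by positivity) ?_
  rw [mul_one_div]
  exact div_self_le_one _

/-- The decrease of the squared error in one step of the linearized dynamics is at least the squared
norm of the gradient. -/
theorem norm_linearStep_sq_add_le (v : EuclideanSpace ℝ (Fin n)) :
    ‖linearStep φ v‖ ^ 2 + ‖samplingAdj φ v‖ ^ 2 ≤ ‖v‖ ^ 2 := by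
  have h1 : ⟪v, sampling φ (samplingAdj φ v)⟫ = ‖samplingAdj φ v‖ ^ 2 := by
    rw [real_inner_comm, inner_sampling, real_inner_self_eq_norm_sq]
  have h2 := pow_le_pow_left₀ (norm_nonneg _) (norm_sampling_le hφ (samplingAdj φ v)) 2
  rw [linearStep, norm_sub_sq_real, h1]
  linarith

theorem norm_linearStep_le (v : EuclideanSpace ℝ (Fin n)) : ‖linearStep φ v‖ ≤ ‖v‖ := by
  rw [← sq_le_sq₀ (norm_nonneg _) (norm_nonneg _)]
  have := norm_linearStep_sq_add_le hφ v
  nlinarith [sq_nonneg ‖samplingAdj φ v‖]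

/-- Forcing the linearized dynamics through the sampling operator produces an error that is only
square-summable in the forcing. By duality this is the energy inequality
`norm_linearStep_sq_add_le`; the triangle inequality would give the sum of the norms instead. -/
theorem norm_forced_sq_le {e : ℕ → EuclideanSpace ℝ (Fin n)} {ζ : ℕ → H} (h0 : e 0 = 0)
    (hstep : ∀ t, e (t + 1) = linearStep φ (e t) + sampling φ (ζ t)) (t : ℕ) :
    ‖e t‖ ≤ √(∑ s ∈ Finset.range t, ‖ζ s‖ ^ 2) := by
  have key : ∀ t v, ⟪e t, v⟫ ≤ √(∑ s ∈ Finset.range t, ‖ζ s‖ ^ 2) * ‖v‖ := by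
    intro t
    induction t with
    | zero => intro v; simp [h0]
    | succ t ih =>
      intro v
      set Z := ∑ s ∈ Finset.range t, ‖ζ s‖ ^ 2 with hZ
      have hZ0 : 0 ≤ Z := Finset.sum_nonneg fun _ _ => by positivity
      -- the adjoint recursion moves one step from `e t` to the test vector `v`
      have hsymm : ⟪linearStep φ (e t), v⟫ = ⟪e t, linearStep φ v⟫ := by
        rw [linearStep, linearStep, inner_sub_left, inner_sub_right, inner_sampling,
          real_inner_comm (sampling φ _) (e t), inner_sampling,
          real_inner_comm (samplingAdj φ v)]
      rw [hstep, inner_add_left, hsymm, inner_sampling, Finset.sum_range_succ, ← hZ]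
      have h1 := ih (linearStep φ v)
      have h2 : ⟪ζ t, samplingAdj φ v⟫ ≤ ‖ζ t‖ * ‖samplingAdj φ v‖ := real_inner_le_norm _ _
      have h3 := norm_linearStep_sq_add_le hφ v
      have h4 : (√Z * ‖linearStep φ v‖ + ‖ζ t‖ * ‖samplingAdj φ v‖) ^ 2 ≤
          (√(Z + ‖ζ t‖ ^ 2) * ‖v‖) ^ 2 := by
        rw [mul_pow, Real.sq_sqrt (by positivity)]
        have h5 := Real.sq_sqrt hZ0
        -- Cauchy-Schwarz in the plane
        have h6 : (√Z * ‖linearStep φ v‖ + ‖ζ t‖ * ‖samplingAdj φ v‖) ^ 2 ≤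
            (√Z ^ 2 + ‖ζ t‖ ^ 2) * (‖linearStep φ v‖ ^ 2 + ‖samplingAdj φ v‖ ^ 2) := by
          nlinarith [sq_nonneg (√Z * ‖samplingAdj φ v‖ - ‖ζ t‖ * ‖linearStep φ v‖)]
        rw [h5] at h6
        exact h6.trans (by gcongr)
      have h7 := (sq_le_sq₀ (by positivity) (by positivity)).1 h4
      linarith
  rcases eq_or_ne (e t) 0 with hz | hz
  · rw [hz, norm_zero]
    positivity
  · have := key t (e t)
    rw [real_inner_self_eq_norm_sq, sq] at this
    exact le_of_mul_le_mul_right this (norm_pos_iff.2 hz)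

/-- A residual that follows the linearized dynamics up to a relative error `κ` in each step is
compared with the samples of functions `h t` that solve the empirical dynamics up to the errors
`ζ t`. -/
theorem norm_residual_le {r : ℕ → EuclideanSpace ℝ (Fin n)} {h ζ : ℕ → H} {κ : ℝ}
    (hh : ∀ t, h t - samplingAdj φ (sampling φ (h t)) = h (t + 1) + ζ t) {t : ℕ}
    (hr : ∀ s < t, ‖r (s + 1) - linearStep φ (r s)‖ ≤ κ * ‖r s‖) :
    ‖r t‖ ≤ ‖sampling φ (h t)‖ + √(∑ s ∈ Finset.range t, ‖ζ s‖ ^ 2) + ‖r 0 - sampling φ (h 0)‖ +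
      κ * ∑ s ∈ Finset.range t, ‖r s‖ := by
  -- the exact linearized dynamics, as an intermediary between the samples of `h t` and `r t`
  let p : ℕ → EuclideanSpace ℝ (Fin n) := fun t => (linearStep φ)^[t] (sampling φ (h 0))
  have hp : ∀ t, p (t + 1) = linearStep φ (p t) := fun t => Function.iterate_succ_apply' _ _ _
  have h1 : ‖p t - sampling φ (h t)‖ ≤ √(∑ s ∈ Finset.range t, ‖ζ s‖ ^ 2) := by
    refine norm_forced_sq_le hφ (e := fun t => p t - sampling φ (h t)) (sub_self _) (fun t => ?_) t
    have h2 : linearStep φ (sampling φ (h t)) = sampling φ (h (t + 1)) + sampling φ (ζ t) := by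
      rw [linearStep, ← map_sub, hh, map_add]
    change p (t + 1) - _ = _
    rw [hp, linearStep_sub, h2]
    abel
  have h3 : ∀ s ≤ t, ‖r s - p s‖ ≤ ‖r 0 - sampling φ (h 0)‖ +
      κ * ∑ k ∈ Finset.range s, ‖r k‖ := by
    intro s hs
    induction s with
    | zero => simp [p]
    | succ s ih =>
      have h4 : r (s + 1) - p (s + 1) =
          linearStep φ (r s - p s) + (r (s + 1) - linearStep φ (r s)) := by
        rw [hp, linearStep_sub]
        abel
      rw [h4, Finset.sum_range_succ, mul_add]
      have h5 := norm_add_le (linearStep φ (r s - p s)) (r (s + 1) - linearStep φ (r s))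
      have h6 := norm_linearStep_le hφ (r s - p s)
      have h7 := hr s (Nat.lt_of_succ_le hs)
      have h8 := ih ((Nat.le_succ s).trans hs)
      linarith
  have h9 := h3 t le_rfl
  have h10 : r t = sampling φ (h t) + (p t - sampling φ (h t)) + (r t - p t) := by abel
  calc ‖r t‖ ≤ ‖sampling φ (h t)‖ + ‖p t - sampling φ (h t)‖ + ‖r t - p t‖ := by
        conv_lhs => rw [h10]
        exact norm_add₃_le
    _ ≤ _ := by linarith

end Sampling

/-! ### The population dynamics of the target -/

section Population

variable {H : Type*} [NormedAddCommGroup H] [InnerProductSpace ℝ H] {n ℓ : ℕ}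

/-- For a target that is a combination of eigenfunctions with eigenvalues in `[lam, 1]`, the sampled
population dynamics and the accumulated sampling error stay within `(1 - lam)^t + 3σ / (2 lam)` if
the empirical operator is within `σ` of its expectation on the eigenfunctions. Since the population
dynamics stays in the span of the `e_i`, no perturbation theory for the empirical eigenvectors is
involved. -/
theorem norm_sampling_add_sqrt_le {φ : Fin n → H} {e : Fin ℓ → H}
    (he : Orthonormal ℝ e) {μ c : Fin ℓ → ℝ} {lam σ : ℝ} (hlam : 0 < lam) (hσ : 0 ≤ σ)
    (hμ : ∀ i, lam ≤ μ i) (hμ1 : ∀ i, μ i ≤ 1) (hlam1 : lam ≤ 1) (hc : ∑ i, c i ^ 2 ≤ 1)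
    (hdev : ∀ β : Fin ℓ → ℝ, ‖samplingAdj φ (sampling φ (∑ i, β i • e i)) - ∑ i, (β i * μ i) • e i‖
      ≤ σ * √(∑ i, β i ^ 2)) :
    ∃ h ζ : ℕ → H, h 0 = ∑ i, (c i / √(μ i)) • e i ∧
      (∀ t, h t - samplingAdj φ (sampling φ (h t)) = h (t + 1) + ζ t) ∧
      ∀ t, ‖sampling φ (h t)‖ + √(∑ s ∈ Finset.range t, ‖ζ s‖ ^ 2) ≤
        (1 - lam) ^ t + 3 / 2 * (σ / lam) := by
  have hμ0 : ∀ i, 0 < μ i := fun i => hlam.trans_le (hμ i)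
  set α := 1 - lam with hα
  have hα0 : 0 ≤ α := by linarith
  -- the population dynamics multiplies the coefficient of `e i` by `1 - μ i` in each step
  let β : ℕ → Fin ℓ → ℝ := fun t i => c i / √(μ i) * (1 - μ i) ^ t
  let h : ℕ → H := fun t => ∑ i, β t i • e i
  let T : ℕ → H := fun t => ∑ i, (β t i * μ i) • e i
  let ζ : ℕ → H := fun t => T t - samplingAdj φ (sampling φ (h t))
  have hpow : ∀ t i, ((1 - μ i) ^ t) ^ 2 ≤ (α ^ t) ^ 2 := fun t i => by
    have := hμ1 i
    have := hμ i
    have h1 : 0 ≤ 1 - μ i := by linarith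
    have h2 : 1 - μ i ≤ α := by linarith
    gcongr
  have hsq : ∀ i, (c i / √(μ i)) ^ 2 = c i ^ 2 / μ i := fun i => by
    rw [div_pow, Real.sq_sqrt (hμ0 i).le]
  have hβ : ∀ t, ∑ i, β t i ^ 2 ≤ (α ^ t) ^ 2 / lam := by
    intro t
    calc ∑ i, β t i ^ 2 ≤ ∑ i, c i ^ 2 * ((α ^ t) ^ 2 / lam) := by
          refine Finset.sum_le_sum fun i _ => ?_
          simp only [β]
          rw [mul_pow, hsq, div_mul_eq_mul_div, mul_div_assoc]
          have := hμ i
          have := hpow t i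
          gcongr
      _ = (∑ i, c i ^ 2) * ((α ^ t) ^ 2 / lam) := by rw [Finset.sum_mul]
      _ ≤ 1 * ((α ^ t) ^ 2 / lam) := by gcongr
      _ = _ := one_mul _
  have hβμ : ∀ t, ∑ i, μ i * β t i ^ 2 ≤ (α ^ t) ^ 2 := by
    intro t
    calc ∑ i, μ i * β t i ^ 2 ≤ ∑ i, c i ^ 2 * (α ^ t) ^ 2 := by
          refine Finset.sum_le_sum fun i _ => ?_
          simp only [β]
          rw [mul_pow, hsq, ← mul_assoc, mul_div_cancel₀ _ (hμ0 i).ne']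
          have := hpow t i
          gcongr
      _ = (∑ i, c i ^ 2) * (α ^ t) ^ 2 := by rw [Finset.sum_mul]
      _ ≤ 1 * (α ^ t) ^ 2 := by gcongr
      _ = _ := one_mul _
  have hζ : ∀ t, ‖ζ t‖ ≤ σ * √((α ^ t) ^ 2 / lam) := by
    intro t
    rw [norm_sub_rev]
    exact (hdev (β t)).trans (by gcongr; exact hβ t)
  have hhn : ∀ t, ‖h t‖ ≤ √((α ^ t) ^ 2 / lam) := by
    intro t
    refine Real.le_sqrt_of_sq_le (le_trans (le_of_eq ?_) (hβ t))
    rw [← real_inner_self_eq_norm_sq, he.inner_sum]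
    simp [sq]
  refine ⟨h, ζ, by simp [h, β], fun t => ?_, fun t => ?_⟩
  · have : h (t + 1) = h t - T t := by
      simp only [h, T, β]
      rw [← Finset.sum_sub_distrib]
      refine Finset.sum_congr rfl fun i _ => ?_
      rw [← sub_smul]
      congr 1
      ring
    rw [this]
    simp only [ζ]
    abel
  · have hS : ‖sampling φ (h t)‖ ≤ α ^ t + 1 / 2 * (σ / lam) := by
      -- the population norm of the function is `⟪T t, h t⟫`, and `ζ t` is the sampling deviation
      have h1 : ‖sampling φ (h t)‖ ^ 2 = ⟪T t, h t⟫ - ⟪ζ t, h t⟫ := by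
        rw [← real_inner_self_eq_norm_sq, inner_sampling, ← inner_sub_left, real_inner_comm]
        simp only [ζ]
        rw [sub_sub_cancel]
      have h2 : ⟪T t, h t⟫ ≤ (α ^ t) ^ 2 := by
        refine le_trans (le_of_eq ?_) (hβμ t)
        rw [he.inner_sum]
        refine Finset.sum_congr rfl fun i _ => ?_
        simp
        ring
      have h3 : -⟪ζ t, h t⟫ ≤ σ / lam * (α ^ t) ^ 2 := by
        calc -⟪ζ t, h t⟫ ≤ ‖ζ t‖ * ‖h t‖ :=
              (neg_le_abs _).trans (abs_real_inner_le_norm _ _)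
          _ ≤ (σ * √((α ^ t) ^ 2 / lam)) * √((α ^ t) ^ 2 / lam) := by
              gcongr
              exacts [hζ t, hhn t]
          _ = _ := by
              rw [mul_assoc, Real.mul_self_sqrt (by positivity)]
              ring
      have h4 : ‖sampling φ (h t)‖ ≤ α ^ t * (1 + 1 / 2 * (σ / lam)) := by
        rw [← sq_le_sq₀ (norm_nonneg _) (by positivity), h1, mul_pow]
        have : 0 ≤ (α ^ t) ^ 2 * (1 / 2 * (σ / lam)) ^ 2 := by positivity
        nlinarith
      have h5 : α ^ t ≤ 1 := pow_le_one₀ hα0 (by linarith)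
      have h6 : 0 ≤ 1 / 2 * (σ / lam) := by positivity
      nlinarith
    have hE : √(∑ s ∈ Finset.range t, ‖ζ s‖ ^ 2) ≤ σ / lam := by
      refine Real.sqrt_le_iff.2 ⟨by positivity, ?_⟩
      have h1 : ∀ s, ‖ζ s‖ ^ 2 ≤ σ ^ 2 / lam * α ^ s := by
        intro s
        calc ‖ζ s‖ ^ 2 ≤ (σ * √((α ^ s) ^ 2 / lam)) ^ 2 := by gcongr; exact hζ s
          _ = σ ^ 2 / lam * (α ^ s) ^ 2 := by
              rw [mul_pow, Real.sq_sqrt (by positivity)]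
              ring
          _ ≤ σ ^ 2 / lam * α ^ s := by
              gcongr
              exact pow_le_of_le_one (by positivity) (pow_le_one₀ hα0 (by linarith)) two_ne_zero
      calc ∑ s ∈ Finset.range t, ‖ζ s‖ ^ 2 ≤ ∑ s ∈ Finset.range t, σ ^ 2 / lam * α ^ s :=
            Finset.sum_le_sum fun s _ => h1 s
        _ = σ ^ 2 / lam * ∑ s ∈ Finset.range t, α ^ s := by rw [Finset.mul_sum]
        _ ≤ σ ^ 2 / lam * (1 / lam) := by
            gcongr
            have := geom_sum_mul_neg α t
            rw [le_div_iff₀ hlam]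
            have h2 : 0 ≤ α ^ t := by positivity
            have h3 : 1 - α = lam := by rw [hα]; ring
            rw [h3] at this
            linarith
        _ = (σ / lam) ^ 2 := by field_simp
    linarith

end Population

/-! ### Concentration of the empirical operator -/

section EmpiricalOperator

variable {d : ℕ} (ρ : Measure (S d)) [IsProbabilityMeasure ρ]
  {H : Type*} [NormedAddCommGroup H] [InnerProductSpace ℝ H] {ψ : S d → H}

/-- The deviation `x ↦ (⟪ψ x, e_i⟫ ψ x - μ_i e_i)_i` of the rank-one operator `ψ x ⊗ ψ x` from its
expectation, applied to the vectors `e_i`. -/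
def operatorDeviation {ℓ : ℕ} (ψ : S d → H) (e : Fin ℓ → H) (μ : Fin ℓ → ℝ) (x : S d) :
    PiLp 2 fun _ : Fin ℓ => H :=
  WithLp.toLp 2 fun i => ⟪ψ x, e i⟫ • ψ x - μ i • e i

theorem continuous_operatorDeviation {ℓ : ℕ} (hc : Continuous ψ) (e : Fin ℓ → H)
    (μ : Fin ℓ → ℝ) : Continuous (operatorDeviation ψ e μ) := by
  unfold operatorDeviation
  fun_prop

theorem stronglyMeasurable_sum_operatorDeviation {ℓ n : ℕ} (hc : Continuous ψ) (e : Fin ℓ → H)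
    (μ : Fin ℓ → ℝ) :
    StronglyMeasurable fun x : Fin n → S d => ∑ k, operatorDeviation ψ e μ (x k) :=
  Finset.stronglyMeasurable_fun_sum _ fun k _ =>
    (continuous_operatorDeviation hc e μ).stronglyMeasurable.comp_measurable (measurable_pi_apply k)

/-- The deviation vector of one sample has norm at most `1` whatever the number of eigenvectors, by
Bessel's inequality, so that the concentration bound does not depend on `ℓ`. -/
theorem measure_operatorDeviation_ge_le [CompleteSpace H] (hc : Continuous ψ)
    (hψ : ∀ x s, ⟪ψ x, ψ s⟫ = kernel x s) {ℓ : ℕ} {e : Fin ℓ → H} (he : Orthonormal ℝ e)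
    {μ : Fin ℓ → ℝ} (hμ : ∀ i, ∫ x, ⟪ψ x, e i⟫ • ψ x ∂ρ = μ i • e i) {n : ℕ} (hn : 0 < n) {s : ℝ}
    (hs : 0 ≤ s) :
    (Measure.pi fun _ : Fin n => ρ) {x | s ≤ ‖∑ k, operatorDeviation ψ e μ (x k)‖} ≤
      ENNReal.ofReal (2 * Real.exp (-(s ^ 2 / (2 * n)))) := by
  let Y : S d → PiLp 2 fun _ : Fin ℓ => H := fun x => WithLp.toLp 2 fun i => ⟪ψ x, e i⟫ • ψ x
  let M : PiLp 2 fun _ : Fin ℓ => H := WithLp.toLp 2 fun i => μ i • e i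
  have hX : ∀ x, operatorDeviation ψ e μ x = Y x - M := fun x => rfl
  have hYc : Continuous Y := by
    simp only [Y]
    fun_prop
  have hY : ∀ x, ‖Y x‖ ≤ 1 / 2 := by
    intro x
    rw [← sq_le_sq₀ (norm_nonneg _) (by norm_num), PiLp.norm_sq_eq_of_L2]
    have h1 : ∀ i, ‖Y x i‖ ^ 2 = 1 / 2 * ‖⟪e i, ψ x⟫‖ ^ 2 := by
      intro i
      change ‖⟪ψ x, e i⟫ • ψ x‖ ^ 2 = _
      rw [norm_smul, mul_pow, norm_feature_sq hψ, real_inner_comm]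
      ring
    rw [Finset.sum_congr rfl fun i _ => h1 i, ← Finset.mul_sum]
    have h2 := he.sum_inner_products_le (ψ x) (s := Finset.univ)
    rw [norm_feature_sq hψ] at h2
    linarith
  have hint : Integrable Y ρ :=
    Integrable.of_bound hYc.aestronglyMeasurable (1 / 2) (Filter.Eventually.of_forall hY)
  have hmean : ∫ x, Y x ∂ρ = M := by
    ext i
    have h1 := (PiLp.proj (𝕜 := ℝ) 2 (fun _ : Fin ℓ => H) i).integral_comp_comm hint
    change _ = (PiLp.proj (𝕜 := ℝ) 2 (fun _ : Fin ℓ => H) i) M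
    change (PiLp.proj (𝕜 := ℝ) 2 (fun _ : Fin ℓ => H) i) (∫ x, Y x ∂ρ) = _
    rw [← h1]
    exact hμ i
  have hM : ‖M‖ ≤ 1 / 2 := by
    rw [← hmean]
    have := norm_integral_le_of_norm_le_const (μ := ρ) (Filter.Eventually.of_forall hY)
    simpa using this
  have := measure_pi_norm_sum_ge_le ρ
    (continuous_operatorDeviation hc e μ).stronglyMeasurable one_pos (fun x => by
      rw [hX]
      have := norm_sub_le (Y x) M
      have := hY x
      linarith)
    (by
      simp only [hX]
      rw [integral_sub hint (integrable_const _), hmean]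
      simp) hn hs
  simpa using this

/-- The deviation vector controls the deviation of the empirical operator on the span of the
`e_i`. -/
theorem norm_empirical_sub_le {ℓ n : ℕ} {e : Fin ℓ → H} {μ : Fin ℓ → ℝ} (hn : 0 < n)
    {x : Fin n → S d} {σ : ℝ} (hx : ‖∑ k, operatorDeviation ψ e μ (x k)‖ ≤ n * σ)
    (β : Fin ℓ → ℝ) :
    ‖samplingAdj (fun k => ψ (x k)) (sampling (fun k => ψ (x k)) (∑ i, β i • e i)) -
      ∑ i, (β i * μ i) • e i‖ ≤ σ * √(∑ i, β i ^ 2) := by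
  set Z := ∑ k, operatorDeviation ψ e μ (x k) with hZ
  have hn' : (0 : ℝ) < n := Nat.cast_pos.2 hn
  have hZi : ∀ i, Z i = ∑ k, (⟪ψ (x k), e i⟫ • ψ (x k) - μ i • e i) := by
    intro i
    rw [hZ, WithLp.ofLp_sum, Finset.sum_apply]
    rfl
  have h1 : samplingAdj (fun k => ψ (x k)) (sampling (fun k => ψ (x k)) (∑ i, β i • e i)) -
      ∑ i, (β i * μ i) • e i = (1 / (n : ℝ)) • ∑ i, β i • Z i := by
    have h2 : samplingAdj (fun k => ψ (x k)) (sampling (fun k => ψ (x k)) (∑ i, β i • e i)) =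
        (1 / (n : ℝ)) • ∑ i, β i • ∑ k, ⟪ψ (x k), e i⟫ • ψ (x k) := by
      rw [samplingAdj_apply]
      simp only [sampling_apply, mul_smul, ← Finset.smul_sum]
      rw [smul_smul, one_div_mul_one_div, Real.mul_self_sqrt hn'.le]
      congr 1
      simp only [inner_sum, inner_smul_right, Finset.sum_smul, Finset.smul_sum, mul_smul]
      exact Finset.sum_comm
    have h3 : ∑ i, (β i * μ i) • e i = (1 / (n : ℝ)) • ∑ i, β i • ∑ _k : Fin n, μ i • e i := by
      rw [Finset.smul_sum]
      refine Finset.sum_congr rfl fun i _ => ?_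
      rw [Finset.sum_const, Finset.card_univ, Fintype.card_fin, ← Nat.cast_smul_eq_nsmul ℝ,
        smul_smul, smul_smul, smul_smul]
      congr 1
      field_simp
    rw [h2, h3, ← smul_sub, ← Finset.sum_sub_distrib]
    congr 1
    refine Finset.sum_congr rfl fun i _ => ?_
    rw [hZi, Finset.sum_sub_distrib, smul_sub]
  have h4 : ‖∑ i, β i • Z i‖ ≤ √(∑ i, β i ^ 2) * ‖Z‖ := by
    calc ‖∑ i, β i • Z i‖ ≤ ∑ i, |β i| * ‖Z i‖ :=
          (norm_sum_le _ _).trans_eq (Finset.sum_congr rfl fun i _ => by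
            rw [norm_smul, Real.norm_eq_abs])
      _ ≤ √(∑ i, |β i| ^ 2) * √(∑ i, ‖Z i‖ ^ 2) := Real.sum_mul_le_sqrt_mul_sqrt _ _ _
      _ = _ := by
          rw [PiLp.norm_eq_of_L2]
          simp only [sq_abs]
  rw [h1, norm_smul, Real.norm_of_nonneg (by positivity)]
  calc 1 / (n : ℝ) * ‖∑ i, β i • Z i‖ ≤ 1 / (n : ℝ) * (√(∑ i, β i ^ 2) * (n * σ)) := by
        gcongr
        exact h4.trans (by gcongr)
    _ = _ := by field_simp

end EmpiricalOperator

/-! ### One step of gradient descent on the network -/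

/-- The derivative of the ReLU, with the value `0` at `0`. -/
def act (u : ℝ) : ℝ := if 0 < u then 1 else 0

/-- The indicator of `|u| ≤ τ`: only inputs with this property can change their sign under a
perturbation of size `τ`. -/
def near (τ u : ℝ) : ℝ := if |u| ≤ τ then 1 else 0

theorem act_nonneg (u : ℝ) : 0 ≤ act u := by
  unfold act
  split_ifs <;> norm_num

theorem act_le_one (u : ℝ) : act u ≤ 1 := by
  unfold act
  split_ifs <;> norm_num

theorem near_nonneg (τ u : ℝ) : 0 ≤ near τ u := by
  unfold near
  split_ifs <;> norm_num

theorem near_le_one (τ u : ℝ) : near τ u ≤ 1 := by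
  unfold near
  split_ifs <;> norm_num

theorem act_eq_of_lt {τ u₀ u : ℝ} (h : |u - u₀| ≤ τ) (h0 : τ < |u₀|) : act u = act u₀ := by
  rw [abs_le] at h
  unfold act
  rcases lt_abs.1 h0 with h1 | h1
  · rw [if_pos (by linarith), if_pos (by linarith)]
  · rw [if_neg (by linarith), if_neg (by linarith)]

/-- Between two points near `u₀` the difference quotient of the ReLU is its derivative at `u₀`,
unless `u₀` is close to the kink. -/
theorem exists_relu_sub_eq {τ u₀ u v : ℝ} (hu : |u - u₀| ≤ τ) (hv : |v - u₀| ≤ τ) :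
    ∃ D : ℝ, 0 ≤ D ∧ D ≤ 1 ∧ relu v - relu u = D * (v - u) ∧ (τ < |u₀| → D = act u₀) := by
  by_cases h0 : τ < |u₀|
  · refine ⟨act u₀, act_nonneg _, act_le_one _, ?_, fun _ => rfl⟩
    rw [abs_le] at hu hv
    unfold act relu
    rcases lt_abs.1 h0 with h1 | h1
    · rw [if_pos (by linarith), max_eq_left (by linarith), max_eq_left (by linarith), one_mul]
    · rw [if_neg (by linarith), max_eq_right (by linarith), max_eq_right (by linarith)]
      ring
  · rcases eq_or_ne v u with rfl | hne
    · exact ⟨0, le_rfl, zero_le_one, by simp, fun h => absurd h h0⟩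
    · have hne' : v - u ≠ 0 := sub_ne_zero.2 hne
      refine ⟨(relu v - relu u) / (v - u), ?_, ?_, (div_mul_cancel₀ _ hne').symm,
        fun h => absurd h h0⟩ <;> unfold relu
      · rcases lt_or_gt_of_ne hne with h | h
        · exact div_nonneg_of_nonpos (by linarith [max_le_max_right 0 h.le]) (by linarith)
        · exact div_nonneg (by linarith [max_le_max_right 0 h.le]) (by linarith)
      · rcases lt_or_gt_of_ne hne with h | h
        · rw [div_le_one_of_neg (by linarith)]
          rcases max_cases v 0 with ⟨h1, h2⟩ | ⟨h1, h2⟩ <;>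
            rcases max_cases u 0 with ⟨h3, h4⟩ | ⟨h3, h4⟩ <;> rw [h1, h3] <;> linarith
        · rw [div_le_one (by linarith)]
          rcases max_cases v 0 with ⟨h1, h2⟩ | ⟨h1, h2⟩ <;>
            rcases max_cases u 0 with ⟨h3, h4⟩ | ⟨h3, h4⟩ <;> rw [h1, h3] <;> linarith

/-- The products of activations that drive gradient descent agree with those at the initial weights,
except for inputs close to the kink. -/
theorem abs_act_mul_act_sub_le {τ u₀ v₀ v D : ℝ} (hv : |v - v₀| ≤ τ) (hD0 : 0 ≤ D) (hD1 : D ≤ 1)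
    (hD : τ < |u₀| → D = act u₀) :
    |act u₀ * act v₀ - D * act v| ≤ near τ u₀ + near τ v₀ := by
  by_cases hu : τ < |u₀|
  · by_cases hv0 : τ < |v₀|
    · rw [hD hu, act_eq_of_lt hv hv0, sub_self, abs_zero]
      exact add_nonneg (near_nonneg _ _) (near_nonneg _ _)
    · have h1 : near τ v₀ = 1 := if_pos (not_lt.1 hv0)
      have h2 := near_nonneg τ u₀
      have h3 : |act u₀ * act v₀ - D * act v| ≤ 1 := abs_sub_le_of_nonneg_of_le
        (mul_nonneg (act_nonneg _) (act_nonneg _))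
        (mul_le_one₀ (act_le_one _) (act_nonneg _) (act_le_one _))
        (mul_nonneg hD0 (act_nonneg _)) (mul_le_one₀ hD1 (act_nonneg _) (act_le_one _))
      linarith
  · have h1 : near τ u₀ = 1 := if_pos (not_lt.1 hu)
    have h2 := near_nonneg τ v₀
    have h3 : |act u₀ * act v₀ - D * act v| ≤ 1 := abs_sub_le_of_nonneg_of_le
      (mul_nonneg (act_nonneg _) (act_nonneg _))
      (mul_le_one₀ (act_le_one _) (act_nonneg _) (act_le_one _))
      (mul_nonneg hD0 (act_nonneg _)) (mul_le_one₀ hD1 (act_nonneg _) (act_le_one _))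
    linarith

/-- The operator norm of a matrix is at most its Frobenius norm. -/
theorem norm_toLp_matVec_le {n : ℕ} (M : Fin n → Fin n → ℝ) (v : EuclideanSpace ℝ (Fin n)) :
    ‖(WithLp.toLp 2 fun i => ∑ k, M i k * v k : EuclideanSpace ℝ (Fin n))‖ ≤
      √(∑ i, ∑ k, M i k ^ 2) * ‖v‖ := by
  rw [← sq_le_sq₀ (norm_nonneg _) (by positivity), mul_pow, Real.sq_sqrt (by positivity),
    EuclideanSpace.norm_sq_eq, EuclideanSpace.norm_sq_eq v, Finset.sum_mul]
  refine Finset.sum_le_sum fun i _ => ?_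
  simp only [Real.norm_eq_abs, sq_abs]
  exact Finset.sum_mul_sq_le_sq_mul_sq _ _ _

section Network

variable {d m n : ℕ}

/-- The normalized vector `n^{-1/2} (f(x_i) - f_{W,a}(x_i))_i` of residuals. -/
def residual (f : S d → ℝ) (x : Fin n → S d) (a : Fin m → ℝ) (W : Fin m → E d) :
    EuclideanSpace ℝ (Fin n) :=
  (1 / √n) • WithLp.toLp 2 fun i => f (x i) - network a W (x i)

/-- The deviation of the normalized Gram matrix of the gradient features `1{⟨w, x_i⟩ > 0} x_i` of
one neuron from its expectation under a Gaussian weight `w`, which is the kernel matrix. The matrix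
is a vector indexed by pairs, so that its norm is the Frobenius norm. -/
def gramDeviation (x : Fin n → S d) (w : E d) : EuclideanSpace ℝ (Fin n × Fin n) :=
  WithLp.toLp 2 fun p => (1 / (n : ℝ)) * (⟪(x p.1 : E d), (x p.2 : E d)⟫ *
    (act ⟪w, (x p.1 : E d)⟫ * act ⟪w, (x p.2 : E d)⟫) - kernel (x p.1) (x p.2))

/-- The normalized indicator of the data points whose activation may change when the weight `w`
moves by at most `τ`. -/
def nearVec (τ : ℝ) (x : Fin n → S d) (w : E d) : EuclideanSpace ℝ (Fin n) :=
  WithLp.toLp 2 fun i => (1 / √n) * near τ ⟪w, (x i : E d)⟫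

theorem trainError_eq (η : ℝ) (f : S d → ℝ) (x : Fin n → S d) (a : Fin m → ℝ) (W : Fin m → E d)
    (t : ℕ) :
    trainError η f x a W t = ‖residual f x a (gdIter η a x (fun k => f (x k)) W t)‖ := rfl

theorem residual_apply (f : S d → ℝ) (x : Fin n → S d) (a : Fin m → ℝ) (W : Fin m → E d)
    (i : Fin n) : residual f x a W i = (1 / √n) * (f (x i) - network a W (x i)) := rfl

theorem gdStep_sub_eq (hn : 0 < n) (f : S d → ℝ) (x : Fin n → S d) (a : Fin m → ℝ)
    (W : Fin m → E d) (j : Fin m) :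
    gdStep 1 a x (fun k => f (x k)) W j - W j = (a j / (√n * √m)) •
      ∑ i, (residual f x a W i * act ⟪W j, (x i : E d)⟫) • (x i : E d) := by
  have hn' : (0 : ℝ) < √n := Real.sqrt_pos.2 (Nat.cast_pos.2 hn)
  have hnn : (n : ℝ) = √n * √n := (Real.mul_self_sqrt (Nat.cast_nonneg n)).symm
  rw [gdStep, add_sub_cancel_left, Finset.smul_sum, Finset.smul_sum]
  refine Finset.sum_congr rfl fun i _ => ?_
  rw [smul_smul, smul_smul, residual_apply]
  congr 1
  change 1 * a j / (n * √m) * ((f (x i) - network a W (x i)) * act ⟪W j, (x i : E d)⟫) = _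
  nth_rw 1 [hnn]
  by_cases hm : √(m : ℝ) = 0
  · simp [hm]
  · field_simp

theorem norm_gdStep_sub_le (hn : 0 < n) (f : S d → ℝ) (x : Fin n → S d) {a : Fin m → ℝ}
    (ha : ∀ j, a j ^ 2 = 1) (W : Fin m → E d) (j : Fin m) :
    ‖gdStep 1 a x (fun k => f (x k)) W j - W j‖ ≤ ‖residual f x a W‖ / √m := by
  have hn' : (0 : ℝ) < √n := Real.sqrt_pos.2 (Nat.cast_pos.2 hn)
  have haj : |a j| = 1 := by
    have := ha j
    rw [← sq_abs] at this
    nlinarith [abs_nonneg (a j)]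
  have h1 : ‖∑ i, (residual f x a W i * act ⟪W j, (x i : E d)⟫) • (x i : E d)‖ ≤
      √n * ‖residual f x a W‖ := by
    calc _ ≤ ∑ i, 1 * |residual f x a W i| := by
          refine norm_sum_le_of_le _ fun i _ => ?_
          rw [norm_smul, norm_coe_S, mul_one, norm_mul, Real.norm_eq_abs, mul_comm,
            Real.norm_of_nonneg (act_nonneg _)]
          exact mul_le_mul_of_nonneg_right (act_le_one _) (abs_nonneg _)
      _ ≤ √(∑ _i : Fin n, (1 : ℝ) ^ 2) * √(∑ i, |residual f x a W i| ^ 2) :=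
          Real.sum_mul_le_sqrt_mul_sqrt _ _ _
      _ = _ := by
          rw [EuclideanSpace.norm_eq]
          simp
  rw [gdStep_sub_eq hn, norm_smul, norm_div, Real.norm_eq_abs, haj, Real.norm_of_nonneg
    (by positivity)]
  calc 1 / (√n * √m) * _ ≤ 1 / (√n * √m) * (√n * ‖residual f x a W‖) := by gcongr
    _ = _ := by
        by_cases hm : √(m : ℝ) = 0
        · simp [hm]
        · field_simp

/-- A weight moves at most `‖r_s‖ / √m` in step `s`, so that the distance from initialization is
controlled by the sum of the training errors. -/
theorem norm_gdIter_sub_le (hn : 0 < n) (f : S d → ℝ) (x : Fin n → S d) {a : Fin m → ℝ}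
    (ha : ∀ j, a j ^ 2 = 1) (W : Fin m → E d) (t : ℕ) (j : Fin m) :
    ‖gdIter 1 a x (fun k => f (x k)) W t j - W j‖ ≤
      (∑ s ∈ Finset.range t, trainError 1 f x a W s) / √m := by
  induction t with
  | zero => simp [gdIter]
  | succ t ih =>
    rw [Finset.sum_range_succ, add_div]
    refine (norm_sub_le_norm_sub_add_norm_sub _
      (gdIter 1 a x (fun k => f (x k)) W t j) _).trans ?_
    rw [add_comm]
    exact add_le_add ih (norm_gdStep_sub_le hn f x ha _ j)

/-- As long as the weights stay within `τ` of their initial values, a gradient descent step agrees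
with the linearized step up to the deviation of the initial Gram matrix and the fraction of neurons
that are within `τ` of switching. -/
theorem norm_residual_gdStep_sub_le (hn : 0 < n) (hm : 0 < m) {H : Type*} [NormedAddCommGroup H]
    [InnerProductSpace ℝ H] {ψ : S d → H} (hψ : ∀ x s, ⟪ψ x, ψ s⟫ = kernel x s)
    (f : S d → ℝ) (x : Fin n → S d) {a : Fin m → ℝ} (ha : ∀ j, a j ^ 2 = 1) {W₀ W : Fin m → E d}
    {τ : ℝ} (hW : ∀ j, ‖W j - W₀ j‖ ≤ τ)
    (hW' : ∀ j, ‖gdStep 1 a x (fun k => f (x k)) W j - W₀ j‖ ≤ τ) :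
    ‖residual f x a (gdStep 1 a x (fun k => f (x k)) W) -
        linearStep (fun i => ψ (x i)) (residual f x a W)‖ ≤
      (1 / (m : ℝ) * ‖∑ j, gramDeviation x (W₀ j)‖ +
        2 * (1 / (m : ℝ) * ‖∑ j, nearVec τ x (W₀ j)‖)) * ‖residual f x a W‖ := by
  have hn' : (0 : ℝ) < n := Nat.cast_pos.2 hn
  have hm' : (0 : ℝ) < m := Nat.cast_pos.2 hm
  have hsn : (0 : ℝ) < √n := Real.sqrt_pos.2 hn'
  have hsm : (0 : ℝ) < √m := Real.sqrt_pos.2 hm'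
  have hnn : 1 / √(n : ℝ) * (1 / √n) = 1 / n := by
    rw [one_div_mul_one_div, Real.mul_self_sqrt hn'.le]
  have hco : 1 / √(m : ℝ) * (1 / (√n * √m)) = √n * (1 / (m * n)) := by
    field_simp
    rw [Real.sq_sqrt hm'.le, Real.sq_sqrt hn'.le]
  set W' := gdStep 1 a x (fun k => f (x k)) W with hWdef
  set r := residual f x a W with hr
  have hinner : ∀ {u v : E d} (i : Fin n), ‖u - v‖ ≤ τ →
      |⟪u, (x i : E d)⟫ - ⟪v, (x i : E d)⟫| ≤ τ := by
    intro u v i h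
    rw [← inner_sub_left]
    exact (abs_real_inner_le_norm _ _).trans (by rwa [norm_coe_S, mul_one])
  -- the mean slope of each ReLU between the two iterates, exact for neurons away from the kink
  choose D hD0 hD1 hDrelu hDact using fun (i : Fin n) (j : Fin m) =>
    exists_relu_sub_eq (hinner i (hW j)) (hinner i (hW' j))
  let G : Fin n → Fin n → ℝ := fun i k => ⟪(x i : E d), (x k : E d)⟫
  -- `A` is the deviation of the initial Gram matrix, `B` the change of the activation patterns
  let A : Fin n → Fin n → ℝ := fun i k => 1 / (m : ℝ) * ∑ j, gramDeviation x (W₀ j) (i, k)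
  let B : Fin n → Fin n → ℝ := fun i k => 1 / ((m : ℝ) * n) * ∑ j, G i k *
    (act ⟪W₀ j, (x i : E d)⟫ * act ⟪W₀ j, (x k : E d)⟫ - D i j * act ⟪W j, (x k : E d)⟫)
  have hnet : ∀ i, network a W' (x i) - network a W (x i) =
      √n * ∑ k, (1 / ((m : ℝ) * n) * ∑ j, G i k * (D i j * act ⟪W j, (x k : E d)⟫)) * r k := by
    intro i
    have h1 : ∀ j, a j * relu ⟪(x i : E d), W' j⟫ - a j * relu ⟪(x i : E d), W j⟫ =
        1 / (√n * √m) * ∑ k, G i k * (D i j * act ⟪W j, (x k : E d)⟫) * r k := by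
      intro j
      rw [← mul_sub, real_inner_comm, real_inner_comm (W j), hDrelu i j, ← inner_sub_left, hWdef,
        gdStep_sub_eq hn, inner_smul_left, sum_inner, ← hr]
      simp only [conj_trivial, inner_smul_left, Finset.mul_sum]
      refine Finset.sum_congr rfl fun k _ => ?_
      rw [real_inner_comm (x i : E d) (x k : E d)]
      change a j * (D i j * (a j / (√n * √m) * (r k * act ⟪W j, (x k : E d)⟫ * G i k))) = _
      linear_combination (D i j * (1 / (√n * √m) * (r k * act ⟪W j, (x k : E d)⟫ * G i k))) * ha j
    rw [network, network, ← mul_sub, ← Finset.sum_sub_distrib, Finset.sum_congr rfl fun j _ => h1 j,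
      ← Finset.mul_sum, Finset.sum_comm, Finset.mul_sum, Finset.mul_sum, Finset.mul_sum]
    refine Finset.sum_congr rfl fun k _ => ?_
    rw [← Finset.sum_mul]
    linear_combination
      ((∑ j, G i k * (D i j * act ⟪W j, (x k : E d)⟫)) * r k) * hco
  have hlin : ∀ i, sampling (fun i => ψ (x i)) (samplingAdj (fun i => ψ (x i)) r) i =
      ∑ k, 1 / (n : ℝ) * kernel (x i) (x k) * r k := by
    intro i
    rw [sampling_apply, samplingAdj_apply, inner_smul_right, inner_sum, Finset.mul_sum,
      Finset.mul_sum]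
    refine Finset.sum_congr rfl fun k _ => ?_
    rw [inner_smul_right, hψ]
    linear_combination (r k * kernel (x i) (x k)) * hnn
  have hdiff : residual f x a W' - linearStep (fun i => ψ (x i)) r =
      (WithLp.toLp 2 fun i => ∑ k, B i k * r k) - WithLp.toLp 2 fun i => ∑ k, A i k * r k := by
    ext i
    have h2 : residual f x a W' i = r i - (1 / √n) * (network a W' (x i) - network a W (x i)) := by
      rw [hr, residual_apply, residual_apply]
      ring
    change residual f x a W' i -
      (r i - sampling (fun i => ψ (x i)) (samplingAdj (fun i => ψ (x i)) r) i) =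
      (∑ k, B i k * r k) - ∑ k, A i k * r k
    rw [h2, hnet, hlin, ← mul_assoc, one_div_mul_cancel hsn.ne', one_mul, ← Finset.sum_sub_distrib]
    have h3 : ∀ k, B i k * r k - A i k * r k = 1 / (n : ℝ) * kernel (x i) (x k) * r k -
        1 / ((m : ℝ) * n) * (∑ j, G i k * (D i j * act ⟪W j, (x k : E d)⟫)) * r k := by
      intro k
      have h4 : A i k = 1 / ((m : ℝ) * n) * ∑ j, G i k *
          (act ⟪W₀ j, (x i : E d)⟫ * act ⟪W₀ j, (x k : E d)⟫) -
          1 / (n : ℝ) * kernel (x i) (x k) := by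
        simp only [A, gramDeviation, mul_sub, Finset.sum_sub_distrib, Finset.sum_const,
          Finset.card_univ, Fintype.card_fin, nsmul_eq_mul, ← Finset.mul_sum]
        simp only [G]
        field_simp
      have h5 : B i k = 1 / ((m : ℝ) * n) * ∑ j, G i k *
          (act ⟪W₀ j, (x i : E d)⟫ * act ⟪W₀ j, (x k : E d)⟫) -
          1 / ((m : ℝ) * n) * ∑ j, G i k * (D i j * act ⟪W j, (x k : E d)⟫) := by
        simp only [B, mul_sub, Finset.sum_sub_distrib]
      rw [h4, h5]
      ring
    rw [Finset.sum_congr rfl fun k _ => h3 k, Finset.sum_sub_distrib]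
    ring
  have hA : √(∑ i, ∑ k, A i k ^ 2) = 1 / (m : ℝ) * ‖∑ j, gramDeviation x (W₀ j)‖ := by
    rw [EuclideanSpace.norm_eq, Fintype.sum_prod_type]
    simp only [A, mul_pow, ← Finset.mul_sum, Real.norm_eq_abs, sq_abs, WithLp.ofLp_sum,
      Finset.sum_apply]
    rw [Real.sqrt_mul (by positivity), Real.sqrt_sq (by positivity)]
  set p : EuclideanSpace ℝ (Fin n) := (1 / (m : ℝ)) • ∑ j, nearVec τ x (W₀ j) with hp
  have hpn : ‖p‖ = 1 / (m : ℝ) * ‖∑ j, nearVec τ x (W₀ j)‖ := by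
    rw [hp, norm_smul, Real.norm_of_nonneg (by positivity)]
  have hpi : ∀ i, p i = 1 / (m : ℝ) * ∑ j, (1 / √n) * near τ ⟪W₀ j, (x i : E d)⟫ := by
    intro i
    rw [hp, PiLp.smul_apply, WithLp.ofLp_sum, Finset.sum_apply]
    rfl
  have hBik : ∀ i k, |B i k| ≤ (1 / √n) * (p i + p k) := by
    intro i k
    have h1 : |∑ j, G i k *
        (act ⟪W₀ j, (x i : E d)⟫ * act ⟪W₀ j, (x k : E d)⟫ - D i j * act ⟪W j, (x k : E d)⟫)| ≤
        ∑ j, (near τ ⟪W₀ j, (x i : E d)⟫ + near τ ⟪W₀ j, (x k : E d)⟫) := by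
      refine (Finset.abs_sum_le_sum_abs _ _).trans (Finset.sum_le_sum fun j _ => ?_)
      rw [abs_mul]
      have h2 : |G i k| ≤ 1 := by
        have := abs_real_inner_le_norm (x i : E d) (x k : E d)
        simpa [G] using this
      have h3 := abs_act_mul_act_sub_le (hinner k (hW j)) (hD0 i j) (hD1 i j) (hDact i j)
      exact (mul_le_of_le_one_left (abs_nonneg _) h2).trans h3
    simp only [B, abs_mul]
    rw [abs_of_nonneg (by positivity)]
    refine (mul_le_mul_of_nonneg_left h1 (by positivity)).trans_eq ?_
    rw [hpi, hpi, Finset.sum_add_distrib, ← Finset.mul_sum, ← Finset.mul_sum]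
    linear_combination (-(1 / (m : ℝ)) * (∑ j, near τ ⟪W₀ j, (x i : E d)⟫ +
      ∑ j, near τ ⟪W₀ j, (x k : E d)⟫)) * hnn
  have hB : √(∑ i, ∑ k, B i k ^ 2) ≤ 2 * ‖p‖ := by
    refine Real.sqrt_le_iff.2 ⟨by positivity, ?_⟩
    have h1 : ∀ i k, B i k ^ 2 ≤ 1 / (n : ℝ) * (2 * p i ^ 2 + 2 * p k ^ 2) := by
      intro i k
      rw [← sq_abs]
      calc |B i k| ^ 2 ≤ ((1 / √n) * (p i + p k)) ^ 2 := by gcongr; exact hBik i k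
        _ = 1 / (n : ℝ) * (p i + p k) ^ 2 := by
            rw [mul_pow, div_pow, Real.sq_sqrt hn'.le, one_pow]
        _ ≤ _ := by
            gcongr
            nlinarith [sq_nonneg (p i - p k)]
    refine (Finset.sum_le_sum fun i _ => Finset.sum_le_sum fun k _ => h1 i k).trans_eq ?_
    have h2 : ‖p‖ ^ 2 = ∑ i, p i ^ 2 := by
      rw [EuclideanSpace.norm_sq_eq]
      simp
    rw [mul_pow, h2]
    simp only [← Finset.mul_sum, Finset.sum_add_distrib, Finset.sum_const, Finset.card_univ,
      Fintype.card_fin, nsmul_eq_mul]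
    field_simp
    ring
  rw [hdiff, ← hA, ← hpn, add_mul, add_comm]
  refine (norm_sub_le _ _).trans (add_le_add ?_ (norm_toLp_matVec_le A r))
  exact (norm_toLp_matVec_le B r).trans (mul_le_mul_of_nonneg_right hB (norm_nonneg _))

end Network

/-! ### The random initialization -/

instance isProbabilityMeasure_gaussianInit (d : ℕ) (ν : ℝ) :
    IsProbabilityMeasure (gaussianInit d ν) :=
  Measure.isProbabilityMeasure_map (by fun_prop)

theorem measurable_act : Measurable act :=
  Measurable.ite measurableSet_Ioi measurable_const measurable_const

theorem measurable_near (τ : ℝ) : Measurable (near τ) :=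
  Measurable.ite (measurableSet_le measurable_abs measurable_const) measurable_const
    measurable_const

theorem measurable_relu : Measurable relu := measurable_id.max measurable_const

section

variable {d n : ℕ} {ν : ℝ}

theorem integral_act_mul_act (hν : 0 < ν) (x s : S d) :
    ∫ w, ⟪(x : E d), (s : E d)⟫ * (act ⟪w, (x : E d)⟫ * act ⟪w, (s : E d)⟫) ∂(gaussianInit d ν) =
      kernel x s := by
  have hmeas : Measurable fun w : E d => act ⟪w, (x : E d)⟫ * act ⟪w, (s : E d)⟫ :=
    (measurable_act.comp (by fun_prop)).mul (measurable_act.comp (by fun_prop))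
  rw [integral_const_mul, gaussianInit, integral_map (by fun_prop) hmeas.aestronglyMeasurable,
    kernel_eq_stdGaussian, Set.ofPred_and, ← integral_indicator_one
      ((measurableSet_inner_pos (x : E d)).inter (measurableSet_inner_pos (s : E d)))]
  congr 2
  ext w
  simp only [inner_smul_left, conj_trivial, act, mul_pos_iff_of_pos_left hν, Set.indicator,
    Pi.one_apply, Set.mem_inter_iff, Set.mem_ofPred_eq]
  by_cases h1 : 0 < ⟪w, (x : E d)⟫ <;> by_cases h2 : 0 < ⟪w, (s : E d)⟫ <;> simp [h1, h2]

theorem integral_near_le (hν : 0 < ν) {τ : ℝ} (hτ : 0 ≤ τ) (x : S d) :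
    ∫ w, near τ ⟪w, (x : E d)⟫ ∂(gaussianInit d ν) ≤ τ / ν := by
  have hmeas : Measurable fun w : E d => near τ ⟪w, (x : E d)⟫ :=
    (measurable_near τ).comp (by fun_prop)
  have hset : MeasurableSet {w : E d | |⟪w, (x : E d)⟫| ≤ τ / ν} :=
    measurableSet_le (by fun_prop) measurable_const
  rw [gaussianInit, integral_map (by fun_prop) hmeas.aestronglyMeasurable]
  refine le_trans (le_of_eq ?_) (stdGaussian_abs_inner_le (norm_coe_S x) (div_nonneg hτ hν.le))
  rw [← integral_indicator_one hset]
  congr 1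
  ext w
  simp only [inner_smul_left, conj_trivial, near, Set.indicator, Pi.one_apply, Set.mem_ofPred_eq,
    abs_mul, abs_of_pos hν]
  congr 1
  rw [le_div_iff₀ hν, mul_comm]

theorem lintegral_exp_inner_sq_le {s : ℝ} (hs0 : 0 ≤ s) (hs : s * ν ^ 2 ≤ 1 / 4) (x : S d) :
    ∫⁻ w, ENNReal.ofReal (Real.exp (s * ⟪w, (x : E d)⟫ ^ 2)) ∂(gaussianInit d ν) ≤
      ENNReal.ofReal (Real.exp (2 * (s * ν ^ 2))) := by
  rw [gaussianInit, lintegral_map (by fun_prop) (by fun_prop)]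
  have h1 := lintegral_exp_sq_gaussianReal_le (s := s * ν ^ 2) (by positivity) hs
  rw [← map_inner_stdGaussian (norm_coe_S x), lintegral_map (by fun_prop) (by fun_prop)] at h1
  refine le_trans (le_of_eq ?_) h1
  congr 1
  ext w
  rw [inner_smul_left, conj_trivial]
  congr 2
  ring

theorem measurable_gramDeviation :
    Measurable fun p : (Fin n → S d) × E d => gramDeviation p.1 p.2 := by
  refine (WithLp.measurable_toLp 2 _).comp (measurable_pi_lambda _ fun i => ?_)
  have hx : ∀ k, Measurable fun p : (Fin n → S d) × E d => ((p.1 k : S d) : E d) := fun k =>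
    measurable_subtype_coe.comp ((measurable_pi_apply k).comp measurable_fst)
  have h1 : ∀ k, Measurable fun p : (Fin n → S d) × E d => act ⟪p.2, (p.1 k : E d)⟫ := fun k =>
    measurable_act.comp (measurable_snd.inner (hx k))
  have h2 : Measurable fun p : (Fin n → S d) × E d => ⟪(p.1 i.1 : E d), (p.1 i.2 : E d)⟫ :=
    (hx i.1).inner (hx i.2)
  have hk : Measurable fun p : (Fin n → S d) × E d => kernel (p.1 i.1) (p.1 i.2) :=
    (h2.div_const (2 * Real.pi)).mul ((Real.measurable_arccos.comp h2).const_sub Real.pi)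
  have h3 : Measurable fun p : (Fin n → S d) × E d => ⟪(p.1 i.1 : E d), (p.1 i.2 : E d)⟫ *
      (act ⟪p.2, (p.1 i.1 : E d)⟫ * act ⟪p.2, (p.1 i.2 : E d)⟫) :=
    h2.mul ((h1 i.1).mul (h1 i.2))
  exact (h3.sub hk).const_mul (1 / (n : ℝ))

theorem measurable_nearVec (τ : ℝ) :
    Measurable fun p : (Fin n → S d) × E d => nearVec τ p.1 p.2 := by
  refine (WithLp.measurable_toLp 2 _).comp (measurable_pi_lambda _ fun i => ?_)
  have hx : Measurable fun p : (Fin n → S d) × E d => ((p.1 i : S d) : E d) :=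
    measurable_subtype_coe.comp ((measurable_pi_apply i).comp measurable_fst)
  exact ((measurable_near τ).comp (measurable_snd.inner hx)).const_mul _

theorem norm_gramDeviation_le (x : Fin n → S d) (w : E d) : ‖gramDeviation x w‖ ≤ 1 := by
  rw [← sq_le_sq₀ (norm_nonneg _) zero_le_one, EuclideanSpace.norm_sq_eq]
  have h1 : ∀ p : Fin n × Fin n, ‖gramDeviation x w p‖ ^ 2 ≤ 1 / (n : ℝ) * (1 / (n : ℝ)) := by
    intro p
    -- the factor `⟨x_i, x_k⟩` is common to the sample and to its mean
    set P := (stdGaussian (E d)).real {w | 0 < ⟪w, (x p.1 : E d)⟫ ∧ 0 < ⟪w, (x p.2 : E d)⟫}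
    have h2 : |act ⟪w, (x p.1 : E d)⟫ * act ⟪w, (x p.2 : E d)⟫ - P| ≤ 1 :=
      abs_sub_le_of_nonneg_of_le
        (mul_nonneg (act_nonneg _) (act_nonneg _))
        (mul_le_one₀ (act_le_one _) (act_nonneg _) (act_le_one _)) measureReal_nonneg
        measureReal_le_one
    have h3 : |⟪(x p.1 : E d), (x p.2 : E d)⟫| ≤ 1 := by
      have := abs_real_inner_le_norm (x p.1 : E d) (x p.2 : E d)
      simpa using this
    have h4 : gramDeviation x w p = 1 / (n : ℝ) * (⟪(x p.1 : E d), (x p.2 : E d)⟫ *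
        (act ⟪w, (x p.1 : E d)⟫ * act ⟪w, (x p.2 : E d)⟫ - P)) := by
      rw [mul_sub _ _ P, ← kernel_eq_stdGaussian]
      rfl
    rw [h4, norm_mul, norm_mul, Real.norm_eq_abs, Real.norm_eq_abs, Real.norm_eq_abs,
      abs_of_nonneg (by positivity : 0 ≤ 1 / (n : ℝ)), ← sq]
    gcongr
    exact mul_le_of_le_one_right (by positivity) (mul_le_one₀ h3 (abs_nonneg _) h2)
  refine (Finset.sum_le_sum fun p _ => h1 p).trans ?_
  rw [Finset.sum_const, Finset.card_univ, Fintype.card_prod, Fintype.card_fin, nsmul_eq_mul,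
    Nat.cast_mul, mul_mul_mul_comm, mul_one_div, one_pow]
  exact mul_le_one₀ (div_self_le_one _) (by positivity) (div_self_le_one _)

theorem integrable_bdd_act {g : E d → ℝ} (hg : Measurable g) {c : ℝ} (h : ∀ w, |g w| ≤ c) :
    Integrable g (gaussianInit d ν) :=
  Integrable.of_bound hg.aestronglyMeasurable c (Filter.Eventually.of_forall h)

theorem integral_gramDeviation (hν : 0 < ν) (x : Fin n → S d) :
    ∫ w, gramDeviation x w ∂(gaussianInit d ν) = 0 := by
  have hact : ∀ k, Measurable fun w : E d => act ⟪w, (x k : E d)⟫ := fun k =>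
    measurable_act.comp (by fun_prop)
  have hint : ∀ p : Fin n × Fin n, Integrable (fun w : E d =>
      ⟪(x p.1 : E d), (x p.2 : E d)⟫ * (act ⟪w, (x p.1 : E d)⟫ * act ⟪w, (x p.2 : E d)⟫))
      (gaussianInit d ν) := by
    intro p
    refine Integrable.const_mul (integrable_bdd_act ((hact p.1).mul (hact p.2)) (c := 1)
      fun w => ?_) _
    rw [Pi.mul_apply, abs_of_nonneg (mul_nonneg (act_nonneg _) (act_nonneg _))]
    exact mul_le_one₀ (act_le_one _) (act_nonneg _) (act_le_one _)
  have hint' : ∀ p, Integrable (fun w : E d => gramDeviation x w p) (gaussianInit d ν) :=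
    fun p => ((hint p).sub (integrable_const _)).const_mul _
  ext p
  rw [eval_integral_piLp hint']
  change ∫ w, 1 / (n : ℝ) * (_ - _) ∂_ = 0
  rw [integral_const_mul, integral_sub (hint p) (integrable_const _), integral_act_mul_act hν]
  simp

theorem measure_gramDeviation_ge_le (hν : 0 < ν) (x : Fin n → S d) {m : ℕ} (hm : 0 < m) {s : ℝ}
    (hs : 0 ≤ s) :
    (Measure.pi fun _ : Fin m => gaussianInit d ν) {W | m * s ≤ ‖∑ j, gramDeviation x (W j)‖} ≤
      ENNReal.ofReal (2 * Real.exp (-(m * s ^ 2 / 2))) := by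
  have hm' : (0 : ℝ) < m := Nat.cast_pos.2 hm
  have h := measure_pi_norm_sum_ge_le (gaussianInit d ν)
    (measurable_gramDeviation.comp measurable_prodMk_left).stronglyMeasurable one_pos
    (norm_gramDeviation_le x) (integral_gramDeviation hν x) hm (s := m * s) (by positivity)
  refine h.trans_eq ?_
  congr 3
  field_simp

theorem norm_le_of_forall_abs_le {v : EuclideanSpace ℝ (Fin n)} {c : ℝ} (hc : 0 ≤ c)
    (h : ∀ i, |v i| ≤ (1 / √n) * c) : ‖v‖ ≤ c := by
  rw [← sq_le_sq₀ (norm_nonneg _) hc, EuclideanSpace.norm_sq_eq]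
  calc ∑ i, ‖v i‖ ^ 2 ≤ ∑ _i : Fin n, ((1 / √n) * c) ^ 2 :=
        Finset.sum_le_sum fun i _ => pow_le_pow_left₀ (norm_nonneg _) (h i) 2
    _ = (n * (1 / (n : ℝ))) * c ^ 2 := by
        rw [Finset.sum_const, Finset.card_univ, Fintype.card_fin, nsmul_eq_mul, mul_pow, div_pow,
          Real.sq_sqrt (Nat.cast_nonneg n)]
        ring
    _ ≤ 1 * c ^ 2 := by
        gcongr
        rw [mul_one_div]
        exact div_self_le_one _
    _ = c ^ 2 := one_mul _

theorem nearVec_apply (τ : ℝ) (x : Fin n → S d) (w : E d) (i : Fin n) :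
    nearVec τ x w i = (1 / √n) * near τ ⟪w, (x i : E d)⟫ := rfl

theorem integrable_near (τ : ℝ) (x : S d) :
    Integrable (fun w : E d => near τ ⟪w, (x : E d)⟫) (gaussianInit d ν) :=
  integrable_bdd_act ((measurable_near τ).comp (by fun_prop)) (c := 1) fun w => by
    rw [abs_of_nonneg (near_nonneg _ _)]
    exact near_le_one _ _

theorem integrable_nearVec_apply (τ : ℝ) (x : Fin n → S d) (i : Fin n) :
    Integrable (fun w : E d => nearVec τ x w i) (gaussianInit d ν) :=
  (integrable_near τ (x i)).const_mul (1 / √n)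

theorem integral_nearVec_apply (τ : ℝ) (x : Fin n → S d) (i : Fin n) :
    (∫ w, nearVec τ x w ∂(gaussianInit d ν)) i =
      (1 / √n) * ∫ w, near τ ⟪w, (x i : E d)⟫ ∂(gaussianInit d ν) := by
  rw [eval_integral_piLp (integrable_nearVec_apply τ x), ← integral_const_mul]
  rfl

theorem norm_integral_nearVec_le (hν : 0 < ν) {τ : ℝ} (hτ : 0 ≤ τ) (x : Fin n → S d) :
    ‖∫ w, nearVec τ x w ∂(gaussianInit d ν)‖ ≤ τ / ν := by
  refine norm_le_of_forall_abs_le (by positivity) fun i => ?_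
  have h0 : 0 ≤ ∫ w, near τ ⟪w, (x i : E d)⟫ ∂(gaussianInit d ν) :=
    integral_nonneg fun w => near_nonneg _ _
  rw [integral_nearVec_apply, abs_of_nonneg (by positivity)]
  gcongr
  exact integral_near_le hν hτ (x i)

theorem norm_nearVec_sub_integral_le (τ : ℝ) (x : Fin n → S d) (w : E d) :
    ‖nearVec τ x w - ∫ w, nearVec τ x w ∂(gaussianInit d ν)‖ ≤ 1 := by
  refine norm_le_of_forall_abs_le zero_le_one fun i => ?_
  rw [PiLp.sub_apply, integral_nearVec_apply, nearVec_apply, ← mul_sub, abs_mul,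
    abs_of_nonneg (by positivity : 0 ≤ 1 / √(n : ℝ))]
  gcongr
  refine abs_sub_le_of_nonneg_of_le (near_nonneg _ _) (near_le_one _ _)
    (integral_nonneg fun w => near_nonneg _ _) ?_
  calc ∫ w, near τ ⟪w, (x i : E d)⟫ ∂(gaussianInit d ν) ≤ ∫ _, (1 : ℝ) ∂(gaussianInit d ν) :=
        integral_mono (integrable_near τ (x i)) (integrable_const _) fun w => near_le_one _ _
    _ = 1 := by simp

/-- The concentration inequality for sums of vectors whose mean is not centered but small. -/
theorem measure_pi_norm_sum_ge_le_of_mean_le {Ω H : Type*} [MeasurableSpace Ω]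
    [NormedAddCommGroup H] [InnerProductSpace ℝ H] [CompleteSpace H] (P : Measure Ω)
    [IsProbabilityMeasure P] {Y : Ω → H} (hY : StronglyMeasurable Y) (hint : Integrable Y P)
    (hbd : ∀ w, ‖Y w - ∫ v, Y v ∂P‖ ≤ 1) {c s : ℝ} (hmean : ‖∫ v, Y v ∂P‖ ≤ c) {m : ℕ}
    (hm : 0 < m) (hs : 0 ≤ s) :
    (Measure.pi fun _ : Fin m => P) {W | m * (c + s) ≤ ‖∑ j, Y (W j)‖} ≤
      ENNReal.ofReal (2 * Real.exp (-(m * s ^ 2 / 2))) := by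
  have hm' : (0 : ℝ) < m := Nat.cast_pos.2 hm
  have h0 : ∫ w, (Y w - ∫ v, Y v ∂P) ∂P = 0 := by
    rw [integral_sub hint (integrable_const _)]
    simp
  generalize ∫ w, Y w ∂P = M at hmean hbd h0
  have h := measure_pi_norm_sum_ge_le P (X := fun w => Y w - M)
    (hY.sub stronglyMeasurable_const) one_pos hbd h0 hm (s := m * s) (by positivity)
  refine (measure_mono fun W hW => ?_).trans (h.trans_eq ?_)
  · have h1 : ∑ j, (Y (W j) - M) = ∑ j, Y (W j) - (m : ℝ) • M := by
      rw [Finset.sum_sub_distrib, Finset.sum_const, Finset.card_univ, Fintype.card_fin,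
        Nat.cast_smul_eq_nsmul]
    have h2 := norm_sub_norm_le (∑ j, Y (W j)) ((m : ℝ) • M)
    have h3 : ‖(m : ℝ) • M‖ ≤ m * c := by
      rw [norm_smul, Real.norm_of_nonneg hm'.le]
      gcongr
    have h4 : (m : ℝ) * (c + s) ≤ ‖∑ j, Y (W j)‖ := hW
    change (m : ℝ) * s ≤ ‖∑ j, (Y (W j) - M)‖
    rw [h1]
    linarith
  · congr 3
    field_simp

theorem measure_nearVec_ge_le (hν : 0 < ν) (x : Fin n → S d) {m : ℕ} (hm : 0 < m) {τ s : ℝ}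
    (hτ : 0 ≤ τ) (hs : 0 ≤ s) :
    (Measure.pi fun _ : Fin m => gaussianInit d ν)
        {W | m * (τ / ν + s) ≤ ‖∑ j, nearVec τ x (W j)‖} ≤
      ENNReal.ofReal (2 * Real.exp (-(m * s ^ 2 / 2))) :=
  measure_pi_norm_sum_ge_le_of_mean_le (gaussianInit d ν)
    ((measurable_nearVec τ).comp measurable_prodMk_left).stronglyMeasurable
    (Integrable.of_eval_piLp (integrable_nearVec_apply τ x))
    (norm_nearVec_sub_integral_le τ x) (norm_integral_nearVec_le hν hτ x) hm hs

/-- The contribution of one neuron to the normalized initial predictions. -/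
def outputVec (m : ℕ) (x : Fin n → S d) (w : E d) : EuclideanSpace ℝ (Fin n) :=
  WithLp.toLp 2 fun i => (1 / (√n * √m)) * relu ⟪(x i : E d), w⟫

theorem measurable_outputVec (m : ℕ) :
    Measurable fun p : (Fin n → S d) × E d => outputVec m p.1 p.2 := by
  refine (WithLp.measurable_toLp 2 _).comp (measurable_pi_lambda _ fun i => ?_)
  have hx : Measurable fun p : (Fin n → S d) × E d => ((p.1 i : S d) : E d) :=
    measurable_subtype_coe.comp ((measurable_pi_apply i).comp measurable_fst)
  exact (measurable_relu.comp (hx.inner measurable_snd)).const_mul _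

theorem sum_smul_outputVec_apply {m : ℕ} (x : Fin n → S d) (W : Fin m → E d) (a : Fin m → ℝ)
    (i : Fin n) : (∑ j, a j • outputVec m x (W j)) i = (1 / √n) * network a W (x i) := by
  rw [WithLp.ofLp_sum, Finset.sum_apply, network, Finset.mul_sum, Finset.mul_sum]
  refine Finset.sum_congr rfl fun j _ => ?_
  change a j * ((1 / (√n * √m)) * relu ⟪(x i : E d), W j⟫) = _
  rw [← one_div_mul_one_div]
  ring

/-- The exponential moment of the predictions of one neuron: by convexity of the exponential it is
at most the average over the data points of a moment of a one-dimensional Gaussian. -/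
theorem lintegral_cosh_outputVec_le (hn : 0 < n) {m : ℕ} (hm : 0 < m) {θ : ℝ}
    (hθ : θ ^ 2 * ν ^ 2 ≤ m / 2) (x : Fin n → S d) :
    ∫⁻ w, ENNReal.ofReal (Real.cosh ‖θ • outputVec m x w‖) ∂(gaussianInit d ν) ≤
      ENNReal.ofReal (Real.exp (θ ^ 2 * ν ^ 2 / m)) := by
  have hm' : (0 : ℝ) < m := Nat.cast_pos.2 hm
  have hn' : (0 : ℝ) < n := Nat.cast_pos.2 hn
  have hpt : ∀ w : E d, Real.cosh ‖θ • outputVec m x w‖ ≤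
      ∑ i : Fin n, (1 / (n : ℝ)) * Real.exp (θ ^ 2 / (2 * m) * ⟪w, (x i : E d)⟫ ^ 2) := by
    intro w
    have h1 : ‖θ • outputVec m x w‖ ^ 2 / 2 ≤
        ∑ i : Fin n, (1 / (n : ℝ)) • (θ ^ 2 / (2 * m) * ⟪w, (x i : E d)⟫ ^ 2) := by
      rw [norm_smul, mul_pow, EuclideanSpace.norm_sq_eq, Real.norm_eq_abs, sq_abs, Finset.mul_sum,
        Finset.sum_div]
      refine Finset.sum_le_sum fun i _ => ?_
      change θ ^ 2 * ‖(1 / (√n * √m)) * relu ⟪(x i : E d), w⟫‖ ^ 2 / 2 ≤ _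
      rw [norm_mul, mul_pow, Real.norm_eq_abs, Real.norm_eq_abs, sq_abs, sq_abs, div_pow, mul_pow,
        Real.sq_sqrt hn'.le, Real.sq_sqrt hm'.le, real_inner_comm]
      have h2 : relu ⟪w, (x i : E d)⟫ ^ 2 ≤ ⟪w, (x i : E d)⟫ ^ 2 := by
        unfold relu
        rcases max_cases ⟪w, (x i : E d)⟫ 0 with ⟨h, _⟩ | ⟨h, _⟩ <;> rw [h]
        nlinarith [sq_nonneg ⟪w, (x i : E d)⟫]
      calc θ ^ 2 * (1 ^ 2 / (n * m) * relu ⟪w, (x i : E d)⟫ ^ 2) / 2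
          ≤ θ ^ 2 * (1 ^ 2 / (n * m) * ⟪w, (x i : E d)⟫ ^ 2) / 2 := by gcongr
        _ = _ := by
            rw [smul_eq_mul]
            field_simp
    have h3 := convexOn_exp.map_sum_le (t := Finset.univ) (w := fun _ : Fin n => 1 / (n : ℝ))
      (p := fun i => θ ^ 2 / (2 * m) * ⟪w, (x i : E d)⟫ ^ 2) (fun _ _ => by positivity)
      (by
        rw [Finset.sum_const, Finset.card_univ, Fintype.card_fin, nsmul_eq_mul]
        field_simp) (fun _ _ => Set.mem_univ _)
    calc Real.cosh ‖θ • outputVec m x w‖ ≤ Real.exp (‖θ • outputVec m x w‖ ^ 2 / 2) :=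
          Real.cosh_le_exp_half_sq _
      _ ≤ _ := Real.exp_le_exp.2 h1
      _ ≤ _ := h3
  calc _ ≤ ∫⁻ w, ∑ i : Fin n, ENNReal.ofReal (1 / (n : ℝ)) *
        ENNReal.ofReal (Real.exp (θ ^ 2 / (2 * m) * ⟪w, (x i : E d)⟫ ^ 2)) ∂(gaussianInit d ν) := by
        refine lintegral_mono fun w => ?_
        refine (ENNReal.ofReal_le_ofReal (hpt w)).trans_eq ?_
        rw [ENNReal.ofReal_sum_of_nonneg fun i _ => by positivity]
        exact Finset.sum_congr rfl fun i _ => ENNReal.ofReal_mul (by positivity)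
    _ ≤ ∑ i : Fin n, ENNReal.ofReal (1 / (n : ℝ)) *
        ENNReal.ofReal (Real.exp (θ ^ 2 * ν ^ 2 / m)) := by
        rw [lintegral_finsetSum _ fun i _ => by fun_prop]
        refine Finset.sum_le_sum fun i _ => ?_
        rw [lintegral_const_mul _ (by fun_prop)]
        gcongr
        have h4 := lintegral_exp_inner_sq_le (ν := ν) (s := θ ^ 2 / (2 * m)) (by positivity) (by
          rw [div_mul_eq_mul_div, div_le_iff₀ (by positivity)]
          linarith) (x i)
        refine h4.trans_eq ?_
        congr 2
        field_simp
    _ = _ := by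
        rw [Finset.sum_const, Finset.card_univ, Fintype.card_fin, nsmul_eq_mul, ← mul_assoc,
          ← ENNReal.ofReal_natCast, ← ENNReal.ofReal_mul hn'.le, mul_one_div_cancel hn'.ne',
          ENNReal.ofReal_one, one_mul]

theorem lintegral_pi_prod_eq_pow {Ω : Type*} [MeasurableSpace Ω] (P : Measure Ω)
    [IsProbabilityMeasure P] {g : Ω → ℝ≥0∞} (hg : Measurable g) (m : ℕ) :
    ∫⁻ ω, ∏ j, g (ω j) ∂(Measure.pi fun _ : Fin m => P) = (∫⁻ ω, g ω ∂P) ^ m := by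
  have h := lintegral_prod_eq_prod_lintegral_of_indepFun (μ := Measure.pi fun _ : Fin m => P)
    Finset.univ (fun j ω => g (ω j)) (iIndepFun_pi (X := fun _ => g) fun _ => hg.aemeasurable)
    (fun j => hg.comp (measurable_pi_apply j))
  rw [h]
  have h2 : ∀ j : Fin m, ∫⁻ ω, g (ω j) ∂(Measure.pi fun _ : Fin m => P) = ∫⁻ ω, g ω ∂P := fun j =>
    (measurePreserving_eval (fun _ : Fin m => P) j).lintegral_comp hg
  rw [Finset.prod_congr rfl fun j _ => h2 j, Finset.prod_const, Finset.card_univ, Fintype.card_fin]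

/-- The normalized initial predictions are of the order of the standard deviation `ν` of the
initialization, with a Gaussian tail. -/
theorem measure_output_ge_le (hν : 0 < ν) (hn : 0 < n) {m : ℕ} (hm : 0 < m) {s : ℝ} (hs : 0 ≤ s)
    (hsm : s ^ 2 ≤ 2 * m * ν ^ 2) (x : Fin n → S d) :
    ((Measure.pi fun _ : Fin m => gaussianInit d ν).prod (Measure.pi fun _ : Fin m => signLaw))
        {p | s ≤ ‖∑ j, p.2 j • outputVec m x (p.1 j)‖} ≤
      ENNReal.ofReal (2 * Real.exp (-(s ^ 2 / (4 * ν ^ 2)))) := by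
  have hm' : (0 : ℝ) < m := Nat.cast_pos.2 hm
  -- the minimizer of the Chernoff exponent `θ ^ 2 ν ^ 2 - θ s`
  set θ := s / (2 * ν ^ 2) with hθ
  have hov : Measurable fun w => outputVec m x w :=
    (measurable_outputVec m).comp measurable_prodMk_left
  have hmeas : Measurable fun p : (Fin m → E d) × (Fin m → ℝ) =>
      ∑ j, p.2 j • outputVec m x (p.1 j) :=
    Finset.measurable_fun_sum _ fun j _ =>
      ((measurable_pi_apply j).comp measurable_snd).smul
        (hov.comp ((measurable_pi_apply j).comp measurable_fst))
  have hcosh : Measurable fun w : E d => ENNReal.ofReal (Real.cosh ‖θ • outputVec m x w‖) :=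
    (Real.measurable_cosh.comp (hov.const_smul θ).norm).ennreal_ofReal
  have hexp : -(s ^ 2 / (4 * ν ^ 2)) = θ ^ 2 * ν ^ 2 - θ * s := by
    rw [hθ]
    field_simp
    ring
  rw [hexp]
  refine measure_norm_ge_le_of_lintegral_cosh _ hmeas.stronglyMeasurable (by positivity) ?_
  have hm2 : Measurable fun p : (Fin m → E d) × (Fin m → ℝ) =>
      ENNReal.ofReal (Real.cosh ‖θ • ∑ j, p.2 j • outputVec m x (p.1 j)‖) :=
    (Real.measurable_cosh.comp (hmeas.const_smul θ).norm).ennreal_ofReal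
  rw [lintegral_prod _ hm2.aemeasurable]
  calc _ ≤ ∫⁻ W, ∏ j, ENNReal.ofReal (Real.cosh ‖θ • outputVec m x (W j)‖)
        ∂(Measure.pi fun _ : Fin m => gaussianInit d ν) := by
        refine lintegral_mono fun W => ?_
        have h := lintegral_cosh_norm_sum_signs_le fun j => θ • outputVec m x (W j)
        simp only [smul_comm _ θ, ← Finset.smul_sum] at h
        exact h
    _ = (∫⁻ w, ENNReal.ofReal (Real.cosh ‖θ • outputVec m x w‖) ∂(gaussianInit d ν)) ^ m :=
        lintegral_pi_prod_eq_pow _ hcosh m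
    _ ≤ (ENNReal.ofReal (Real.exp (θ ^ 2 * ν ^ 2 / m))) ^ m := by
        gcongr
        refine lintegral_cosh_outputVec_le hn hm ?_ x
        rw [hθ, div_pow, mul_pow, div_mul_eq_mul_div, div_le_iff₀ (by positivity)]
        nlinarith [mul_le_mul_of_nonneg_right hsm (sq_nonneg ν)]
    _ = _ := by
        rw [← ENNReal.ofReal_pow (Real.exp_pos _).le, ← Real.exp_nat_mul,
          mul_div_cancel₀ _ hm'.ne']

end

/-! ### Gradient descent outside the exceptional events -/

/-- The bound on the training error, for a fixed data set and a fixed initialization with small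
deviations. The induction is self-supporting: the bounds on the errors up to time `t` confine the
weights to a ball of radius `τ` around their initial values, there the dynamics is linear up to the
relative error `κ`, and `κ R ≤ ε₂` says that the accumulated error is of the order assumed. -/
theorem trainError_le {d m n ℓ : ℕ} (hn : 0 < n) (hm : 0 < m) {H : Type*} [NormedAddCommGroup H]
    [InnerProductSpace ℝ H] {ψ : S d → H} (hψ : ∀ x s, ⟪ψ x, ψ s⟫ = kernel x s)
    {e : Fin ℓ → H} (he : Orthonormal ℝ e) {μ c : Fin ℓ → ℝ} {lam σ : ℝ} (hlam : 0 < lam)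
    (hlam1 : lam ≤ 1) (hσ : 0 ≤ σ) (hμ : ∀ i, lam ≤ μ i) (hμ1 : ∀ i, μ i ≤ 1)
    (hc : ∑ i, c i ^ 2 ≤ 1) {f : S d → ℝ} {x : Fin n → S d}
    (hf : ∀ k, f (x k) = ⟪ψ (x k), ∑ i, (c i / √(μ i)) • e i⟫)
    {a : Fin m → ℝ} (ha : ∀ j, a j ^ 2 = 1) {W : Fin m → E d} {s₀ τ κ ε₂ R T : ℝ}
    (hx : ‖∑ k, operatorDeviation ψ e μ (x k)‖ ≤ n * σ)
    (h₀ : ‖∑ j, a j • outputVec m x (W j)‖ ≤ s₀)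
    (hκ : 1 / (m : ℝ) * ‖∑ j, gramDeviation x (W j)‖ +
      2 * (1 / (m : ℝ) * ‖∑ j, nearVec τ x (W j)‖) ≤ κ)
    (hε₂ : 0 ≤ ε₂) (hR : 1 / lam + T * (3 / 2 * (σ / lam) + s₀ + ε₂) ≤ R) (hτ : R / √m ≤ τ)
    (hκR : κ * R ≤ ε₂) (t : ℕ) (ht : (t : ℝ) ≤ T) :
    trainError 1 f x a W t ≤ (1 - lam) ^ t + (3 / 2 * (σ / lam) + s₀ + ε₂) := by
  have hs₀ : 0 ≤ s₀ := (norm_nonneg _).trans h₀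
  have hκ0 : 0 ≤ κ := le_trans (by positivity) hκ
  have hτR : 0 < √(m : ℝ) := Real.sqrt_pos.2 (Nat.cast_pos.2 hm)
  set ε := 3 / 2 * (σ / lam) + s₀ + ε₂ with hε
  have hε0 : 0 ≤ ε := by positivity
  obtain ⟨h, ζ, hh0, hh, hbase⟩ := norm_sampling_add_sqrt_le he hlam hσ hμ hμ1 hlam1 hc
    (norm_empirical_sub_le hn hx)
  set r : ℕ → EuclideanSpace ℝ (Fin n) := fun s =>
    residual f x a (gdIter 1 a x (fun k => f (x k)) W s) with hr
  have hte : ∀ s, trainError 1 f x a W s = ‖r s‖ := fun s => trainError_eq 1 f x a W s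
  have hinit : ‖r 0 - sampling (fun k => ψ (x k)) (h 0)‖ ≤ s₀ := by
    have h1 : r 0 - sampling (fun k => ψ (x k)) (h 0) = -∑ j, a j • outputVec m x (W j) := by
      ext i
      rw [PiLp.sub_apply, PiLp.neg_apply, sum_smul_outputVec_apply, sampling_apply, hh0, ← hf i]
      change (1 / √(n : ℝ)) * (f (x i) - network a W (x i)) - _ = _
      ring
    rw [h1, norm_neg]
    exact h₀
  induction t using Nat.strong_induction_on with
  | _ t ih =>
    have hprev : ∀ s < t, ‖r s‖ ≤ (1 - lam) ^ s + ε := fun s hs => by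
      rw [← hte]
      exact ih s hs ((Nat.cast_le.2 hs.le).trans ht)
    -- the geometric part sums to at most `1 / lam`, the error level `ε` is paid `t ≤ T` times
    have hsum : ∑ s ∈ Finset.range t, ‖r s‖ ≤ R := by
      calc ∑ s ∈ Finset.range t, ‖r s‖ ≤ ∑ s ∈ Finset.range t, ((1 - lam) ^ s + ε) :=
            Finset.sum_le_sum fun s hs => hprev s (Finset.mem_range.1 hs)
        _ = ∑ s ∈ Finset.range t, (1 - lam) ^ s + t * ε := by
            rw [Finset.sum_add_distrib, Finset.sum_const, Finset.card_range, nsmul_eq_mul]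
        _ ≤ 1 / lam + T * ε := by
            refine add_le_add ?_ (by gcongr)
            have hg := geom_sum_mul_neg (1 - lam) t
            rw [sub_sub_cancel] at hg
            rw [le_div_iff₀ hlam, hg]
            linarith [pow_nonneg (sub_nonneg.2 hlam1) t]
        _ ≤ R := hR
    have hdist : ∀ s ≤ t, ∀ j, ‖gdIter 1 a x (fun k => f (x k)) W s j - W j‖ ≤ τ := by
      intro s hs j
      refine (norm_gdIter_sub_le hn f x ha W s j).trans (le_trans ?_ hτ)
      gcongr
      simp only [hte]
      exact (Finset.sum_le_sum_of_subset_of_nonneg (Finset.range_mono hs)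
        fun _ _ _ => norm_nonneg _).trans hsum
    have hstep : ∀ s < t, ‖r (s + 1) - linearStep (fun k => ψ (x k)) (r s)‖ ≤ κ * ‖r s‖ :=
      fun s hs => (norm_residual_gdStep_sub_le hn hm hψ f x ha (hdist s hs.le)
        (hdist (s + 1) hs)).trans (by gcongr)
    have hfin := norm_residual_le (fun k => norm_feature_le_one hψ (x k)) hh hstep
    have hlast : κ * ∑ s ∈ Finset.range t, ‖r s‖ ≤ ε₂ :=
      (mul_le_mul_of_nonneg_left hsum hκ0).trans hκR
    rw [hte]
    linarith [hbase t]

/-! ### The exceptional events -/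

section Probability

theorem measure_prod_le_of_section_le {α β : Type*} [MeasurableSpace α] [MeasurableSpace β]
    (P : Measure α) [IsProbabilityMeasure P] (Q : Measure β) [SFinite Q] {B : Set (α × β)}
    (hB : MeasurableSet B) {c : ℝ≥0∞} (h : ∀ x, Q (Prod.mk x ⁻¹' B) ≤ c) : P.prod Q B ≤ c := by
  rw [Measure.prod_apply hB]
  exact (lintegral_mono h).trans_eq (by simp)

theorem ae_sampleLaw_sign {d : ℕ} (ρ : Measure (S d)) (n m : ℕ) (ν : ℝ) :
    ∀ᵐ ω ∂(sampleLaw ρ n m ν), ∀ j, ω.2.2 j ^ 2 = 1 := by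
  have h : ∀ᵐ a ∂(Measure.pi fun _ : Fin m => signLaw), ∀ j, a j ^ 2 = 1 := by
    refine ae_all_iff.2 fun j => ?_
    filter_upwards [(Measure.tendsto_eval_ae_ae (i := j)).eventually ae_signLaw] with a ha
    rcases ha with ha | ha <;> simp only [Function.eval] at ha <;> simp [ha]
  exact (Measure.quasiMeasurePreserving_snd.comp Measure.quasiMeasurePreserving_snd).ae h

variable {d n m : ℕ} (ρ : Measure (S d)) [IsProbabilityMeasure ρ] {ν : ℝ}

instance isProbabilityMeasure_sampleLaw (n m : ℕ) (ν : ℝ) :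
    IsProbabilityMeasure (sampleLaw ρ n m ν) := by
  unfold sampleLaw
  infer_instance

theorem ae_sampleLaw_data {p : S d → Prop} (hp : ∀ᵐ x ∂ρ, p x) :
    ∀ᵐ ω ∂(sampleLaw ρ n m ν), ∀ i, p (ω.1 i) := by
  have h : ∀ᵐ x ∂(Measure.pi fun _ : Fin n => ρ), ∀ i, p (x i) :=
    ae_all_iff.2 fun i => (Measure.tendsto_eval_ae_ae (i := i)).eventually hp
  exact Measure.quasiMeasurePreserving_fst.ae h

theorem sampleLaw_operatorDeviation_le {H : Type*} [NormedAddCommGroup H] [InnerProductSpace ℝ H]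
    [CompleteSpace H] {ψ : S d → H} (hc : Continuous ψ) (hψ : ∀ x s, ⟪ψ x, ψ s⟫ = kernel x s)
    {ℓ : ℕ} {e : Fin ℓ → H} (he : Orthonormal ℝ e) {μ : Fin ℓ → ℝ}
    (hμ : ∀ i, ∫ x, ⟪ψ x, e i⟫ • ψ x ∂ρ = μ i • e i) (hn : 0 < n) {s : ℝ} (hs : 0 ≤ s) :
    sampleLaw ρ n m ν {ω | s ≤ ‖∑ k, operatorDeviation ψ e μ (ω.1 k)‖} ≤
      ENNReal.ofReal (2 * Real.exp (-(s ^ 2 / (2 * n)))) := by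
  have hB : MeasurableSet {x : Fin n → S d | s ≤ ‖∑ k, operatorDeviation ψ e μ (x k)‖} :=
    measurableSet_le measurable_const
      (stronglyMeasurable_sum_operatorDeviation hc e μ).norm.measurable
  exact (measurePreserving_fst.measure_preimage hB.nullMeasurableSet).trans_le
    (measure_operatorDeviation_ge_le ρ hc hψ he hμ hn hs)

theorem measurable_sum_weights {F : Type*} [MeasurableSpace F] [NormedAddCommGroup F]
    [SecondCountableTopology F] [BorelSpace F] {g : (Fin n → S d) × E d → F} (hg : Measurable g) :
    Measurable fun ω : (Fin n → S d) × (Fin m → E d) × (Fin m → ℝ) =>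
      ∑ j, g (ω.1, ω.2.1 j) :=
  Finset.measurable_fun_sum _ fun j _ => hg.comp
    (measurable_fst.prodMk ((measurable_pi_apply j).comp (measurable_fst.comp measurable_snd)))

/-- A tail bound for a sum over the initial weights that holds for each data set holds for the joint
law. -/
theorem sampleLaw_weights_le {F : Type*} [MeasurableSpace F] [NormedAddCommGroup F]
    [SecondCountableTopology F] [BorelSpace F] {g : (Fin n → S d) × E d → F} (hg : Measurable g)
    {s : ℝ} {c : ℝ≥0∞}
    (h : ∀ x, (Measure.pi fun _ : Fin m => gaussianInit d ν) {W | s ≤ ‖∑ j, g (x, W j)‖} ≤ c) :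
    sampleLaw ρ n m ν {ω | s ≤ ‖∑ j, g (ω.1, ω.2.1 j)‖} ≤ c := by
  have hB : MeasurableSet {ω : (Fin n → S d) × (Fin m → E d) × (Fin m → ℝ) |
      s ≤ ‖∑ j, g (ω.1, ω.2.1 j)‖} :=
    measurableSet_le measurable_const (measurable_sum_weights hg).norm
  refine measure_prod_le_of_section_le _ _ hB fun x => ?_
  have hB' : MeasurableSet {W : Fin m → E d | s ≤ ‖∑ j, g (x, W j)‖} :=
    measurableSet_le measurable_const (Finset.measurable_fun_sum _ fun j _ =>
      hg.comp (measurable_const.prodMk (measurable_pi_apply j))).norm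
  exact (measurePreserving_fst.measure_preimage hB'.nullMeasurableSet).trans_le (h x)

theorem sampleLaw_signed_weights_le {F : Type*} [MeasurableSpace F] [NormedAddCommGroup F]
    [NormedSpace ℝ F] [SecondCountableTopology F] [BorelSpace F] {g : (Fin n → S d) × E d → F}
    (hg : Measurable g) {s : ℝ} {c : ℝ≥0∞}
    (h : ∀ x, ((Measure.pi fun _ : Fin m => gaussianInit d ν).prod
      (Measure.pi fun _ : Fin m => signLaw)) {p | s ≤ ‖∑ j, p.2 j • g (x, p.1 j)‖} ≤ c) :
    sampleLaw ρ n m ν {ω | s ≤ ‖∑ j, ω.2.2 j • g (ω.1, ω.2.1 j)‖} ≤ c := by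
  have hB : MeasurableSet {ω : (Fin n → S d) × (Fin m → E d) × (Fin m → ℝ) |
      s ≤ ‖∑ j, ω.2.2 j • g (ω.1, ω.2.1 j)‖} := by
    have hj : ∀ j, Measurable fun ω : (Fin n → S d) × (Fin m → E d) × (Fin m → ℝ) =>
        ω.2.2 j • g (ω.1, ω.2.1 j) := fun j =>
      Measurable.fun_smul ((measurable_pi_apply j).comp (measurable_snd.comp measurable_snd))
        (hg.comp (measurable_fst.prodMk
          ((measurable_pi_apply j).comp (measurable_fst.comp measurable_snd))))
    exact measurableSet_le measurable_const (Finset.measurable_fun_sum _ fun j _ => hj j).norm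
  exact measure_prod_le_of_section_le _ _ hB h

end Probability

/-! ### The choice of the constants -/

theorem sq_log_le {x : ℝ} (hx : 1 ≤ x) : Real.log x ^ 2 ≤ 16 * √x := by
  have h0 : 0 ≤ Real.log x := Real.log_nonneg hx
  have h1 : Real.log x = 4 * Real.log (√(√x)) := by
    rw [Real.log_sqrt (Real.sqrt_nonneg _), Real.log_sqrt (by linarith)]
    ring
  have h2 : Real.log (√(√x)) ≤ √(√x) := Real.log_le_self (Real.sqrt_nonneg _)
  have h3 : Real.log x ≤ 4 * √(√x) := by linarith
  calc Real.log x ^ 2 ≤ (4 * √(√x)) ^ 2 := by gcongr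
    _ = 16 * √x := by rw [mul_pow, Real.sq_sqrt (Real.sqrt_nonneg _)]; norm_num

/-- The numerical heart of the choice of constants, in terms of `N = √n`, `q = √(log (2 / δ))`,
`l = log n`, `A = 1 / λ`, `M = √m` and the spectral gap `G`. The radius `R` bounds the sum of the
training errors, `5 A q / N + ε₂` is the error level to be maintained, and the coefficient of `R` in
the second estimate is the relative error of linearization; the width enters through `hM` alone. -/
theorem exists_radius {N q l A G M : ℝ} (hN : 1 ≤ N) (hq : 1 ≤ q) (hl : 0 ≤ l)
    (hlN : l ^ 2 ≤ 16 * N) (hA : 1 ≤ A) (hG : 0 < G) (hGA : G * A ≤ 1) (hqN : 16 * q ≤ N * G)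
    (hM0 : 0 < M) (hM : 111 * (G * N ^ 2 * (A + l / (G * N)) ^ 2) ≤ M) :
    ∃ R ε₂ : ℝ, 0 ≤ R ∧ 0 ≤ ε₂ ∧ A + l * (5 * A * q / N + ε₂) ≤ R ∧
      (6 * (q / M) + 2 * (R / M * N)) * R ≤ ε₂ ∧
      5 * A * q / N + ε₂ ≤ 7 * q / (N * G) := by
  have hN0 : 0 < N := by linarith
  have hNG : 0 < N * G := by positivity
  have hG1 : G ≤ 1 := by nlinarith
  set b := l / (G * N) with hb
  have hb0 : 0 ≤ b := by positivity
  set p := l * q / N with hp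
  have hp0 : 0 ≤ p := by positivity
  -- `b p ≤ 1` is where `log n ≤ 4 n^{1/4}` is needed
  have hbp : b * p ≤ 1 := by
    have h1 : b * p = l ^ 2 * q / (N * (N * G)) := by
      rw [hb, hp]
      field_simp
    rw [h1, div_le_one (by positivity)]
    calc l ^ 2 * q ≤ 16 * N * q := by gcongr
      _ = N * (16 * q) := by ring
      _ ≤ N * (N * G) := by gcongr
  have hp2 : p ^ 2 ≤ q := by
    have h1 : p ^ 2 = l ^ 2 * q * q / N ^ 2 := by
      rw [hp]
      field_simp
    rw [h1, div_le_iff₀ (by positivity)]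
    have h2 : l ^ 2 * q ≤ N ^ 2 := by
      calc l ^ 2 * q ≤ 16 * N * q := by gcongr
        _ = N * (16 * q) := by ring
        _ ≤ N * (N * G) := by gcongr
        _ ≤ N * (N * 1) := by gcongr
        _ = N ^ 2 := by ring
    nlinarith
  -- an upper bound for `A + l (5 A q / N + ε₂) = A + 5 A p + b (1 + p ^ 2)`, by `b p ^ 2 ≤ p ≤ A p`
  set R := A * (1 + 6 * p) + b with hR
  have hR1 : 1 ≤ R := by nlinarith [mul_nonneg (by linarith : 0 ≤ A) hp0]
  refine ⟨R, (1 + p ^ 2) / (N * G), by linarith, by positivity, ?_, ?_, ?_⟩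
  · have h1 : A + l * (5 * A * q / N + (1 + p ^ 2) / (N * G)) =
        A + 5 * A * p + b * (1 + p ^ 2) := by
      rw [hb, hp]
      field_simp
      ring
    rw [h1]
    nlinarith [mul_le_mul_of_nonneg_right hbp hp0, mul_le_mul_of_nonneg_right hA hp0]
  · have hR2 : R ^ 2 ≤ 37 * (1 + p ^ 2) * (A + b) ^ 2 := by
      have h1 : R ≤ (1 + 6 * p) * (A + b) := by nlinarith [mul_nonneg hp0 hb0]
      calc R ^ 2 ≤ ((1 + 6 * p) * (A + b)) ^ 2 := by gcongr
        _ = (1 + 6 * p) ^ 2 * (A + b) ^ 2 := by ring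
        _ ≤ 37 * (1 + p ^ 2) * (A + b) ^ 2 := by
          gcongr
          nlinarith [sq_nonneg (6 - p)]
    have h6 : 6 * q ≤ N * R := by nlinarith
    have h3 : (6 * (q / M) + 2 * (R / M * N)) * R = (6 * q + 2 * (N * R)) * R / M := by
      field_simp
    rw [h3, div_le_div_iff₀ hM0 hNG]
    calc (6 * q + 2 * (N * R)) * R * (N * G) ≤ (N * R + 2 * (N * R)) * R * (N * G) := by gcongr
      _ = 3 * (G * N ^ 2) * R ^ 2 := by ring
      _ ≤ 3 * (G * N ^ 2) * (37 * (1 + p ^ 2) * (A + b) ^ 2) := by gcongr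
      _ = (1 + p ^ 2) * (111 * (G * N ^ 2 * (A + b) ^ 2)) := by ring
      _ ≤ (1 + p ^ 2) * M := by gcongr
  · have h1 : 5 * A * q / N = 5 * (G * A) * q / (N * G) := by
      field_simp
    rw [h1, ← add_div]
    gcongr
    nlinarith

/-- The choice of the radius under the assumptions on the sample size and the width, with
`q ^ 2 = log (2 / δ)`. -/
theorem exists_radius_of_width {n m : ℕ} {lam G q : ℝ} (hq1 : 1 ≤ q) (hG : 0 < G) (hGl : G ≤ lam)
    (hlam1 : lam ≤ 1) (hn : 256 * q ^ 2 / G ^ 2 < n)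
    (hm : 12321 * (G ^ 2 * (n : ℝ) ^ 2 * (1 / lam + Real.log n / (G * √n)) ^ 4) ≤ m) :
    0 < n ∧ 0 < m ∧ 2 * q ^ 2 ≤ m ∧ ∃ R ε₂ : ℝ, 0 ≤ R ∧ 0 ≤ ε₂ ∧
      1 / lam + Real.log n * (3 / 2 * (√2 * q / √n / lam) + 2 * q / √n + ε₂) ≤ R ∧
      (2 * q / √m + 2 * (R / √m / (1 / √n) + 2 * q / √m)) * R ≤ ε₂ ∧
      3 / 2 * (√2 * q / √n / lam) + 2 * q / √n + ε₂ ≤ 16 * (√2 * q) / (√n * G) := by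
  have hlam : 0 < lam := hG.trans_le hGl
  have hq0 : 0 < q := by linarith
  have hnL : 256 * q ^ 2 < n * G ^ 2 := by rwa [div_lt_iff₀ (by positivity)] at hn
  have hn0' : (0 : ℝ) < n := lt_of_le_of_lt (by positivity) hn
  have hn0 : 0 < n := Nat.cast_pos.1 hn0'
  have hn1 : (1 : ℝ) ≤ n := by exact_mod_cast hn0
  have hl0 : 0 ≤ Real.log n := Real.log_nonneg hn1
  have hlN := sq_log_le hn1
  have hN1 : 1 ≤ √(n : ℝ) := Real.one_le_sqrt.2 hn1
  have hN2 : √(n : ℝ) ^ 2 = n := Real.sq_sqrt hn0'.le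
  generalize √(n : ℝ) = N at *
  generalize Real.log n = l at *
  have hN0 : 0 < N := by linarith
  have hqN : 16 * q ≤ N * G := by
    refine le_of_sq_le_sq ?_ (by positivity)
    rw [mul_pow, mul_pow, hN2]
    linarith
  have hA1 : 1 ≤ 1 / lam := (one_le_div hlam).2 hlam1
  have hm' : (111 * (G * N ^ 2 * (1 / lam + l / (G * N)) ^ 2)) ^ 2 ≤ m := by
    refine le_of_eq_of_le ?_ hm
    rw [hN2]
    ring
  have hM := Real.le_sqrt_of_sq_le hm'
  have hM0 : 0 < √(m : ℝ) := lt_of_lt_of_le (by positivity) hM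
  obtain ⟨R, ε₂, hR0, hε₂, hR, hκR, hεε⟩ := exists_radius hN1 hq1 hl0 hlN hA1 hG
    (by rw [mul_one_div, div_le_one hlam]; exact hGl) hqN hM0 hM
  have hε : 3 / 2 * (√2 * q / N / lam) + 2 * q / N ≤ 5 * (1 / lam) * q / N := by
    have hsqrt2 : √(2 : ℝ) ≤ 2 := by
      rw [Real.sqrt_le_left (by norm_num)]
      norm_num
    calc 3 / 2 * (√2 * q / N / lam) + 2 * q / N
        ≤ 3 / 2 * (2 * q / N / lam) + 2 * q / N * (1 / lam) :=
          add_le_add (by gcongr) (le_mul_of_one_le_right (by positivity) hA1)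
      _ = 5 * (1 / lam) * q / N := by
        field_simp
        norm_num
  have hε' := add_le_add_left hε ε₂
  refine ⟨hn0, Nat.cast_pos.1 (Real.sqrt_pos.1 hM0), ?_, R, ε₂, hR0, hε₂,
    le_trans (by gcongr) hR, le_of_eq_of_le ?_ hκR, hε'.trans (hεε.trans ?_)⟩
  · have h1 : 1 ≤ (1 / lam + l / (G * N)) ^ 2 :=
      one_le_pow₀ (hA1.trans (le_add_of_nonneg_right (by positivity)))
    have h2 : q ≤ G * N ^ 2 * (1 / lam + l / (G * N)) ^ 2 := by
      calc q ≤ (N * G) * 1 * 1 := by linarith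
        _ ≤ (N * G) * N * (1 / lam + l / (G * N)) ^ 2 := by gcongr
        _ = G * N ^ 2 * (1 / lam + l / (G * N)) ^ 2 := by ring
    calc 2 * q ^ 2 ≤ (111 * q) ^ 2 := by nlinarith [sq_nonneg q]
      _ ≤ (111 * (G * N ^ 2 * (1 / lam + l / (G * N)) ^ 2)) ^ 2 := by gcongr
      _ ≤ m := hm'
  · rw [div_div_eq_mul_div, div_one]
    ring
  · have : 1 ≤ √(2 : ℝ) := Real.one_le_sqrt.2 (by norm_num)
    gcongr
    · norm_num
    · exact le_mul_of_one_le_left hq0.le this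

/-! ### The probability of the error bound -/

/-- A set that contains the complement of an exceptional set almost everywhere has large measure;
neither set needs to be measurable. -/
theorem one_sub_le_measureReal {Ω : Type*} [MeasurableSpace Ω] (P : Measure Ω)
    [IsProbabilityMeasure P] {A B : Set Ω} {ε : ℝ} (hε : 0 ≤ ε) (h : ∀ᵐ ω ∂P, ω ∉ B → ω ∈ A)
    (hB : P B ≤ ENNReal.ofReal ε) : 1 - ε ≤ P.real A := by
  have h1 : (1 : ℝ) ≤ P.real A + P.real B := by
    have h2 : P Set.univ ≤ P (A ∪ B) := by
      refine measure_mono_ae ?_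
      filter_upwards [h] with ω hω _
      by_cases hωB : ω ∈ B
      · exact Or.inr hωB
      · exact Or.inl (hω hωB)
    have h3 := ENNReal.toReal_mono (measure_ne_top _ _) h2
    rw [measure_univ, ENNReal.toReal_one] at h3
    exact h3.trans (measureReal_union_le A B)
  have h4 : P.real B ≤ ε := ENNReal.toReal_le_of_le_ofReal hε hB
  linarith

section Main

variable {d : ℕ} (ρ : Measure (S d)) [IsProbabilityMeasure ρ]

theorem distinctEig_le_one {i : ℕ} (h : 0 < distinctEig ρ i) : distinctEig ρ i ≤ 1 :=
  le_one_of_mem_eigs ρ (distinctEig_mem_eigs ρ h)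

theorem gap_pos {j : ℕ} (h : ∀ k ≤ j, 0 < distinctEig ρ k) : 0 < gap ρ (j + 1) := by
  rw [gap, eig_multSum ρ h]
  exact sub_pos.2 (eig_multSum_succ_lt ρ h)

theorem gap_le_eig (ℓ : ℕ) : gap ρ ℓ ≤ eig ρ (multSum ρ ℓ) :=
  sub_le_self _ (eig_nonneg ρ _)

/-- The exceptional events together have probability at most `3 δ`. Each of them is a large
deviation: of the empirical kernel operator on the leading eigenvectors, of the initial predictions,
of the Gram matrix of the gradient features, and of the number of neurons close to the kink of the
activation. Here `q ^ 2 = log (2 / δ)`. -/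
theorem sampleLaw_exceptional_le {H : Type*} [NormedAddCommGroup H] [InnerProductSpace ℝ H]
    [CompleteSpace H] {ψ : S d → H} (hψc : Continuous ψ)
    (hψ : ∀ x s, ⟪ψ x, ψ s⟫ = kernel x s) {ℓ : ℕ} {e : Fin ℓ → H} (he : Orthonormal ℝ e)
    {μ : Fin ℓ → ℝ} (heig : ∀ i, ∫ x, ⟪ψ x, e i⟫ • ψ x ∂ρ = μ i • e i) {n m : ℕ} (hn : 0 < n)
    (hm : 0 < m) {q δ τ : ℝ} (hq : 0 ≤ q) (hδ : 0 ≤ δ) (hδ1 : δ ≤ 1)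
    (hexp : Real.exp (-q ^ 2) = δ / 2) (hqm : 2 * q ^ 2 ≤ m) (hτ : 0 ≤ τ) :
    sampleLaw ρ n m (1 / √n) (({ω | n * (√2 * q / √n) ≤ ‖∑ k, operatorDeviation ψ e μ (ω.1 k)‖} ∪
        {ω | 2 * q / √n ≤ ‖∑ k, ω.2.2 k • outputVec m ω.1 (ω.2.1 k)‖}) ∪
      ({ω | m * (2 * q / √m) ≤ ‖∑ k, gramDeviation ω.1 (ω.2.1 k)‖} ∪
        {ω | m * (τ / (1 / √n) + 2 * q / √m) ≤ ‖∑ k, nearVec τ ω.1 (ω.2.1 k)‖})) ≤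
      ENNReal.ofReal (3 * δ) := by
  have hn' : (0 : ℝ) < n := Nat.cast_pos.2 hn
  have hm' : (0 : ℝ) < m := Nat.cast_pos.2 hm
  have hN0 : 0 < √(n : ℝ) := Real.sqrt_pos.2 hn'
  have hM0 : 0 < √(m : ℝ) := Real.sqrt_pos.2 hm'
  have hN2 : √(n : ℝ) ^ 2 = n := Real.sq_sqrt hn'.le
  have hM2 : √(m : ℝ) ^ 2 = m := Real.sq_sqrt hm'.le
  have hν : 0 < 1 / √(n : ℝ) := by positivity
  have htail1 : ENNReal.ofReal (2 * Real.exp (-q ^ 2)) = ENNReal.ofReal δ := by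
    rw [hexp]
    congr 1
    ring
  have htail2 : ENNReal.ofReal (2 * Real.exp (-(m * (2 * q / √m) ^ 2 / 2))) ≤
      ENNReal.ofReal (δ / 2) := by
    refine ENNReal.ofReal_le_ofReal ?_
    have h1 : m * (2 * q / √(m : ℝ)) ^ 2 / 2 = q ^ 2 + q ^ 2 := by
      rw [div_pow, hM2]
      field_simp
      ring
    rw [h1, neg_add, Real.exp_add, hexp]
    nlinarith
  have hB₁ : sampleLaw ρ n m (1 / √n)
      {ω | n * (√2 * q / √n) ≤ ‖∑ k, operatorDeviation ψ e μ (ω.1 k)‖} ≤ ENNReal.ofReal δ := by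
    refine (sampleLaw_operatorDeviation_le ρ hψc hψ he heig hn (by positivity)).trans_eq ?_
    have h1 : (n * (√2 * q / √(n : ℝ))) ^ 2 / (2 * n) = q ^ 2 := by
      rw [mul_pow, div_pow, mul_pow, Real.sq_sqrt (by norm_num), hN2]
      field_simp
    rw [h1, htail1]
  have hB₂ : sampleLaw ρ n m (1 / √n)
      {ω | 2 * q / √n ≤ ‖∑ k, ω.2.2 k • outputVec m ω.1 (ω.2.1 k)‖} ≤ ENNReal.ofReal δ := by
    refine sampleLaw_signed_weights_le ρ (measurable_outputVec m) fun x =>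
      (measure_output_ge_le hν hn hm (by positivity) ?_ x).trans_eq ?_
    · rw [div_pow, div_pow, hN2, one_pow, mul_one_div]
      exact div_le_div_of_nonneg_right (by linarith) hn'.le
    · have h1 : (2 * q / √(n : ℝ)) ^ 2 / (4 * (1 / √n) ^ 2) = q ^ 2 := by
        field_simp
        ring
      rw [h1, htail1]
  have hB₃ : sampleLaw ρ n m (1 / √n)
      {ω | m * (2 * q / √m) ≤ ‖∑ k, gramDeviation ω.1 (ω.2.1 k)‖} ≤ ENNReal.ofReal (δ / 2) :=
    sampleLaw_weights_le ρ measurable_gramDeviation fun x =>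
      (measure_gramDeviation_ge_le hν x hm (by positivity)).trans htail2
  have hB₄ : sampleLaw ρ n m (1 / √n)
      {ω | m * (τ / (1 / √n) + 2 * q / √m) ≤ ‖∑ k, nearVec τ ω.1 (ω.2.1 k)‖} ≤
      ENNReal.ofReal (δ / 2) :=
    sampleLaw_weights_le ρ (measurable_nearVec τ) fun x =>
      (measure_nearVec_ge_le hν x hm hτ (by positivity)).trans htail2
  refine (measure_union_le _ _).trans ((add_le_add ((measure_union_le _ _).trans
    (add_le_add hB₁ hB₂)) ((measure_union_le _ _).trans (add_le_add hB₃ hB₄))).trans_eq ?_)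
  rw [← ENNReal.ofReal_add hδ hδ, ← ENNReal.ofReal_add (by positivity) (by positivity),
    ← ENNReal.ofReal_add (by positivity) (by positivity)]
  congr 1
  ring

/-- A target without approximation error is represented, on almost every data point, by a vector
in the span of the leading eigenvectors of the feature covariance. -/
theorem exists_feature_representation {H : Type*} [NormedAddCommGroup H] [InnerProductSpace ℝ H]
    [CompleteSpace H] {ψ : S d → H} (hψc : Continuous ψ) (hψ : ∀ x s, ⟪ψ x, ψ s⟫ = kernel x s)
    {f : S d → ℝ} (hf : Measurable f) (hb : ∀ᵐ x ∂ρ, f x ∈ Set.Icc (-1) 1) {ℓ : ℕ}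
    (hpos : ∀ i < ℓ, 0 < distinctEig ρ i)
    (h0 : approxError ρ f (memLp_target ρ hf hb) ℓ = 0) :
    ∃ (e : Fin ℓ → H) (c : Fin ℓ → ℝ), Orthonormal ℝ e ∧
      (∀ i : Fin ℓ, ∫ x, ⟪ψ x, e i⟫ • ψ x ∂ρ = distinctEig ρ i • e i) ∧ ∑ i, c i ^ 2 ≤ 1 ∧
      ∀ᵐ x ∂ρ, f x = ⟪ψ x, ∑ i : Fin ℓ, (c i / √(distinctEig ρ i)) • e i⟫ := by
  obtain ⟨u, c, hu, hLu, hc, hfu⟩ := exists_eigenfunctions ρ hf hb hpos h0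
  have hμpos : ∀ i : Fin ℓ, 0 < distinctEig ρ i := fun i => hpos i i.2
  obtain ⟨e, he, heig, heu⟩ := exists_feature_eigenvectors ρ hψc hψ hu hμpos hLu
  refine ⟨e, c, he, heig, hc, ?_⟩
  filter_upwards [hfu, ae_all_iff.2 heu] with x hx1 hx2
  rw [hx1, inner_sum]
  refine Finset.sum_congr rfl fun i _ => ?_
  have : √(distinctEig ρ i) ≠ 0 := (Real.sqrt_pos.2 (hμpos i)).ne'
  rw [inner_smul_right, hx2 i]
  field_simp

/-- The training error bound with the width condition for an explicit absolute constant. -/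
theorem one_sub_le_sampleLaw_goodEvent {f : S d → ℝ} (hf : Measurable f)
    (hb : ∀ᵐ x ∂ρ, f x ∈ Set.Icc (-1) 1) {j : ℕ} (hpos : ∀ k ≤ j, 0 < distinctEig ρ k)
    (h0 : approxError ρ f (memLp_target ρ hf hb) (j + 1) = 0) {δ : ℝ} (hδ : 0 < δ)
    (hδ4 : δ < 1 / 4) {n m : ℕ} (hn : 256 * Real.log (2 / δ) / gap ρ (j + 1) ^ 2 < n)
    (hm : 12321 * (gap ρ (j + 1) ^ 2 * (n : ℝ) ^ 2 * (1 / eig ρ (multSum ρ (j + 1)) +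
      Real.log n / (gap ρ (j + 1) * √n)) ^ 4) ≤ m) :
    1 - 3 * δ ≤ (sampleLaw ρ n m (1 / √n)).real
      (goodEvent ρ f (j + 1) n m 1 (Real.log (n * gap ρ (j + 1)))
        (16 * √(2 * Real.log (2 / δ)) / (√n * gap ρ (j + 1)))) := by
  have hG := gap_pos ρ hpos
  have hGl := gap_le_eig ρ (j + 1)
  have hlam := hG.trans_le hGl
  have hlam1 : eig ρ (multSum ρ (j + 1)) ≤ 1 := by
    rw [eig_multSum ρ hpos]
    exact distinctEig_le_one ρ (hpos j le_rfl)
  have hlamμ : ∀ k ≤ j, eig ρ (multSum ρ (j + 1)) ≤ distinctEig ρ k := fun k hk => by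
    rw [eig_multSum ρ hpos]
    exact distinctEig_le_of_le ρ hk hpos
  have hL1 : 1 ≤ Real.log (2 / δ) := by
    rw [Real.le_log_iff_exp_le (by positivity), le_div_iff₀ hδ]
    have := Real.exp_one_lt_d9
    nlinarith
  have hexpL : Real.exp (-Real.log (2 / δ)) = δ / 2 := by
    rw [Real.exp_neg, Real.exp_log (by positivity), inv_div]
  have hq1 : 1 ≤ √(Real.log (2 / δ)) := Real.one_le_sqrt.2 hL1
  have hq2 := Real.sq_sqrt (zero_le_one.trans hL1)
  -- from here on `q` stands for `√(log (2 / δ))`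
  rw [Real.sqrt_mul (by norm_num)]
  rw [← hq2] at hn hexpL
  generalize √(Real.log (2 / δ)) = q at *
  obtain ⟨hn0, hm0, hqm, R, ε₂, hR0, hε₂, hR, hκR, hεε⟩ :=
    exists_radius_of_width hq1 hG hGl hlam1 hn hm
  obtain ⟨ψ, hψc, hψ⟩ := exists_featureMap d
  obtain ⟨e, c, he, heig, hc, hfe⟩ := exists_feature_representation ρ hψc hψ hf hb
    (fun i hi => hpos i (Nat.lt_succ_iff.1 hi)) h0
  have hq0 : 0 ≤ q := zero_le_one.trans hq1
  have hm' : (0 : ℝ) < m := Nat.cast_pos.2 hm0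
  have hn' : (0 : ℝ) < n := Nat.cast_pos.2 hn0
  refine one_sub_le_measureReal _ (by positivity) ?_ (sampleLaw_exceptional_le ρ hψc hψ he
    (μ := fun i : Fin (j + 1) => distinctEig ρ i) heig hn0 hm0 hq0 hδ.le (by linarith) hexpL hqm
    (τ := R / √m) (by positivity))
  filter_upwards [ae_sampleLaw_data ρ hfe, ae_sampleLaw_sign ρ n m (1 / √n)]
    with ω hω1 hω2 hω t ht
  simp only [Set.mem_union, Set.mem_ofPred_eq, not_or, not_le] at hω
  obtain ⟨⟨h1, h2⟩, h3, h4⟩ := hω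
  have h5 := (div_le_iff₀' hm').2 h3.le
  have h6 := (div_le_iff₀' hm').2 h4.le
  rw [← one_div_mul_eq_div] at h5 h6
  have hmain := trainError_le hn0 hm0 hψ he hlam hlam1 (by positivity)
    (fun i => hlamμ i (Nat.lt_succ_iff.1 i.2))
    (fun i => distinctEig_le_one ρ (hpos i (Nat.lt_succ_iff.1 i.2))) hc hω1 hω2 h1.le h2.le
    (add_le_add h5 (mul_le_mul_of_nonneg_left h6 zero_le_two)) hε₂ hR le_rfl hκR t
    (ht.trans (Real.log_le_log (by positivity)
      (mul_le_of_le_one_right hn'.le (hGl.trans hlam1))))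
  exact hmain.trans (add_le_add (pow_le_pow_left₀ (by linarith) (by linarith) _) hεε)

end Main

end TwoLayer

end

theorem corollary2 :
    ∃ C : ℝ, 0 < C ∧
      ∀ (d : ℕ) (ρ : Measure (TwoLayer.S d)) [IsProbabilityMeasure ρ],
        TwoLayer.NoParallel ρ →
      ∀ (f : TwoLayer.S d → ℝ) (hf : Measurable f) (hb : ∀ᵐ x ∂ρ, f x ∈ Set.Icc (-1) 1) (ℓ : ℕ),
        1 ≤ ℓ → (∀ i < ℓ, 0 < TwoLayer.distinctEig ρ i) →
        TwoLayer.approxError ρ f (TwoLayer.memLp_target ρ hf hb) ℓ = 0 →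
        -- the bound under the explicit width condition, with an absolute constant
        (∀ δ : ℝ, 0 < δ → δ < 1 / 4 → ∀ n m : ℕ,
          max (256 * Real.log (2 / δ) / TwoLayer.gap ρ ℓ ^ 2) (TwoLayer.multSum ρ ℓ : ℝ) < n →
          C * (TwoLayer.gap ρ ℓ ^ 2 * (n : ℝ) ^ 2 *
            (1 / TwoLayer.eig ρ (TwoLayer.multSum ρ ℓ) +
              Real.log n / (TwoLayer.gap ρ ℓ * Real.sqrt n)) ^ 4) ≤ m →
          1 - 3 * δ ≤ (TwoLayer.sampleLaw ρ n m (1 / Real.sqrt n)).real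
            (TwoLayer.goodEvent ρ f ℓ n m 1 (Real.log (n * TwoLayer.gap ρ ℓ))
              (16 * Real.sqrt (2 * Real.log (2 / δ)) / (Real.sqrt n * TwoLayer.gap ρ ℓ)))) ∧
        -- quadratic width suffices, with a linear rate that does not depend on `n`
        0 < TwoLayer.gap ρ ℓ ∧
        0 < 1 - 3 * TwoLayer.eig ρ (TwoLayer.multSum ρ ℓ) / 4 ∧
        1 - 3 * TwoLayer.eig ρ (TwoLayer.multSum ρ ℓ) / 4 < 1 ∧
        ∃ c : ℝ, 0 < c ∧
          ∀ δ : ℝ, 0 < δ → δ < 1 / 4 → ∀ n m : ℕ,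
            max (256 * Real.log (2 / δ) / TwoLayer.gap ρ ℓ ^ 2) (TwoLayer.multSum ρ ℓ : ℝ) < n →
            c * (n : ℝ) ^ 2 ≤ m →
            1 - 3 * δ ≤ (TwoLayer.sampleLaw ρ n m (1 / Real.sqrt n)).real
              (TwoLayer.goodEvent ρ f ℓ n m 1 (Real.log (n * TwoLayer.gap ρ ℓ))
                (16 * Real.sqrt (2 * Real.log (2 / δ)) /
                  (Real.sqrt n * TwoLayer.gap ρ ℓ))) := by
  refine ⟨12321, by norm_num, ?_⟩
  intro d ρ _ _ f hf hb ℓ hℓ hpos h0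
  obtain ⟨j, rfl⟩ := Nat.exists_eq_add_of_le' hℓ
  have hpos' : ∀ k ≤ j, 0 < TwoLayer.distinctEig ρ k := fun k hk => hpos k (Nat.lt_succ_of_le hk)
  have hG := TwoLayer.gap_pos ρ hpos'
  have hlam : 0 < TwoLayer.eig ρ (TwoLayer.multSum ρ (j + 1)) :=
    hG.trans_le (TwoLayer.gap_le_eig ρ (j + 1))
  have hlam1 : TwoLayer.eig ρ (TwoLayer.multSum ρ (j + 1)) ≤ 1 := by
    rw [TwoLayer.eig_multSum ρ hpos']
    exact TwoLayer.distinctEig_le_one ρ (hpos' j le_rfl)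
  refine ⟨fun δ hδ hδ4 n m hn hm => TwoLayer.one_sub_le_sampleLaw_goodEvent ρ hf hb hpos' h0 hδ hδ4
    ((le_max_left _ _).trans_lt hn) hm, hG, by linarith, by linarith, ?_⟩
  set G := TwoLayer.gap ρ (j + 1) with hGdef
  set lam := TwoLayer.eig ρ (TwoLayer.multSum ρ (j + 1)) with hlamdef
  refine ⟨12321 * (G ^ 2 * (1 / lam + 2 / G) ^ 4), by positivity, fun δ hδ hδ4 n m hn hm =>
    TwoLayer.one_sub_le_sampleLaw_goodEvent ρ hf hb hpos' h0 hδ hδ4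
      ((le_max_left _ _).trans_lt hn) (le_trans ?_ hm)⟩
  have hn0' : (0 : ℝ) < n := by
    refine lt_of_le_of_lt ?_ ((le_max_right _ _).trans_lt hn)
    positivity
  have hn1 : (1 : ℝ) ≤ n := by exact_mod_cast Nat.cast_pos.1 hn0'
  have hN0 : 0 < √(n : ℝ) := Real.sqrt_pos.2 hn0'
  have hl0 : 0 ≤ Real.log n := Real.log_nonneg hn1
  -- the logarithmic term of the width condition is bounded, since `log n ≤ 2 √n`
  have hlog : Real.log n / (G * √n) ≤ 2 / G := by
    have h1 : Real.log n = 2 * Real.log (√n) := by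
      rw [Real.log_sqrt hn0'.le]
      ring
    have h2 := Real.log_le_self hN0.le
    rw [div_le_div_iff₀ (by positivity) hG]
    nlinarith
  calc 12321 * (G ^ 2 * (n : ℝ) ^ 2 * (1 / lam + Real.log n / (G * √n)) ^ 4)
      ≤ 12321 * (G ^ 2 * (n : ℝ) ^ 2 * (1 / lam + 2 / G) ^ 4) := by gcongr
    _ = 12321 * (G ^ 2 * (1 / lam + 2 / G) ^ 4) * (n : ℝ) ^ 2 := by ring
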